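/- Conventions. A II$_1$ factor $M$ is an infinite-dimensional von Neumann algebra with trivial centre which admits a faithful normal tracial state $\tau$; put $\|x\|_2=\tau(x^*x)^{1/2}$, let $L^2(M)$ be the completion of $M$ in $\|\cdot\|_2$ (an $M$-$M$-bimodule), and let $(M)_1$ be the operator-norm unit ball of $M$. $M$ is full if for every $\varepsilon>0$ there are a finite $F\subseteq M$ and $\delta>0$ such that every $x\in (M)_1$ with $\max_{y\in F}\|xy-yx\|_2<\delta$ satisfies $\|x-\tau(x)1\|_2<\varepsilon$ (i.e. $M$ does not have property Gamma). For a von Neumann subalgebra $A\subseteq M$, a spectral gap number for $A\subseteq M$ is a real $C>0$ for which there is a finite $F\subseteq (A)_1$ with $|F|\le C$ and $$\|\xi-E_{A'\cap M}(\xi)\|_2^2\le C\sum_{x\in F}\|x\xi-\xi x\|_2^2\qquad\text{for all }\xi\in L^2(M),$$ where $E_{A'\cap M}$ is the orthogonal projection of $L^2(M)$ onto the closure of $A'\cap M$. Let $\mathrm{SG}(A,M)\in[0,\infty]$ be the infimum of these numbers ($\infty$ if there are none), and $\mathrm{SG}(M)=\mathrm{SG}(M,M)$. Tensor products, finite or infinite,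 are von Neumann algebra tensor products with respect to the traces: $\bigotimes_k M_k$ is the von Neumann algebra generated by the left actions of the $M_k$ on the Hilbert space tensor product $\bigotimes_k (L^2(M_k),1)$, with the product trace. A II$_1$ factor $M$ is McDuff if for every finite $F\subseteq M$ and $\varepsilon>0$ there is $y\in M$ with $y^2=0$, $y^*y+yy^*=1$ and $\max_{x\in F}\|xy-yx\|_2<\varepsilon$ (an approximately central unital copy of $M_2(\mathbb C)$). A McDuff II$_1$ factor $M$ is uniformly super McDuff if for every $n\ge1$ there is $m\ge1$ such that for every $F\subseteq (M)_1$ with $|F|\le n$ there is $G\subseteq (M)_1$ with $|G|\le m$ with the following property: for all projections $p,q\in M$ with $\tau(p)=\tau(q)$ and $\max_{x\in G}\max(\|[x,p]\|_2,\|[x,q]\|_2)<\frac1m$ there is a unitary $u\in M$ with $\|upu^*-q\|_2<\frac1n$ and $\max_{x\in F}\|[x,u]\|_2<\frac1n$. Proposition. Let $(M_k)_{k\ge1}$ be a sequence of full II$_1$ factors with $$\sup_{k\ge1}\mathrm{SG}(M_1\otimes\cdots\otimes M_k)<\infty .$$ Then $\bigotimes_{k\ge1} M_k$ is uniformly super McDuff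 (in particular, it is a McDuff II$_1$ factor). -/

import Mathlib

open scoped InnerProductSpace ComplexOrder

noncomputable section

/-! ## Von Neumann algebras with a normal state, and the space `L²(M, τ)` -/

section States

variable {K : Type*} [NormedAddCommGroup K] [InnerProductSpace ℂ K] [CompleteSpace K]

/-- A normal state on a von Neumann algebra `M ⊆ B(K)`: a linear functional `τ` on `M` with
`τ 1 = 1` of the form `τ x = ∑ₙ ⟪ξₙ, x ξₙ⟫` (positivity of `τ` follows from this form). -/
structure NormalState (M : VonNeumannAlgebra K) where
  /-- the underlying linear functional -/
  toLinearMap : M.toStarSubalgebra →ₗ[ℂ] ℂ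
  map_one : toLinearMap 1 = 1
  normal : ∃ ξ : ℕ → K, ∀ x : M.toStarSubalgebra,
    HasSum (fun n => ⟪ξ n, (x : K →L[ℂ] K) (ξ n)⟫_ℂ) (toLinearMap x)

namespace NormalState

variable {M : VonNeumannAlgebra K} (τ : NormalState M)

instance : CoeFun (NormalState M) (fun _ => M.toStarSubalgebra → ℂ) :=
  ⟨fun τ => τ.toLinearMap⟩

/-- `τ` is a trace. -/
def IsTracial : Prop := ∀ x y : M.toStarSubalgebra, τ (x * y) = τ (y * x)

/-- `τ` is faithful. -/
def IsFaithful : Prop := ∀ x : M.toStarSubalgebra, τ (star x * x) = 0 → x = 0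

/-- The 2-norm `‖x‖₂ = τ(x* x)^(1/2)`. -/
def norm2 (x : M.toStarSubalgebra) : ℝ := √(τ (star x * x)).re

theorem map_star (x : M.toStarSubalgebra) : τ (star x) = starRingEnd ℂ (τ x) := by
  obtain ⟨ξ, h⟩ := τ.normal
  refine (h (star x)).unique ?_
  have h2 := (h x).map (starRingEnd ℂ) Complex.continuous_conj
  convert h2 using 2 with n
  simp [ContinuousLinearMap.star_eq_adjoint, ContinuousLinearMap.adjoint_inner_right]

theorem exists_hasSum_norm_sq : ∃ ξ : ℕ → K, ∀ x : M.toStarSubalgebra,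
    HasSum (fun n => ‖(x : K →L[ℂ] K) (ξ n)‖ ^ 2) (τ (star x * x)).re := by
  obtain ⟨ξ, h⟩ := τ.normal
  refine ⟨ξ, fun x => ?_⟩
  have h2 := (h (star x * x)).mapL Complex.reCLM
  have h3 : (fun n => ‖(x : K →L[ℂ] K) (ξ n)‖ ^ 2) =
      fun n => Complex.reCLM ⟪ξ n, ((star x * x : M.toStarSubalgebra) : K →L[ℂ] K) (ξ n)⟫_ℂ := by
    funext n
    simp [ContinuousLinearMap.star_eq_adjoint, ContinuousLinearMap.adjoint_inner_right,
      ← Complex.ofReal_pow]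
  rw [h3]
  exact h2

theorem re_nonneg (x : M.toStarSubalgebra) : 0 ≤ (τ (star x * x)).re := by
  obtain ⟨ξ, h⟩ := τ.exists_hasSum_norm_sq
  exact (h x).nonneg fun n => by positivity

theorem re_mul_le (a x : M.toStarSubalgebra) :
    (τ (star (a * x) * (a * x))).re ≤ ‖(a : K →L[ℂ] K)‖ ^ 2 * (τ (star x * x)).re := by
  obtain ⟨ξ, h⟩ := τ.exists_hasSum_norm_sq
  refine hasSum_le (fun n => ?_) (h (a * x)) ((h x).mul_left _)
  rw [← mul_pow]
  gcongr
  exact (a : K →L[ℂ] K).le_opNorm _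

end NormalState

variable {M : VonNeumannAlgebra K}

/-- The vector space `M`, to be equipped with the inner product `⟪x, y⟫ = τ(x* y)`. -/
def PreL2 (_τ : NormalState M) : Type _ := M.toStarSubalgebra

namespace PreL2

variable (τ : NormalState M)

instance : AddCommGroup (PreL2 τ) := inferInstanceAs (AddCommGroup M.toStarSubalgebra)

instance : Module ℂ (PreL2 τ) := inferInstanceAs (Module ℂ M.toStarSubalgebra)

/-- The identity map `M → PreL2 τ`. -/
def of : M.toStarSubalgebra ≃ₗ[ℂ] PreL2 τ := LinearEquiv.refl ℂ _

/-- The inner product `⟪x, y⟫ = τ(x* y)`. -/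
abbrev core : PreInnerProductSpace.Core ℂ (PreL2 τ) where
  inner x y := τ (star ((of τ).symm x) * (of τ).symm y)
  conj_inner_symm x y := by rw [← τ.map_star]; simp
  re_inner_nonneg x := τ.re_nonneg _
  add_left x y z := by rw [map_add, star_add, add_mul, map_add]
  smul_left x y r := by simp

instance : SeminormedAddCommGroup (PreL2 τ) :=
  InnerProductSpace.Core.toSeminormedAddCommGroup (c := core τ)

instance : InnerProductSpace ℂ (PreL2 τ) := InnerProductSpace.ofCore (core τ)

theorem norm_of (x : M.toStarSubalgebra) : ‖of τ x‖ = τ.norm2 x := rfl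

/-- Left multiplication by `a`. -/
def leftMul (a : M.toStarSubalgebra) : PreL2 τ →L[ℂ] PreL2 τ :=
  LinearMap.mkContinuous
    ((of τ).toLinearMap ∘ₗ LinearMap.mulLeft ℂ a ∘ₗ (of τ).symm.toLinearMap)
    ‖(a : K →L[ℂ] K)‖ fun x => by
      change τ.norm2 (a * (of τ).symm x) ≤ ‖(a : K →L[ℂ] K)‖ * τ.norm2 ((of τ).symm x)
      unfold NormalState.norm2
      rw [← Real.sqrt_sq (norm_nonneg (a : K →L[ℂ] K)), ← Real.sqrt_mul (by positivity)]
      exact Real.sqrt_le_sqrt (τ.re_mul_le a _)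

end PreL2

/-- The Hilbert space `L²(M, τ)`. -/
abbrev L2 (τ : NormalState M) : Type _ := UniformSpace.Completion (PreL2 τ)

namespace L2

variable (τ : NormalState M)

/-- The canonical map `M → L²(M, τ)`. -/
def ofM (x : M.toStarSubalgebra) : L2 τ := ((PreL2.of τ x : PreL2 τ) : L2 τ)

/-- The left action of `a ∈ M` on `L²(M, τ)`: the continuous extension of `x ↦ a x`. -/
def leftMul (a : M.toStarSubalgebra) : L2 τ →L[ℂ] L2 τ := (PreL2.leftMul τ a).completion

/-- The right action of `a ∈ M` on `L²(M, τ)`: the continuous extension of `x ↦ x a`.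
(This map is uniformly continuous in the 2-norm because `τ` is a trace, wherever it is used.) -/
def rightMul (a : M.toStarSubalgebra) : L2 τ → L2 τ :=
  UniformSpace.Completion.map fun x => PreL2.of τ ((PreL2.of τ).symm x * a)

end L2

/-! ## II₁ factors, fullness, spectral gap, McDuff properties -/

/-- `(M, τ)` is a II₁ factor with its trace: the centre of `M` is trivial, `M` is
infinite-dimensional, and the normal state `τ` is a faithful trace. -/
structure IsIIOneFactor (τ : NormalState M) : Prop where
  tracial : τ.IsTracial
  faithful : τ.IsFaithful
  center : ∀ z : M.toStarSubalgebra, (∀ x : M.toStarSubalgebra, z * x = x * z) →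
    ∃ c : ℂ, z = c • (1 : M.toStarSubalgebra)
  infinite : ¬ FiniteDimensional ℂ M.toStarSubalgebra

/-- The unit ball `(M)₁` for the operator norm. -/
def unitBall (M : VonNeumannAlgebra K) : Set M.toStarSubalgebra :=
  {x | ‖(x : K →L[ℂ] K)‖ ≤ 1}

/-- `(M, τ)` is full (does not have property Gamma): elements of the unit ball that almost commute
with a suitable finite subset of `M` are almost scalar, in the 2-norm; that is, every uniformly
bounded central net is trivial. -/
def IsFull (τ : NormalState M) : Prop :=
  ∀ ε : ℝ, 0 < ε → ∃ F : Finset M.toStarSubalgebra, ∃ δ : ℝ, 0 < δ ∧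
    ∀ x ∈ unitBall M, (∀ y ∈ F, τ.norm2 (x * y - y * x) < δ) →
      τ.norm2 (x - τ x • (1 : M.toStarSubalgebra)) < ε

/-- The closure of `A' ∩ M` in `L²(M, τ)`. The conditional expectation `E_{A' ∩ M}` acts on
`L²(M, τ)` as the orthogonal projection onto it. -/
def relCommutantL2 (A : VonNeumannAlgebra K) (τ : NormalState M) : Submodule ℂ (L2 τ) :=
  (Submodule.span ℂ
    (L2.ofM τ '' {x | (x : K →L[ℂ] K) ∈ A.commutant})).topologicalClosure

instance (A : VonNeumannAlgebra K) (τ : NormalState M) : CompleteSpace (relCommutantL2 A τ) :=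
  inferInstanceAs (CompleteSpace (Submodule.topologicalClosure _))

/-- `C` is a spectral gap number for `A ⊆ M`: there is a finite `F ⊆ (A)₁` with `|F| ≤ C` and
`‖ξ - E_{A' ∩ M} ξ‖₂² ≤ C ∑_{x ∈ F} ‖x ξ - ξ x‖₂²` for all `ξ ∈ L²(M, τ)`. -/
def IsSpectralGapNumber (A : VonNeumannAlgebra K) (τ : NormalState M) (C : ℝ) : Prop :=
  0 < C ∧ ∃ F : Finset M.toStarSubalgebra,
    (∀ x ∈ F, x ∈ unitBall M ∧ (x : K →L[ℂ] K) ∈ A) ∧ (F.card : ℝ) ≤ C ∧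
    ∀ ξ : L2 τ, ‖ξ - (relCommutantL2 A τ).starProjection ξ‖ ^ 2 ≤
      C * ∑ x ∈ F, ‖L2.leftMul τ x ξ - L2.rightMul τ x ξ‖ ^ 2

/-- `SG(A, M)`: the infimum of the spectral gap numbers for `A ⊆ M` (`∞` if there are none). -/
def relSG (A : VonNeumannAlgebra K) (τ : NormalState M) : ENNReal :=
  sInf (ENNReal.ofReal '' {C | IsSpectralGapNumber A τ C})

/-- `SG(M) = SG(M, M)`. -/
def SG (τ : NormalState M) : ENNReal := relSG M τ

/-- The II₁ factor `(M, τ)` is McDuff: for every finite `F ⊆ M` and `ε > 0` there is a unital copy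
of the 2 by 2 matrices in `M`, given by its matrix unit `y = e₁₂`, which commutes with `F` up to
`ε` in the 2-norm. -/
def IsMcDuff (τ : NormalState M) : Prop :=
  IsIIOneFactor τ ∧ ∀ (F : Finset M.toStarSubalgebra) (ε : ℝ), 0 < ε →
    ∃ y : M.toStarSubalgebra, y * y = 0 ∧ star y * y + y * star y = 1 ∧
      ∀ x ∈ F, τ.norm2 (x * y - y * x) < ε

/-- `𝒫₂(M)`: pairs of projections in `M` of the same trace. -/
def projPairs (τ : NormalState M) : Set (M.toStarSubalgebra × M.toStarSubalgebra) :=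
  {pq | IsStarProjection pq.1 ∧ IsStarProjection pq.2 ∧ τ pq.1 = τ pq.2}

/-- `(M, τ)` is a uniformly super McDuff II₁ factor. -/
def IsUniformlySuperMcDuff (τ : NormalState M) : Prop :=
  IsMcDuff τ ∧ ∀ n : ℕ, 1 ≤ n → ∃ m : ℕ, 1 ≤ m ∧
    ∀ F : Finset M.toStarSubalgebra, ↑F ⊆ unitBall M → F.card ≤ n →
    ∃ G : Finset M.toStarSubalgebra, ↑G ⊆ unitBall M ∧ G.card ≤ m ∧
    ∀ p q : M.toStarSubalgebra, (p, q) ∈ projPairs τ →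
      (∀ x ∈ G, τ.norm2 (x * p - p * x) < 1 / (m : ℝ) ∧
        τ.norm2 (x * q - q * x) < 1 / (m : ℝ)) →
      ∃ u ∈ unitary M.toStarSubalgebra,
        τ.norm2 (u * p * star u - q) < 1 / (n : ℝ) ∧
        ∀ x ∈ F, τ.norm2 (x * u - u * x) < 1 / (n : ℝ)

end States

/-! ## Tensor products of Hilbert spaces with respect to unit vectors -/

section HilbertTensor

variable {ι : Type*} {E : ι → Type*} [∀ i, NormedAddCommGroup (E i)]
  [∀ i, InnerProductSpace ℂ (E i)]

/-- The index set of the elementary tensors `⊗ᵢ xᵢ`: families with `xᵢ = eᵢ` for all but finitely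
many `i`. -/
def ElemTensor (e : ∀ i, E i) : Type _ := {x : ∀ i, E i // {i | x i ≠ e i}.Finite}

namespace ElemTensor

variable {e : ∀ i, E i}

/-- The inner product of elementary tensors, `∏ᵢ ⟪xᵢ, yᵢ⟫`. -/
def kernel (x y : ElemTensor e) : ℂ := ∏ᶠ i, ⟪x.1 i, y.1 i⟫_ℂ

/-- The elementary tensor `⊗ᵢ eᵢ`. -/
def base (e : ∀ i, E i) : ElemTensor e := ⟨e, by simp⟩

open Classical in
/-- Apply a map to the `i`-th entry. -/
def updateAt (i : ι) (T : E i → E i) (x : ElemTensor e) : ElemTensor e :=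
  ⟨Function.update x.1 i (T (x.1 i)), by
    refine (x.2.insert i).subset fun j hj => ?_
    by_cases h : j = i
    · exact Or.inl h
    · right
      simpa [Function.update_of_ne h] using hj⟩

theorem kernel_eq_prod (he : ∀ i, ‖e i‖ = 1) (x y : ElemTensor e) (s : Finset ι)
    (hx : ∀ i ∉ s, x.1 i = e i) (hy : ∀ i ∉ s, y.1 i = e i) :
    kernel x y = ∏ i ∈ s, ⟪x.1 i, y.1 i⟫_ℂ := by
  refine finprod_eq_prod_of_mulSupport_subset _ fun i hi => ?_
  by_contra h
  refine hi ?_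
  have h' : i ∉ s := h
  simp [hx i h', hy i h', inner_self_eq_norm_sq_to_K, he]

theorem kernel_conj (he : ∀ i, ‖e i‖ = 1) (x y : ElemTensor e) :
    starRingEnd ℂ (kernel y x) = kernel x y := by
  classical
  have hx : ∀ i ∉ x.2.toFinset ∪ y.2.toFinset, x.1 i = e i := by
    intro i hi
    by_contra h
    exact hi (by simp [h])
  have hy : ∀ i ∉ x.2.toFinset ∪ y.2.toFinset, y.1 i = e i := by
    intro i hi
    by_contra h
    exact hi (by simp [h])
  rw [kernel_eq_prod he _ _ _ hx hy, kernel_eq_prod he _ _ _ hy hx, map_prod]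
  simp

theorem exists_finset (t : Finset (ElemTensor e)) :
    ∃ s : Finset ι, ∀ x ∈ t, ∀ i ∉ s, x.1 i = e i := by
  classical
  refine ⟨t.biUnion fun x => x.2.toFinset, fun x hx i hi => ?_⟩
  by_contra h
  exact hi (Finset.mem_biUnion.2 ⟨x, hx, by simpa using h⟩)

end ElemTensor

theorem posSemidef_prod {n κ : Type*} [Fintype n] (s : Finset κ) (A : κ → Matrix n n ℂ)
    (hA : ∀ i ∈ s, (A i).PosSemidef) :
    (Matrix.of fun a b => ∏ i ∈ s, A i a b).PosSemidef := by
  classical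
  induction s using Finset.induction_on with
  | empty =>
    have h := Matrix.posSemidef_gram ℂ (fun _ : n => (1 : ℂ))
    have h2 : (Matrix.of fun a b => ∏ i ∈ (∅ : Finset κ), A i a b) =
        Matrix.gram ℂ (fun _ : n => (1 : ℂ)) := by
      ext a b
      simp [Matrix.gram_apply]
    rw [h2]
    exact h
  | insert i s hi ih =>
    have h := (hA i (by simp)).hadamard (ih fun j hj => hA j (by simp [hj]))
    have h2 : (Matrix.of fun a b => ∏ j ∈ insert i s, A j a b) =
        (A i).hadamard (Matrix.of fun a b => ∏ j ∈ s, A j a b) := by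
      ext a b
      simp [Finset.prod_insert hi]
    rw [h2]
    exact h

theorem posSemidef_re_sum_nonneg {n : Type*} [Fintype n] {A : Matrix n n ℂ} (hA : A.PosSemidef)
    (v : n → ℂ) : 0 ≤ (∑ a, ∑ b, starRingEnd ℂ (v a) * v b * A a b).re := by
  have h := (Complex.le_def.1 (hA.dotProduct_mulVec_nonneg v)).1
  have h2 : star v ⬝ᵥ A.mulVec v = ∑ a, ∑ b, starRingEnd ℂ (v a) * v b * A a b := by
    simp only [dotProduct, Matrix.mulVec, Finset.mul_sum, Pi.star_apply, RCLike.star_def]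
    refine Finset.sum_congr rfl fun a _ => Finset.sum_congr rfl fun b _ => ?_
    ring
  rw [h2] at h
  exact h

/-- Formal linear combinations of elementary tensors. -/
def PreTensor (e : ∀ i, E i) (_he : ∀ i, ‖e i‖ = 1) : Type _ := ElemTensor e →₀ ℂ

namespace PreTensor

variable (e : ∀ i, E i) (he : ∀ i, ‖e i‖ = 1)

instance : AddCommGroup (PreTensor e he) := inferInstanceAs (AddCommGroup (ElemTensor e →₀ ℂ))

instance : Module ℂ (PreTensor e he) := inferInstanceAs (Module ℂ (ElemTensor e →₀ ℂ))

/-- The identity map. -/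
def of : (ElemTensor e →₀ ℂ) ≃ₗ[ℂ] PreTensor e he := LinearEquiv.refl ℂ _

/-- The sesquilinear form `⟪∑ cₓ x, ∑ d_y y⟫ = ∑ conj(cₓ) d_y ∏ᵢ ⟪xᵢ, yᵢ⟫`. -/
def form (f g : ElemTensor e →₀ ℂ) : ℂ :=
  f.sum fun x c => g.sum fun y d => starRingEnd ℂ c * d * ElemTensor.kernel x y

theorem form_conj (he : ∀ i, ‖e i‖ = 1) (f g : ElemTensor e →₀ ℂ) : starRingEnd ℂ (form e g f) = form e f g := by
  unfold form
  rw [Finsupp.sum_comm]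
  simp only [Finsupp.sum, map_sum, map_mul, ElemTensor.kernel_conj he, Complex.conj_conj]
  refine Finset.sum_congr rfl fun x _ => Finset.sum_congr rfl fun y _ => ?_
  ring

theorem form_self_nonneg (he : ∀ i, ‖e i‖ = 1) (f : ElemTensor e →₀ ℂ) :
    0 ≤ (form e f f).re := by
  obtain ⟨s, hs⟩ := ElemTensor.exists_finset f.support
  have hP := posSemidef_prod (n := f.support) s
    (fun i => Matrix.gram ℂ fun x : f.support => x.1.1 i)
    (fun i _ => Matrix.posSemidef_gram ℂ _)
  have h := posSemidef_re_sum_nonneg hP (fun x => f x)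
  convert h using 2
  unfold form Finsupp.sum
  rw [← Finset.sum_coe_sort f.support]
  refine Finset.sum_congr rfl fun x _ => ?_
  dsimp only
  rw [← Finset.sum_coe_sort f.support]
  refine Finset.sum_congr rfl fun y _ => ?_
  rw [ElemTensor.kernel_eq_prod he _ _ s (hs _ x.2) (hs _ y.2)]
  simp [Matrix.gram_apply]

theorem form_mapDomain_le (he : ∀ i, ‖e i‖ = 1) (f : ElemTensor e →₀ ℂ) (i : ι)
    (T : E i →L[ℂ] E i) :
    (form e (f.mapDomain (ElemTensor.updateAt i T)) (f.mapDomain (ElemTensor.updateAt i T))).re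
      ≤ ‖T‖ ^ 2 * (form e f f).re := by
  classical
  obtain ⟨s, hs⟩ := ElemTensor.exists_finset f.support
  have hP := posSemidef_prod (n := f.support) (s.erase i)
    (fun j => Matrix.gram ℂ fun x : f.support => x.1.1 j)
    (fun j _ => Matrix.posSemidef_gram ℂ _)
  have hD : (((‖T‖ : ℂ) ^ 2) • Matrix.gram ℂ (fun x : f.support => x.1.1 i) -
      Matrix.gram ℂ (fun x : f.support => T (x.1.1 i))).PosSemidef := by
    refine .of_dotProduct_mulVec_nonneg ?_ fun v => ?_
    · refine Matrix.IsHermitian.sub ?_ (Matrix.isHermitian_gram _ _)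
      rw [Matrix.IsHermitian, Matrix.conjTranspose_smul, (Matrix.isHermitian_gram _ _).eq]
      simp
    · rw [Matrix.sub_mulVec, Matrix.smul_mulVec, dotProduct_sub, dotProduct_smul,
        Matrix.star_dotProduct_gram_mulVec, Matrix.star_dotProduct_gram_mulVec]
      have hT : ∑ x : f.support, v x • T (x.1.1 i) = T (∑ x : f.support, v x • x.1.1 i) := by
        simp
      rw [hT, inner_self_eq_norm_sq_to_K, inner_self_eq_norm_sq_to_K]
      have h1 := T.le_opNorm (∑ x : f.support, v x • x.1.1 i)
      have h2 : ‖T (∑ x : f.support, v x • x.1.1 i)‖ ^ 2 ≤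
          ‖T‖ ^ 2 * ‖∑ x : f.support, v x • x.1.1 i‖ ^ 2 := by
        rw [← mul_pow]
        gcongr
      rw [sub_nonneg, smul_eq_mul]
      have h3 := Complex.real_le_real.2 h2
      rw [Complex.ofReal_mul, Complex.ofReal_pow, Complex.ofReal_pow, Complex.ofReal_pow] at h3
      exact h3
  have h := posSemidef_re_sum_nonneg (hD.hadamard hP) (fun x => f x)
  rw [← sub_nonneg]
  convert h using 1
  have e1 : form e f f = ∑ x : f.support, ∑ y : f.support,
      starRingEnd ℂ (f x) * f y * ElemTensor.kernel x.1 y.1 := by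
    unfold form Finsupp.sum
    rw [← Finset.sum_coe_sort]
    refine Finset.sum_congr rfl fun x _ => ?_
    dsimp only
    rw [← Finset.sum_coe_sort f.support]
  have e2 : form e (f.mapDomain (ElemTensor.updateAt i T)) (f.mapDomain (ElemTensor.updateAt i T)) =
      ∑ x : f.support, ∑ y : f.support, starRingEnd ℂ (f x) * f y *
        ElemTensor.kernel (ElemTensor.updateAt i T x.1) (ElemTensor.updateAt i T y.1) := by
    unfold form
    rw [Finsupp.sum_mapDomain_index (by simp) (by simp [add_mul, Finsupp.sum_add])]
    unfold Finsupp.sum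
    rw [← Finset.sum_coe_sort]
    refine Finset.sum_congr rfl fun x _ => ?_
    have h3 := Finsupp.sum_mapDomain_index (f := ElemTensor.updateAt i T) (s := f)
      (h := fun y d => starRingEnd ℂ (f x) * d *
        ElemTensor.kernel (ElemTensor.updateAt i T x.1) y) (by simp) (by intros; ring)
    unfold Finsupp.sum at h3
    dsimp only at h3 ⊢
    rw [h3, ← Finset.sum_coe_sort f.support]
  have e3 : ‖T‖ ^ 2 * (form e f f).re = (((‖T‖ : ℂ) ^ 2) * form e f f).re := by
    rw [← Complex.ofReal_pow, Complex.re_ofReal_mul]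
  rw [e3, ← Complex.sub_re, e1, e2]
  congr 1
  rw [Finset.mul_sum, ← Finset.sum_sub_distrib]
  refine Finset.sum_congr rfl fun x _ => ?_
  rw [Finset.mul_sum, ← Finset.sum_sub_distrib]
  refine Finset.sum_congr rfl fun y _ => ?_
  have hx : ∀ j ∉ insert i s, x.1.1 j = e j := fun j hj => hs _ x.2 j (by simp_all)
  have hy : ∀ j ∉ insert i s, y.1.1 j = e j := fun j hj => hs _ y.2 j (by simp_all)
  have hx' : ∀ j ∉ insert i s, (ElemTensor.updateAt i T x.1).1 j = e j := fun j hj => by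
    simp [ElemTensor.updateAt, Function.update_of_ne (show j ≠ i by rintro rfl; simp at hj), hx j hj]
  have hy' : ∀ j ∉ insert i s, (ElemTensor.updateAt i T y.1).1 j = e j := fun j hj => by
    simp [ElemTensor.updateAt, Function.update_of_ne (show j ≠ i by rintro rfl; simp at hj), hy j hj]
  rw [ElemTensor.kernel_eq_prod he _ _ _ hx hy, ElemTensor.kernel_eq_prod he _ _ _ hx' hy',
    ← Finset.mul_prod_erase _ _ (Finset.mem_insert_self i s),
    ← Finset.mul_prod_erase _ _ (Finset.mem_insert_self i s),
    Finset.erase_insert_eq_erase]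
  have h4 : ∏ j ∈ s.erase i, ⟪(ElemTensor.updateAt i T x.1).1 j,
      (ElemTensor.updateAt i T y.1).1 j⟫_ℂ = ∏ j ∈ s.erase i, ⟪x.1.1 j, y.1.1 j⟫_ℂ := by
    refine Finset.prod_congr rfl fun j hj => ?_
    have hj' := Finset.ne_of_mem_erase hj
    simp [ElemTensor.updateAt, Function.update_of_ne hj']
  rw [h4]
  simp [ElemTensor.updateAt, Matrix.gram_apply]
  ring

/-- The inner product on formal linear combinations. -/
abbrev core : PreInnerProductSpace.Core ℂ (PreTensor e he) where
  inner f g := form e ((of e he).symm f) ((of e he).symm g)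
  conj_inner_symm f g := form_conj e he _ _
  re_inner_nonneg f := form_self_nonneg e he _
  add_left f g h := by
    unfold form
    rw [map_add, Finsupp.sum_add_index']
    · simp
    · intro x c d
      simp [add_mul, Finsupp.sum_add]
  smul_left f g r := by
    unfold form
    rw [map_smul, Finsupp.sum_smul_index]
    · simp [Finsupp.mul_sum, mul_assoc]
    · simp

instance : SeminormedAddCommGroup (PreTensor e he) :=
  InnerProductSpace.Core.toSeminormedAddCommGroup (c := core e he)

instance : InnerProductSpace ℂ (PreTensor e he) := InnerProductSpace.ofCore (core e he)

/-- The operator `⊗ᵢ xᵢ ↦ T xᵢ ⊗ (⊗_{j ≠ i} xⱼ)`. -/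
def siteOp (i : ι) (T : E i →L[ℂ] E i) : PreTensor e he →L[ℂ] PreTensor e he :=
  LinearMap.mkContinuous
    ((of e he).toLinearMap ∘ₗ Finsupp.lmapDomain ℂ ℂ (ElemTensor.updateAt i T) ∘ₗ
      (of e he).symm.toLinearMap) ‖T‖ fun f => by
    change √(form e (Finsupp.mapDomain _ _) (Finsupp.mapDomain _ _)).re ≤
      ‖T‖ * √(form e ((of e he).symm f) ((of e he).symm f)).re
    rw [← Real.sqrt_sq (norm_nonneg T), ← Real.sqrt_mul (by positivity)]
    exact Real.sqrt_le_sqrt (form_mapDomain_le e he _ i T)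

end PreTensor

/-- The Hilbert space tensor product `⊗ᵢ (Eᵢ, eᵢ)` with respect to the unit vectors `eᵢ`. -/
abbrev HilbertTensor (e : ∀ i, E i) (he : ∀ i, ‖e i‖ = 1) : Type _ :=
  UniformSpace.Completion (PreTensor e he)

namespace HilbertTensor

variable (e : ∀ i, E i) (he : ∀ i, ‖e i‖ = 1)

/-- The elementary tensor `⊗ᵢ xᵢ`. -/
def tprod (x : ElemTensor e) : HilbertTensor e he :=
  ((PreTensor.of e he (Finsupp.single x 1) : PreTensor e he) : HilbertTensor e he)

/-- The bounded operator on `⊗ⱼ (Eⱼ, eⱼ)` that acts as `T` on the `i`-th tensor factor and as the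
identity on the others. -/
def siteOp (i : ι) (T : E i →L[ℂ] E i) : HilbertTensor e he →L[ℂ] HilbertTensor e he :=
  (PreTensor.siteOp e he i T).completion

theorem norm_tprod_base : ‖tprod e he (ElemTensor.base e)‖ = 1 := by
  unfold tprod
  rw [UniformSpace.Completion.norm_coe]
  change √(PreTensor.form e (Finsupp.single _ 1) (Finsupp.single _ 1)).re = 1
  unfold PreTensor.form
  rw [Finsupp.sum_single_index (by simp), Finsupp.sum_single_index (by simp)]
  simp [ElemTensor.kernel, ElemTensor.base, inner_self_eq_norm_sq_to_K, he]

end HilbertTensor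

end HilbertTensor

/-! ## Tensor products of von Neumann algebras -/

/-- The von Neumann algebra generated by a set of bounded operators. -/
def vonNeumannClosure {H : Type*} [NormedAddCommGroup H] [InnerProductSpace ℂ H] [CompleteSpace H]
    (S : Set (H →L[ℂ] H)) : VonNeumannAlgebra H where
  toStarSubalgebra :=
    StarSubalgebra.centralizer ℂ (StarSubalgebra.centralizer ℂ S : Set (H →L[ℂ] H))
  centralizer_centralizer' := by
    simp

/-- The vector state `x ↦ ⟪Ω, x Ω⟫`. -/
def vectorState {H : Type*} [NormedAddCommGroup H] [InnerProductSpace ℂ H] [CompleteSpace H]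
    (M : VonNeumannAlgebra H) (Ω : H) (hΩ : ‖Ω‖ = 1) : NormalState M where
  toLinearMap :=
    { toFun := fun x => ⟪Ω, (x : H →L[ℂ] H) Ω⟫_ℂ
      map_add' := fun x y => by simp
      map_smul' := fun c x => by simp }
  map_one := by simp [inner_self_eq_norm_sq_to_K, hΩ]
  normal := ⟨fun n => if n = 0 then Ω else 0, fun x => by
    have h := hasSum_single (f := fun n : ℕ =>
      ⟪(if n = 0 then Ω else 0), (x : H →L[ℂ] H) (if n = 0 then Ω else 0)⟫_ℂ) 0
      (fun n hn => by simp [hn])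
    simpa using h⟩

section VNTensor

variable {ι : Type*} {K : ι → Type*} [∀ i, NormedAddCommGroup (K i)]
  [∀ i, InnerProductSpace ℂ (K i)] [∀ i, CompleteSpace (K i)] {M : ∀ i, VonNeumannAlgebra (K i)}

theorem L2.norm_ofM_one {K : Type*} [NormedAddCommGroup K] [InnerProductSpace ℂ K]
    [CompleteSpace K] {M : VonNeumannAlgebra K} (τ : NormalState M) : ‖L2.ofM τ 1‖ = 1 := by
  unfold L2.ofM
  rw [UniformSpace.Completion.norm_coe, PreL2.norm_of]
  simp [NormalState.norm2, τ.map_one]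

/-- The Hilbert space `⊗ᵢ (L²(Mᵢ, τᵢ), 1)`. -/
abbrev TensorSpace (τ : ∀ i, NormalState (M i)) : Type _ :=
  HilbertTensor (fun i => L2.ofM (τ i) 1) (fun i => L2.norm_ofM_one (τ i))

/-- The von Neumann algebra tensor product `⊗ᵢ (Mᵢ, τᵢ)`: the von Neumann algebra on
`⊗ᵢ (L²(Mᵢ, τᵢ), 1)` generated by the left actions of the `Mᵢ` on their tensor factors. -/
def tensorAlgebra (τ : ∀ i, NormalState (M i)) : VonNeumannAlgebra (TensorSpace τ) :=
  vonNeumannClosure {T | ∃ (i : ι) (a : (M i).toStarSubalgebra),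
    T = HilbertTensor.siteOp _ _ i (L2.leftMul (τ i) a)}

/-- The product state `⊗ᵢ τᵢ` on `⊗ᵢ (Mᵢ, τᵢ)`: the vector state of `⊗ᵢ 1`. -/
def tensorState (τ : ∀ i, NormalState (M i)) : NormalState (tensorAlgebra τ) :=
  vectorState _ (HilbertTensor.tprod _ _ (ElemTensor.base _)) (HilbertTensor.norm_tprod_base _ _)

end VNTensor

end

/-!
Write `N = ⊗ₖ Mₖ`, acting on `⊗ₖ L²(Mₖ)` with the trace vector `Ω = ⊗ₖ 1`, and let `Bₙ` be the
relative commutant in `N` of the first `n` factors.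

* `N` and all `Bₙ` are II₁ factors (`isIIOneFactor_tensorState`, `isIIOneFactor_tailAlgebra`). The
  vector state of `Ω` is a faithful trace because every left multiplication has a partner in the
  commutant, the right multiplication, with the same value on `Ω` (`isTracial_vectorState`). The
  centre of `N` is trivial because a central vector has scalar slices in each `L²(Mₖ)`
  (`eq_smul_vacuum_of_central`); an element of the centre of `Bₙ` commutes with all `Mₖ`.
* Every finite subset of `N` is, up to a small error in the 2-norm, in the commutant of some `Bₙ`
  (`exists_near_commute_tailAlgebra`). Since `Bₙ` contains a unital copy of the 2 by 2 matrices
  (`IsIIOneFactor.exists_matrixUnit`), `N` is McDuff.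
* A spectral gap number `C` of `A = M₀ ⊗ ⋯ ⊗ Mₙ₋₁` gives an operator inequality
  `(1 - P)* (1 - P) ≤ C ∑ (x - Rₓ)* (x - Rₓ)` on `L²(A)`, where `Rₓ` is the right multiplication by
  `x` and `P` projects to the closure of the centre. The inequality is inherited by the
  amplifications to `⊗ₖ L²(Mₖ)` (`IsTensorFamily.norm_amp_sq_le`). Since the range of the amplified
  `P` consists of vectors that are fixed by the conjugations with the unitaries of `A`, the average
  of a self-adjoint `p ∈ N` over these conjugations is an element of `Bₙ` whose distance to `p`
  is controlled by `C` and the commutators of `p` with boundedly many elements of `A`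
  (`exists_near_relCommutant`).
* If `p`, `q` are projections of the same trace that almost commute with these elements, their
  approximants in `Bₙ` are rounded to projections of `Bₙ` whose traces almost agree. By
  comparison of projections in the II₁ factor `Bₙ` they are almost conjugate by a unitary `u ∈ Bₙ`
  (`IsIIOneFactor.exists_unitary_conj_near`), and `u` almost commutes with the given finite set. As
  `C` does not depend on `n`, the estimates are uniform
  (`isUniformlySuperMcDuff_of_subfactors`).
-/

noncomputable section

open Filter Topology

set_option linter.unusedSectionVars false

/-! ### The 2-norm of a normal state -/

section States

variable {K : Type*} [NormedAddCommGroup K] [InnerProductSpace ℂ K] [CompleteSpace K]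

instance VonNeumannAlgebra.isClosed_coe (M : VonNeumannAlgebra K) :
    IsClosed (M.toStarSubalgebra : Set (K →L[ℂ] K)) := by
  rw [VonNeumannAlgebra.coe_toStarSubalgebra, ← M.centralizer_centralizer]
  exact Set.isClosed_centralizer _

theorem VonNeumannAlgebra.mem_iff_commute {M : VonNeumannAlgebra K} {x : K →L[ℂ] K} :
    x ∈ M ↔ ∀ y ∈ M.commutant, y * x = x * y := by
  conv_lhs => rw [← M.commutant_commutant]
  exact VonNeumannAlgebra.mem_commutant_iff

variable {M : VonNeumannAlgebra K} (τ : NormalState M)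

namespace L2

theorem norm_ofM (x : M.toStarSubalgebra) : ‖ofM τ x‖ = τ.norm2 x := by
  unfold ofM
  rw [UniformSpace.Completion.norm_coe, PreL2.norm_of]

theorem inner_ofM (x y : M.toStarSubalgebra) : ⟪ofM τ x, ofM τ y⟫_ℂ = τ (star x * y) := by
  unfold ofM
  rw [UniformSpace.Completion.inner_coe]
  rfl

theorem ofM_add (x y : M.toStarSubalgebra) : ofM τ (x + y) = ofM τ x + ofM τ y := by
  simp only [ofM, map_add]
  exact UniformSpace.Completion.coe_add _ _

theorem ofM_sub (x y : M.toStarSubalgebra) : ofM τ (x - y) = ofM τ x - ofM τ y := by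
  simp only [ofM, map_sub]
  exact UniformSpace.Completion.coe_sub _ _

theorem ofM_smul (c : ℂ) (x : M.toStarSubalgebra) : ofM τ (c • x) = c • ofM τ x := by
  simp [ofM]

/-- The canonical map `M → L²(M, τ)` as a linear map. -/
def ofMₗ : M.toStarSubalgebra →ₗ[ℂ] L2 τ where
  toFun := ofM τ
  map_add' := ofM_add τ
  map_smul' := ofM_smul τ

@[simp] theorem ofMₗ_apply (x : M.toStarSubalgebra) : ofMₗ τ x = ofM τ x := rfl

theorem denseRange_ofM : DenseRange (ofM τ) :=
  UniformSpace.Completion.denseRange_coe.comp (PreL2.of τ).surjective.denseRange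
    (UniformSpace.Completion.continuous_coe _)

end L2

namespace NormalState

theorem norm2_nonneg (x : M.toStarSubalgebra) : 0 ≤ τ.norm2 x := Real.sqrt_nonneg _

@[simp] theorem norm2_zero : τ.norm2 0 = 0 := by simp [norm2]

@[simp] theorem norm2_one : τ.norm2 1 = 1 := by simp [norm2, τ.map_one]

theorem norm2_sq (x : M.toStarSubalgebra) : τ.norm2 x ^ 2 = (τ (star x * x)).re :=
  Real.sq_sqrt (τ.re_nonneg x)

theorem apply_star_mul_self (x : M.toStarSubalgebra) :
    τ (star x * x) = ((τ.norm2 x ^ 2 : ℝ) : ℂ) := by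
  rw [norm2_sq, ← L2.inner_ofM]
  exact (Complex.conj_eq_iff_re.1 (inner_conj_symm _ _)).symm

theorem norm2_add_le (x y : M.toStarSubalgebra) : τ.norm2 (x + y) ≤ τ.norm2 x + τ.norm2 y := by
  simpa [← L2.norm_ofM, L2.ofM_add] using norm_add_le (L2.ofM τ x) (L2.ofM τ y)

theorem norm2_sub_le (x y : M.toStarSubalgebra) : τ.norm2 (x - y) ≤ τ.norm2 x + τ.norm2 y := by
  simpa [← L2.norm_ofM, L2.ofM_sub] using norm_sub_le (L2.ofM τ x) (L2.ofM τ y)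

theorem norm2_sub_comm (x y : M.toStarSubalgebra) : τ.norm2 (x - y) = τ.norm2 (y - x) := by
  simpa [← L2.norm_ofM, L2.ofM_sub] using norm_sub_rev (L2.ofM τ x) (L2.ofM τ y)

theorem norm2_sub_le_add (x y z : M.toStarSubalgebra) :
    τ.norm2 (x - z) ≤ τ.norm2 (x - y) + τ.norm2 (y - z) := by
  simpa using τ.norm2_add_le (x - y) (y - z)

theorem norm2_smul (c : ℂ) (x : M.toStarSubalgebra) : τ.norm2 (c • x) = ‖c‖ * τ.norm2 x := by
  simp [← L2.norm_ofM, L2.ofM_smul, norm_smul]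

theorem norm2_mul_le (a x : M.toStarSubalgebra) : τ.norm2 (a * x) ≤ ‖a‖ * τ.norm2 x := by
  refine abs_le_of_sq_le_sq' ?_ (by have := τ.norm2_nonneg x; positivity) |>.2
  rw [mul_pow, norm2_sq, norm2_sq]
  exact τ.re_mul_le a x

theorem norm2_le_norm (x : M.toStarSubalgebra) : τ.norm2 x ≤ ‖x‖ := by
  simpa using τ.norm2_mul_le x 1

theorem norm_apply_le (x : M.toStarSubalgebra) : ‖τ x‖ ≤ τ.norm2 x := by
  have h := norm_inner_le_norm (𝕜 := ℂ) (L2.ofM τ 1) (L2.ofM τ x)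
  simpa [L2.inner_ofM, L2.norm_ofM] using h

variable {τ}

namespace IsTracial

variable (ht : τ.IsTracial)
include ht

theorem norm2_star (x : M.toStarSubalgebra) : τ.norm2 (star x) = τ.norm2 x := by
  unfold norm2
  rw [star_star, ht]

theorem norm2_mul_le (x a : M.toStarSubalgebra) : τ.norm2 (x * a) ≤ τ.norm2 x * ‖a‖ := by
  rw [← ht.norm2_star, star_mul, mul_comm]
  refine (τ.norm2_mul_le _ _).trans_eq ?_
  rw [ht.norm2_star, norm_star]

end IsTracial

theorem IsFaithful.eq_zero (hf : τ.IsFaithful) {x : M.toStarSubalgebra} (hx : τ.norm2 x = 0) :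
    x = 0 := by
  refine hf x ?_
  rw [apply_star_mul_self, hx]
  simp

theorem IsFaithful.eq_of_norm2_sub_le (hf : τ.IsFaithful) {x y : M.toStarSubalgebra}
    (h : ∀ ε : ℝ, 0 < ε → τ.norm2 (x - y) ≤ ε) : x = y := by
  refine sub_eq_zero.1 (hf.eq_zero (le_antisymm ?_ (τ.norm2_nonneg _)))
  exact le_of_forall_pos_le_add fun ε hε => by simpa using h ε hε

theorem IsFaithful.eq_of_tendsto (hf : τ.IsFaithful) {x : ℕ → M.toStarSubalgebra}
    {y z : M.toStarSubalgebra}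
    (hy : Tendsto (fun n => τ.norm2 (x n - y)) atTop (𝓝 0))
    (hz : Tendsto (fun n => τ.norm2 (x n - z)) atTop (𝓝 0)) : y = z := by
  refine sub_eq_zero.1 (hf.eq_zero (le_antisymm ?_ (τ.norm2_nonneg _)))
  have h1 : Tendsto (fun n => τ.norm2 (x n - y) + τ.norm2 (x n - z)) atTop (𝓝 0) := by
    simpa using hy.add hz
  exact ge_of_tendsto' h1 fun n => by
    have := τ.norm2_sub_le_add y (x n) z
    rwa [τ.norm2_sub_comm y (x n)] at this

variable (τ)

/-- Balls of `M` for the operator norm are complete in the 2-norm: on the vectors `y ξ`, with `y` in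
the commutant and `ξ` one of the vectors that define `τ`, a Cauchy sequence converges strongly, and
these vectors span a dense subspace as `τ` is faithful. -/
theorem exists_tendsto_of_cauchySeq (hf : τ.IsFaithful) {c : ℝ} (x : ℕ → M.toStarSubalgebra)
    (hc : ∀ n, ‖x n‖ ≤ c) (hx : CauchySeq fun n => L2.ofM τ (x n)) :
    ∃ b : M.toStarSubalgebra, ‖b‖ ≤ c ∧ Tendsto (fun n => τ.norm2 (x n - b)) atTop (𝓝 0) := by
  have hc0 : 0 ≤ c := (norm_nonneg _).trans (hc 0)
  obtain ⟨ξ, hξ⟩ := τ.exists_hasSum_norm_sq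
  have hξle : ∀ (a : M.toStarSubalgebra) i, ‖(a : K →L[ℂ] K) (ξ i)‖ ≤ τ.norm2 a := fun a i => by
    refine abs_le_of_sq_le_sq' ?_ (τ.norm2_nonneg a) |>.2
    rw [norm2_sq]
    exact (hξ a).summable.le_tsum i (fun _ _ => by positivity) |>.trans_eq (hξ a).tsum_eq
  have hdist : ∀ n m, dist (L2.ofM τ (x n)) (L2.ofM τ (x m)) = τ.norm2 (x n - x m) := fun n m => by
    rw [dist_eq_norm, ← L2.ofM_sub, L2.norm_ofM]
  -- the span of the orbits of the defining vectors under the commutant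
  set V : Submodule ℂ K :=
    Submodule.span ℂ {v | ∃ y ∈ M.commutant, ∃ i, v = y (ξ i)} with hV
  have hVinv : ∀ y ∈ M.commutant, ∀ v ∈ V, y v ∈ V := by
    intro y hy v hv
    refine Submodule.span_induction (p := fun v _ => y v ∈ V) ?_ (by simp) ?_ ?_ hv
    · rintro _ ⟨z, hz, i, rfl⟩
      exact Submodule.subset_span ⟨y * z, mul_mem hy hz, i, rfl⟩
    · intro a b _ _ ha hb
      simpa using V.add_mem ha hb
    · intro r a _ ha
      simpa using V.smul_mem r ha
  have hVcl : ∀ y ∈ M.commutant, ∀ v ∈ V.topologicalClosure, y v ∈ V.topologicalClosure := by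
    intro y hy v hv
    exact map_mem_closure y.continuous hv fun a ha => hVinv y hy a ha
  have hVtop : V.topologicalClosure = ⊤ := by
    have hmem : V.topologicalClosure.starProjection ∈ M := by
      refine (VonNeumannAlgebra.IsStarProjection.mem_iff isStarProjection_starProjection M).2 ?_
      intro y hy v hv
      simp only [Submodule.range_starProjection, Submodule.mem_comap] at hv ⊢
      exact hVcl y hy v hv
    have h1 : (1 : M.toStarSubalgebra) - ⟨_, hmem⟩ = 0 := by
      refine hf.eq_zero ?_
      have h2 := hξ (1 - ⟨_, hmem⟩)
      have h3 : (fun n => ‖((1 - ⟨_, hmem⟩ : M.toStarSubalgebra) : K →L[ℂ] K) (ξ n)‖ ^ 2) =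
          fun _ => 0 := by
        funext n
        have : ξ n ∈ V.topologicalClosure := V.le_topologicalClosure
          (Submodule.subset_span ⟨1, one_mem _, n, rfl⟩)
        simp [Submodule.starProjection_eq_self_iff.2 this]
      rw [h3] at h2
      rw [norm2, h2.unique hasSum_zero, Real.sqrt_zero]
    have h4 : V.topologicalClosure.starProjection = 1 := (congrArg Subtype.val (sub_eq_zero.1 h1)).symm
    rw [Submodule.eq_top_iff']
    intro v
    rw [← Submodule.starProjection_eq_self_iff, h4]
    rfl
  have hcau : ∀ v : K, CauchySeq fun n => ((x n : M.toStarSubalgebra) : K →L[ℂ] K) v := by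
    have h1 : ∀ v ∈ V, ∃ l, Tendsto (fun n => ((x n : M.toStarSubalgebra) : K →L[ℂ] K) v) atTop
        (𝓝 l) := by
      intro v hv
      refine Submodule.span_induction
        (p := fun v _ => ∃ l, Tendsto (fun n => ((x n : M.toStarSubalgebra) : K →L[ℂ] K) v) atTop
          (𝓝 l)) ?_ ?_ ?_ ?_ hv
      · rintro _ ⟨y, hy, i, rfl⟩
        have h2 : CauchySeq fun n => ((x n : M.toStarSubalgebra) : K →L[ℂ] K) (ξ i) := by
          rw [Metric.cauchySeq_iff] at hx ⊢
          intro ε hε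
          obtain ⟨N, hN⟩ := hx ε hε
          refine ⟨N, fun m hm n hn => lt_of_le_of_lt ?_ (hN m hm n hn)⟩
          rw [hdist, dist_eq_norm]
          exact hξle (x m - x n) i
        obtain ⟨l, hl⟩ := cauchySeq_tendsto_of_complete h2
        refine ⟨y l, ((y.continuous.tendsto _).comp hl).congr fun n => ?_⟩
        have := VonNeumannAlgebra.mem_iff_commute.1 (x n).2 y hy
        exact congrArg (fun T : K →L[ℂ] K => T (ξ i)) this
      · exact ⟨0, by simp⟩
      · rintro a b _ _ ⟨l, hl⟩ ⟨l', hl'⟩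
        exact ⟨l + l', by simpa using hl.add hl'⟩
      · rintro r a _ ⟨l, hl⟩
        exact ⟨r • l, by simpa using hl.const_smul r⟩
    intro v
    have hv : v ∈ closure (V : Set K) := by
      rw [← Submodule.topologicalClosure_coe, hVtop]; trivial
    rw [Metric.cauchySeq_iff]
    intro ε hε
    obtain ⟨w, hw, hvw⟩ := Metric.mem_closure_iff.1 hv (ε / (3 * (c + 1))) (by positivity)
    obtain ⟨N, hN⟩ := Metric.cauchySeq_iff.1 (h1 w hw).choose_spec.cauchySeq (ε / 3) (by positivity)
    refine ⟨N, fun m hm n hn => ?_⟩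
    have h5 : ∀ k, dist (((x k : M.toStarSubalgebra) : K →L[ℂ] K) v)
        (((x k : M.toStarSubalgebra) : K →L[ℂ] K) w) < ε / 3 := fun k => by
      rw [dist_eq_norm, ← map_sub]
      refine lt_of_le_of_lt (((x k : M.toStarSubalgebra) : K →L[ℂ] K).le_of_opNorm_le (hc k) _) ?_
      rw [← dist_eq_norm]
      calc c * dist v w ≤ (c + 1) * dist v w := by gcongr; linarith
        _ < (c + 1) * (ε / (3 * (c + 1))) := by gcongr
        _ = ε / 3 := by field_simp
    have h6 := dist_triangle4 (((x m : M.toStarSubalgebra) : K →L[ℂ] K) v)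
      (((x m : M.toStarSubalgebra) : K →L[ℂ] K) w) (((x n : M.toStarSubalgebra) : K →L[ℂ] K) w)
      (((x n : M.toStarSubalgebra) : K →L[ℂ] K) v)
    have h7 := h5 n
    rw [dist_comm] at h7
    linarith [h5 m, hN m hm n hn]
  choose f hflim using fun v => cauchySeq_tendsto_of_complete (hcau v)
  set b : K →L[ℂ] K := continuousLinearMapOfTendsto
    (fun n => ((x n : M.toStarSubalgebra) : K →L[ℂ] K)) (tendsto_pi_nhds.2 hflim) with hb
  have hblim : ∀ v, Tendsto (fun n => ((x n : M.toStarSubalgebra) : K →L[ℂ] K) v) atTop (𝓝 (b v)) :=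
    hflim
  have hbM : b ∈ M := by
    refine VonNeumannAlgebra.mem_iff_commute.2 fun y hy => ?_
    ext v
    refine tendsto_nhds_unique ((y.continuous.tendsto _).comp (hblim v)) ?_
    refine (hblim (y v)).congr fun n => ?_
    exact congrArg (fun T : K →L[ℂ] K => T v) (VonNeumannAlgebra.mem_iff_commute.1 (x n).2 y hy).symm
  have hbc : ‖b‖ ≤ c := b.opNorm_le_bound hc0 fun v =>
    le_of_tendsto' (hblim v).norm fun n =>
      ((x n : M.toStarSubalgebra) : K →L[ℂ] K).le_of_opNorm_le (hc n) v
  refine ⟨⟨b, hbM⟩, hbc, ?_⟩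
  rw [Metric.tendsto_atTop]
  intro ε hε
  obtain ⟨N, hN⟩ := Metric.cauchySeq_iff.1 hx (ε / 2) (by positivity)
  refine ⟨N, fun n hn => ?_⟩
  rw [dist_zero_right, Real.norm_of_nonneg (τ.norm2_nonneg _)]
  refine lt_of_le_of_lt ?_ (half_lt_self hε)
  refine abs_le_of_sq_le_sq' ?_ (by positivity) |>.2
  rw [norm2_sq]
  refine hasSum_le_of_sum_le (hξ _) fun s => ?_
  have h8 : Tendsto (fun m => ∑ i ∈ s, ‖((x n - x m : M.toStarSubalgebra) : K →L[ℂ] K) (ξ i)‖ ^ 2)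
      atTop (𝓝 (∑ i ∈ s, ‖((x n - ⟨b, hbM⟩ : M.toStarSubalgebra) : K →L[ℂ] K) (ξ i)‖ ^ 2)) := by
    refine tendsto_finsetSum _ fun i _ => ?_
    refine Tendsto.pow (Tendsto.norm ?_) 2
    exact tendsto_const_nhds.sub (hblim (ξ i))
  refine le_of_tendsto h8 ?_
  filter_upwards [eventually_ge_atTop N] with m hm
  refine (sum_le_hasSum s (fun _ _ => by positivity) (hξ _)).trans ?_
  rw [← norm2_sq]
  have := (hN n hn m hm).le
  rw [hdist] at this
  exact pow_le_pow_left₀ (τ.norm2_nonneg _) this 2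

end NormalState

end States

section States

variable {K : Type*} [NormedAddCommGroup K] [InnerProductSpace ℂ K] [CompleteSpace K]
variable {M : VonNeumannAlgebra K} (τ : NormalState M)

/-! ### The left and right actions of `M` on `L²(M, τ)` -/

namespace L2

theorem clm_ext {F : Type*} [NormedAddCommGroup F] [NormedSpace ℂ F] {S T : L2 τ →L[ℂ] F}
    (h : ∀ x, S (ofM τ x) = T (ofM τ x)) : S = T :=
  DFunLike.coe_injective ((denseRange_ofM τ).equalizer S.continuous T.continuous (funext h))

theorem leftMul_ofM (a x : M.toStarSubalgebra) : leftMul τ a (ofM τ x) = ofM τ (a * x) := by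
  unfold leftMul ofM
  rw [ContinuousLinearMap.completion_apply_coe]
  rfl

/-- The left action of `M` on `L²(M, τ)`, as a `*`-homomorphism. -/
def leftHom : M.toStarSubalgebra →⋆ₐ[ℂ] (L2 τ →L[ℂ] L2 τ) where
  toFun := leftMul τ
  map_one' := clm_ext τ fun x => by simp [leftMul_ofM]
  map_mul' a b := clm_ext τ fun x => by simp [leftMul_ofM, mul_assoc]
  map_zero' := clm_ext τ fun x => by
    rw [leftMul_ofM, zero_mul]
    exact map_zero (ofMₗ τ)
  map_add' a b := clm_ext τ fun x => by
    simp [leftMul_ofM, add_mul, ofM_add]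
  commutes' r := clm_ext τ fun x => by
    rw [leftMul_ofM, Algebra.algebraMap_eq_smul_one, Algebra.algebraMap_eq_smul_one, smul_mul_assoc,
      one_mul, ofM_smul]
    simp
  map_star' a := by
    rw [ContinuousLinearMap.star_eq_adjoint]
    refine (ContinuousLinearMap.eq_adjoint_iff _ _).2 fun ξ η => ?_
    refine (denseRange_ofM τ).induction_on₂
      (isClosed_eq (by fun_prop) (by fun_prop)) (fun x y => ?_) ξ η
    rw [leftMul_ofM, leftMul_ofM, inner_ofM, inner_ofM, star_mul, star_star, mul_assoc]

@[simp] theorem leftHom_apply (a : M.toStarSubalgebra) : leftHom τ a = leftMul τ a := rfl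

variable {τ} (ht : τ.IsTracial)

/-- Right multiplication by `a` on `L²(M, τ)` for a trace `τ`, as a bounded operator. -/
def rightOp (_ht : τ.IsTracial) (a : M.toStarSubalgebra) : L2 τ →L[ℂ] L2 τ :=
  (LinearMap.mkContinuous
    ((PreL2.of τ).toLinearMap ∘ₗ LinearMap.mulRight ℂ a ∘ₗ (PreL2.of τ).symm.toLinearMap)
    ‖a‖ fun x => by
      rw [mul_comm]
      exact _ht.norm2_mul_le _ a).completion

theorem rightOp_ofM (a x : M.toStarSubalgebra) : rightOp ht a (ofM τ x) = ofM τ (x * a) := by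
  unfold rightOp ofM
  rw [ContinuousLinearMap.completion_apply_coe]
  rfl

theorem norm_rightOp_le (a : M.toStarSubalgebra) : ‖rightOp ht a‖ ≤ ‖a‖ := by
  refine ContinuousLinearMap.opNorm_le_bound _ (norm_nonneg _) fun ξ => ?_
  refine (denseRange_ofM τ).induction_on ξ
    (isClosed_le (by fun_prop) (by fun_prop)) fun x => ?_
  rw [rightOp_ofM, norm_ofM, norm_ofM, mul_comm]
  exact ht.norm2_mul_le x a

theorem star_rightOp (a : M.toStarSubalgebra) :
    star (rightOp ht a) = rightOp ht (star a) := by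
  symm
  rw [ContinuousLinearMap.star_eq_adjoint]
  refine (ContinuousLinearMap.eq_adjoint_iff _ _).2 fun ξ η => ?_
  refine (denseRange_ofM τ).induction_on₂
    (isClosed_eq (by fun_prop) (by fun_prop)) (fun x y => ?_) ξ η
  rw [rightOp_ofM, rightOp_ofM, inner_ofM, inner_ofM, star_mul, star_star, mul_assoc, ht, mul_assoc]

theorem leftMul_mul_rightOp (a b : M.toStarSubalgebra) :
    leftMul τ a * rightOp ht b = rightOp ht b * leftMul τ a :=
  clm_ext τ fun x => by simp [rightOp_ofM, leftMul_ofM, mul_assoc]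

end L2

/-! ### Averaging over a group of unitaries -/

theorem combo_mem_closure_image {V E : Type*} [AddCommGroup V] [Module ℂ V] [NormedAddCommGroup E]
    [NormedSpace ℂ E] (f : V →ₗ[ℂ] E) {C : Set V} (hC : Convex ℝ C) {a b : E}
    (ha : a ∈ closure (f '' C)) (hb : b ∈ closure (f '' C)) {s t : ℝ} (hs : 0 ≤ s) (ht : 0 ≤ t)
    (hst : s + t = 1) : (s : ℂ) • a + (t : ℂ) • b ∈ closure (f '' C) := by
  refine map_mem_closure₂ (f := fun a b : E => (s : ℂ) • a + (t : ℂ) • b) (by fun_prop) ha hb ?_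
  rintro _ ⟨y, hy, rfl⟩ _ ⟨z, hz, rfl⟩
  exact ⟨s • y + t • z, hC hy hz hs ht hst, by
    rw [map_add, ← Complex.coe_smul, ← Complex.coe_smul, map_smul, map_smul]⟩

/-- A closed convex set in a complex Hilbert space has a unique point of minimal norm. -/
theorem exists_unique_norm_min {E : Type*} [NormedAddCommGroup E] [InnerProductSpace ℂ E]
    [CompleteSpace E] {C : Set E} (hne : C.Nonempty) (hcl : IsClosed C)
    (hconv : ∀ a ∈ C, ∀ b ∈ C, ∀ s t : ℝ, 0 ≤ s → 0 ≤ t → s + t = 1 →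
      (s : ℂ) • a + (t : ℂ) • b ∈ C) :
    ∃ ζ ∈ C, ∀ η ∈ C, ‖η‖ ≤ ‖ζ‖ → η = ζ := by
  let _ : InnerProductSpace ℝ E := InnerProductSpace.rclikeToReal ℂ E
  have hC : Convex ℝ C := fun a ha b hb s t hs ht hst => hconv a ha b hb s t hs ht hst
  obtain ⟨ζ, hζC, hζ⟩ := exists_norm_eq_iInf_of_complete_convex hne hcl.isComplete hC (0 : E)
  have hmin : ∀ η ∈ C, ‖ζ‖ ≤ ‖η‖ := by
    intro η hη
    have h2 : ‖0 - ζ‖ ≤ ‖0 - η‖ := by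
      rw [hζ]
      exact ciInf_le (f := fun w : C => ‖0 - (w : E)‖)
        ⟨0, by rintro _ ⟨w, rfl⟩; exact norm_nonneg _⟩ ⟨η, hη⟩
    simpa using h2
  refine ⟨ζ, hζC, fun η hη hle => ?_⟩
  by_contra hne
  have h6 := norm_combo_lt_of_ne hle le_rfl hne (a := (1 / 2 : ℝ)) (b := 1 / 2)
    (by norm_num) (by norm_num) (by norm_num)
  exact absurd (hmin _ (hC hη hζC (by norm_num) (by norm_num) (by norm_num))) (not_le.2 h6)

namespace NormalState

variable {τ}

theorem unitary_norm_le (u : M.toStarSubalgebra) (hu : u ∈ unitary M.toStarSubalgebra) :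
    ‖u‖ ≤ 1 := by
  rcases subsingleton_or_nontrivial M.toStarSubalgebra with h | h
  · simp [Subsingleton.elim u 0]
  · exact (CStarRing.norm_of_mem_unitary hu).le

theorem norm2_unitary_mul {u : M.toStarSubalgebra} (hu : u ∈ unitary M.toStarSubalgebra)
    (x : M.toStarSubalgebra) : τ.norm2 (u * x) = τ.norm2 x := by
  unfold norm2
  rw [star_mul, mul_assoc, ← mul_assoc (star u), Unitary.star_mul_self_of_mem hu, one_mul]

theorem IsTracial.norm2_mul_unitary (ht : τ.IsTracial) {u : M.toStarSubalgebra}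
    (hu : u ∈ unitary M.toStarSubalgebra) (x : M.toStarSubalgebra) :
    τ.norm2 (x * u) = τ.norm2 x := by
  rw [← ht.norm2_star, star_mul, norm2_unitary_mul (Unitary.star_mem hu), ht.norm2_star]

theorem convexHull_conj_invariant {G : Submonoid M.toStarSubalgebra} {u : M.toStarSubalgebra}
    (hu : u ∈ G) (x : M.toStarSubalgebra) {y : M.toStarSubalgebra}
    (hy : y ∈ convexHull ℝ {z | ∃ v ∈ G, z = v * x * star v}) :
    u * y * star u ∈ convexHull ℝ {z | ∃ v ∈ G, z = v * x * star v} := by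
  set L : M.toStarSubalgebra →ₗ[ℝ] M.toStarSubalgebra :=
    (LinearMap.mulRight ℂ (star u) ∘ₗ LinearMap.mulLeft ℂ u).restrictScalars ℝ
  have h : L y ∈ L '' convexHull ℝ {z | ∃ v ∈ G, z = v * x * star v} := ⟨y, hy, rfl⟩
  rw [LinearMap.image_convexHull] at h
  refine convexHull_mono ?_ h
  rintro _ ⟨_, ⟨v, hv, rfl⟩, rfl⟩
  exact ⟨u * v, mul_mem hu hv, by simp [L, mul_assoc]⟩

/-- Averaging `x ∈ M` over a group `G` of unitaries: the element of minimal 2-norm in the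
2-norm closure of the convex hull of `{u x u* | u ∈ G}` lies in `M` as balls are complete, and
commutes with `G` as it is unique. -/
theorem exists_average (ht : τ.IsTracial) (hf : τ.IsFaithful) (G : Submonoid M.toStarSubalgebra)
    (hG : ∀ u ∈ G, u ∈ unitary M.toStarSubalgebra) (x : M.toStarSubalgebra) :
    ∃ b : M.toStarSubalgebra, ‖b‖ ≤ ‖x‖ ∧ (∀ u ∈ G, u * b = b * u) ∧
      ∀ ε : ℝ, 0 < ε → ∃ y ∈ convexHull ℝ {z | ∃ u ∈ G, z = u * x * star u},
        τ.norm2 (y - b) < ε := by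
  set C₀ : Set M.toStarSubalgebra := convexHull ℝ {z | ∃ u ∈ G, z = u * x * star u} with hC₀
  have hC₀norm : ∀ y ∈ C₀, ‖y‖ ≤ ‖x‖ := by
    have h1 : C₀ ⊆ Metric.closedBall 0 ‖x‖ := by
      refine convexHull_min ?_ (convex_closedBall _ _)
      rintro _ ⟨u, hu, rfl⟩
      rw [mem_closedBall_zero_iff]
      have h2 := unitary_norm_le u (hG u hu)
      have h3 := unitary_norm_le (star u) (Unitary.star_mem (hG u hu))
      calc ‖u * x * star u‖ ≤ ‖u * x‖ * ‖star u‖ := norm_mul_le _ _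
        _ ≤ (‖u‖ * ‖x‖) * ‖star u‖ := by gcongr; exact norm_mul_le _ _
        _ ≤ (1 * ‖x‖) * 1 := by gcongr
        _ = ‖x‖ := by ring
    exact fun y hy => by simpa using h1 hy
  set C : Set (L2 τ) := closure (L2.ofM τ '' C₀) with hC
  have hCconv : ∀ a ∈ C, ∀ b ∈ C, ∀ s t : ℝ, 0 ≤ s → 0 ≤ t → s + t = 1 →
      (s : ℂ) • a + (t : ℂ) • b ∈ C :=
    fun a ha b hb s t hs ht hst =>
      combo_mem_closure_image (L2.ofMₗ τ) (convex_convexHull ℝ _) ha hb hs ht hst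
  have hCne : C.Nonempty := by
    refine (Set.Nonempty.image _ ?_).closure
    exact ⟨x, subset_convexHull ℝ _ ⟨1, one_mem _, by simp⟩⟩
  obtain ⟨ζ, hζC, hζ⟩ := exists_unique_norm_min hCne isClosed_closure hCconv
  obtain ⟨s, hs, hslim⟩ := mem_closure_iff_seq_limit.1 hζC
  choose y hyC hys using hs
  obtain ⟨b, hbx, hb⟩ := τ.exists_tendsto_of_cauchySeq hf y (fun n => hC₀norm _ (hyC n))
    (by simpa only [hys] using hslim.cauchySeq)
  have hofM : L2.ofM τ b = ζ := by
    refine tendsto_nhds_unique (f := fun n => L2.ofM τ (y n)) ?_ (by simpa only [hys] using hslim)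
    rw [tendsto_iff_norm_sub_tendsto_zero]
    simpa only [← L2.ofM_sub, L2.norm_ofM] using hb
  refine ⟨b, hbx, fun u hu => ?_, fun ε hε => ?_⟩
  · have hu1 := hG u hu
    have h3 : L2.ofM τ (u * b * star u) ∈ C := by
      refine mem_closure_of_tendsto (f := fun n => L2.ofM τ (u * y n * star u)) (b := atTop) ?_
        (Eventually.of_forall fun n => ⟨_, convexHull_conj_invariant hu x (hyC n), rfl⟩)
      rw [tendsto_iff_norm_sub_tendsto_zero]
      refine hb.congr fun n => ?_
      rw [← L2.ofM_sub, L2.norm_ofM, ← sub_mul, ← mul_sub,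
        ht.norm2_mul_unitary (Unitary.star_mem hu1), norm2_unitary_mul hu1]
    have h4 : ‖L2.ofM τ (u * b * star u)‖ = ‖ζ‖ := by
      rw [← hofM, L2.norm_ofM, L2.norm_ofM,
        ht.norm2_mul_unitary (Unitary.star_mem hu1), norm2_unitary_mul hu1]
    have h5 : L2.ofM τ (u * b * star u) = ζ := hζ _ h3 h4.le
    have h7 : u * b * star u = b := by
      refine sub_eq_zero.1 (hf.eq_zero ?_)
      rw [← L2.norm_ofM, L2.ofM_sub, h5, hofM, sub_self, norm_zero]
    calc u * b = u * b * (star u * u) := by rw [Unitary.star_mul_self_of_mem hu1, mul_one]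
      _ = (u * b * star u) * u := by simp only [mul_assoc]
      _ = b * u := by rw [h7]
  · obtain ⟨n, hn⟩ := ((tendsto_order.1 hb).2 ε hε).exists
    exact ⟨y n, hyC n, hn⟩

end NormalState

/-- The unitaries span `M`. -/
theorem VonNeumannAlgebra.mem_span_unitary (x : M.toStarSubalgebra) :
    x ∈ Submodule.span ℂ (unitary M.toStarSubalgebra : Set M.toStarSubalgebra) := by
  rw [CStarAlgebra.span_unitary]
  trivial

theorem VonNeumannAlgebra.commute_of_forall_unitary {b : M.toStarSubalgebra}
    (h : ∀ u ∈ unitary M.toStarSubalgebra, u * b = b * u) (x : M.toStarSubalgebra) :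
    x * b = b * x := by
  refine Submodule.span_induction (p := fun x _ => x * b = b * x) (fun u hu => h u hu) (by simp)
    ?_ ?_ (mem_span_unitary x)
  · intro x y _ _ hx hy
    rw [add_mul, mul_add, hx, hy]
  · intro c x _ hx
    rw [smul_mul_assoc, mul_smul_comm, hx]

/-- In a factor, the average of `x` over all unitaries is `τ x`. -/
theorem IsIIOneFactor.exists_convexHull_near {τ : NormalState M} (hM : IsIIOneFactor τ)
    (x : M.toStarSubalgebra) (ε : ℝ) (hε : 0 < ε) :
    ∃ y ∈ convexHull ℝ {z | ∃ u ∈ unitary M.toStarSubalgebra, z = u * x * star u},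
      τ.norm2 (y - τ x • (1 : M.toStarSubalgebra)) < ε := by
  obtain ⟨b, -, hb, hbε⟩ := NormalState.exists_average hM.tracial hM.faithful
    (unitary M.toStarSubalgebra) (fun _ h => h) x
  obtain ⟨c, rfl⟩ := hM.center b fun x => (VonNeumannAlgebra.commute_of_forall_unitary hb x).symm
  have hconst : ∀ y ∈ convexHull ℝ {z | ∃ u ∈ unitary M.toStarSubalgebra, z = u * x * star u},
      τ y = τ x := by
    have h1 : convexHull ℝ {z | ∃ u ∈ unitary M.toStarSubalgebra, z = u * x * star u} ⊆
        (τ.toLinearMap.restrictScalars ℝ) ⁻¹' {τ x} := by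
      refine convexHull_min ?_ ((convex_singleton _).linear_preimage _)
      rintro _ ⟨u, hu, rfl⟩
      simp only [Set.mem_preimage, LinearMap.coe_restrictScalars, Set.mem_singleton_iff]
      rw [hM.tracial, ← mul_assoc, Unitary.star_mul_self_of_mem hu, one_mul]
    exact h1
  have hc : c = τ x := by
    refine eq_of_forall_dist_le fun δ hδ => ?_
    obtain ⟨y, hy, hyδ⟩ := hbε δ hδ
    have h2 := (τ.norm_apply_le _).trans hyδ.le
    rw [map_sub, hconst y hy, map_smul, τ.map_one, smul_eq_mul, mul_one] at h2
    rwa [dist_comm, dist_eq_norm]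
  rw [← hc]
  exact hbε ε hε

/-- In a factor, a vector of `L²(M, τ)` that commutes with `M` is a scalar. -/
theorem IsIIOneFactor.inner_eq_of_central {τ : NormalState M} (hM : IsIIOneFactor τ) {ξ : L2 τ}
    (hξ : ∀ a, L2.leftMul τ a ξ = L2.rightOp hM.tracial a ξ) (x : M.toStarSubalgebra) :
    ⟪ξ, L2.ofM τ x⟫_ℂ = τ x * ⟪ξ, L2.ofM τ 1⟫_ℂ := by
  have hconst : ∀ y ∈ convexHull ℝ {z | ∃ u ∈ unitary M.toStarSubalgebra, z = u * x * star u},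
      ⟪ξ, L2.ofM τ y⟫_ℂ = ⟪ξ, L2.ofM τ x⟫_ℂ := by
    have h1 : convexHull ℝ {z | ∃ u ∈ unitary M.toStarSubalgebra, z = u * x * star u} ⊆
        (((innerSL ℂ ξ).toLinearMap ∘ₗ L2.ofMₗ τ).restrictScalars ℝ) ⁻¹'
          {⟪ξ, L2.ofM τ x⟫_ℂ} := by
      refine convexHull_min ?_ ((convex_singleton _).linear_preimage _)
      rintro _ ⟨u, hu, rfl⟩
      simp only [Set.mem_preimage, LinearMap.coe_restrictScalars, Set.mem_singleton_iff,
        LinearMap.comp_apply, L2.ofMₗ_apply, ContinuousLinearMap.coe_coe, innerSL_apply_apply]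
      rw [← L2.rightOp_ofM hM.tracial, ← L2.leftMul_ofM,
        ← ContinuousLinearMap.adjoint_inner_left, ← ContinuousLinearMap.star_eq_adjoint,
        L2.star_rightOp, star_star, ← hξ, ← ContinuousLinearMap.adjoint_inner_right,
        ← ContinuousLinearMap.star_eq_adjoint, ← L2.leftHom_apply, ← map_star, L2.leftHom_apply,
        L2.leftHom_apply, L2.leftMul_ofM, L2.leftMul_ofM, ← mul_assoc,
        Unitary.star_mul_self_of_mem hu, one_mul]
    exact h1
  refine eq_of_forall_dist_le fun δ hδ => ?_
  obtain ⟨y, hy, hyδ⟩ := hM.exists_convexHull_near x (δ / (‖ξ‖ + 1)) (by positivity)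
  rw [← hconst y hy, ← inner_smul_right (𝕜 := ℂ) ξ, ← L2.ofM_smul, dist_eq_norm,
    ← inner_sub_right, ← L2.ofM_sub]
  refine (norm_inner_le_norm _ _).trans ?_
  rw [L2.norm_ofM]
  calc ‖ξ‖ * _ ≤ (‖ξ‖ + 1) * (δ / (‖ξ‖ + 1)) := by
        gcongr
        · have := τ.norm2_nonneg (y - τ x • (1 : M.toStarSubalgebra)); linarith
        · linarith
    _ = δ := by field_simp

end States

section States

variable {K : Type*} [NormedAddCommGroup K] [InnerProductSpace ℂ K] [CompleteSpace K]
variable {M : VonNeumannAlgebra K}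

/-! ### Range projections, polar decomposition, spectral projections -/

namespace VonNeumannAlgebra

theorem starProjection_range_mem (x : M.toStarSubalgebra) :
    (x : K →L[ℂ] K).range.topologicalClosure.starProjection ∈ M := by
  refine (IsStarProjection.mem_iff isStarProjection_starProjection M).2 fun y hy v hv => ?_
  simp only [Submodule.range_starProjection, Submodule.mem_comap] at hv ⊢
  refine map_mem_closure y.continuous hv ?_
  rintro _ ⟨w, rfl⟩
  exact ⟨y w, (congrArg (fun T : K →L[ℂ] K => T w) (mem_iff_commute.1 x.2 y hy)).symm⟩

/-- The range projection of `x ∈ M`. -/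
def rangeProj (x : M.toStarSubalgebra) : M.toStarSubalgebra :=
  ⟨(x : K →L[ℂ] K).range.topologicalClosure.starProjection, starProjection_range_mem x⟩

theorem isStarProjection_rangeProj (x : M.toStarSubalgebra) : IsStarProjection (rangeProj x) := by
  have h := isStarProjection_starProjection (𝕜 := ℂ) (E := K)
    (U := (x : K →L[ℂ] K).range.topologicalClosure)
  exact ⟨Subtype.ext h.isIdempotentElem, Subtype.ext h.isSelfAdjoint⟩

theorem rangeProj_mul_self (x : M.toStarSubalgebra) : rangeProj x * x = x := by
  refine Subtype.ext (ContinuousLinearMap.ext fun v => ?_)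
  exact Submodule.starProjection_eq_self_iff.2 (Submodule.le_topologicalClosure _ ⟨v, rfl⟩)

theorem mul_rangeProj_eq_zero {x y : M.toStarSubalgebra} (h : y * x = 0) :
    y * rangeProj x = 0 := by
  refine Subtype.ext (ContinuousLinearMap.ext fun v => ?_)
  have h1 : ∀ w ∈ (x : K →L[ℂ] K).range.topologicalClosure, (y : K →L[ℂ] K) w = 0 := by
    intro w hw
    have h2 : IsClosed {w | (y : K →L[ℂ] K) w = 0} :=
      isClosed_eq (y : K →L[ℂ] K).continuous continuous_const
    refine h2.closure_subset_iff.2 ?_ hw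
    rintro _ ⟨u, rfl⟩
    exact congrArg (fun T : M.toStarSubalgebra => (T : K →L[ℂ] K) u) h
  exact h1 _ (Submodule.starProjection_apply_mem _ v)

theorem rangeProj_mul_eq_zero {x y : M.toStarSubalgebra} (hx : IsSelfAdjoint x) (h : x * y = 0) :
    rangeProj x * y = 0 := by
  have h1 : star y * x = 0 := by
    rw [← star_star (star y * x), star_mul, star_star, hx.star_eq, h, star_zero]
  rw [← star_star (rangeProj x * y), star_mul, (isStarProjection_rangeProj x).isSelfAdjoint.star_eq,
    mul_rangeProj_eq_zero h1, star_zero]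

theorem rangeProj_ne_zero {x : M.toStarSubalgebra} (hx : x ≠ 0) : rangeProj x ≠ 0 := by
  intro h
  rw [← rangeProj_mul_self x, h, zero_mul] at hx
  exact hx rfl

/-- Every `t ≠ 0` in `M` dominates a nonzero partial isometry `w = t g(h) e`, where `h = t* t`, `e`
is a spectral projection of `h` away from `0`, and `g(s) = s^(-1/2)` on the range of `e`. -/
theorem exists_partialIsometry_of_ne_zero {t : M.toStarSubalgebra} (ht : t ≠ 0) :
    ∃ w : M.toStarSubalgebra, w ≠ 0 ∧ w * star w * w = w ∧ (∀ y, y * t = 0 → y * w = 0) ∧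
      ∀ y, t * y = 0 → w * y = 0 := by
  set h := star t * t with hh
  have hsa : IsSelfAdjoint h := IsSelfAdjoint.star_mul_self t
  set c : ℝ := ‖h‖ / 2 with hc
  have hhpos : 0 < ‖h‖ := by
    rw [norm_pos_iff]
    exact fun h0 => ht (CStarRing.star_mul_self_eq_zero_iff t |>.1 h0)
  have hcpos : 0 < c := by positivity
  set k := cfc (fun s : ℝ => max (s - c) 0) h with hk
  have hksa : IsSelfAdjoint k := cfc_predicate _ h
  have hgc : Continuous fun s : ℝ => (√(max s c))⁻¹ :=
    Continuous.inv₀ (by fun_prop) fun s => by positivity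
  set g := cfc (fun s : ℝ => (√(max s c))⁻¹) h with hg
  have hgsa : IsSelfAdjoint g := cfc_predicate _ h
  have hqc : Continuous fun s : ℝ => max (s - c) 0 * (max s c)⁻¹ :=
    Continuous.mul (by fun_prop) (Continuous.inv₀ (by fun_prop) fun s => by positivity)
  have hk0 : k ≠ 0 := by
    intro h0
    have h1 : h = cfc (fun s : ℝ => min s c) h := by
      have h2 : cfc (fun s : ℝ => min s c + max (s - c) 0) h = h := by
        refine (cfc_congr fun s _ => ?_).trans (cfc_id' ℝ h)
        rcases le_total s c with h3 | h3
        · simp [h3]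
        · simp [h3]
      rw [cfc_add h (fun s : ℝ => min s c) (fun s => max (s - c) 0) (by fun_prop) (by fun_prop),
        ← hk, h0, add_zero] at h2
      exact h2.symm
    have h2 : ‖h‖ ≤ c := by
      conv_lhs => rw [h1]
      refine norm_cfc_le hcpos.le fun s hs => ?_
      have h3 : 0 ≤ s := spectrum_star_mul_self_nonneg s hs
      rw [Real.norm_of_nonneg (le_min h3 hcpos.le)]
      exact min_le_right _ _
    linarith
  have hgk : g * h * g * k = k := by
    have h1 : g * h * g * k = cfc (fun s : ℝ => (√(max s c))⁻¹ * s * (√(max s c))⁻¹ *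
        max (s - c) 0) h := by
      rw [cfc_mul _ _ h (by fun_prop (disch := intros; positivity))
        (by fun_prop),
        cfc_mul _ _ h (by fun_prop (disch := intros; positivity)) hgc.continuousOn,
        cfc_mul _ _ h hgc.continuousOn (by fun_prop), cfc_id' ℝ h]
    rw [h1]
    refine cfc_congr fun s _ => ?_
    rcases le_total s c with h3 | h3
    · simp [h3]
    · have h4 : 0 < s := hcpos.trans_le h3
      have h5 : (√s)⁻¹ * s * (√s)⁻¹ = 1 := by
        have := Real.mul_self_sqrt h4.le
        field_simp
        nlinarith
      rw [max_eq_left h3, h5, one_mul]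
  have hkq : k = cfc (fun s : ℝ => max (s - c) 0 * (max s c)⁻¹) h * h := by
    conv_rhs => rw [← cfc_id' ℝ h, cfc_id' ℝ h]
    have h1 := cfc_mul (fun s : ℝ => max (s - c) 0 * (max s c)⁻¹) (fun s => s) h
      hqc.continuousOn (by fun_prop)
    rw [cfc_id' ℝ h] at h1
    rw [← h1, hk]
    refine cfc_congr fun s _ => ?_
    rcases le_total s c with h3 | h3
    · simp [h3]
    · have h4 : 0 < s := hcpos.trans_le h3
      rw [max_eq_left h3, mul_assoc, inv_mul_cancel₀ h4.ne', mul_one]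
  set e := rangeProj k with he
  have hproj := isStarProjection_rangeProj k
  have hee : e * e = e := hproj.isIdempotentElem
  have hes : star e = e := hproj.isSelfAdjoint
  have hge : g * h * g * e = e := by
    have h1 : (g * h * g - 1) * k = 0 := by rw [sub_mul, one_mul, hgk, sub_self]
    have h2 := mul_rangeProj_eq_zero h1
    rwa [sub_mul, one_mul, sub_eq_zero] at h2
  have hww : star (t * g * e) * (t * g * e) = e := by
    have h1 : star (t * g * e) * (t * g * e) = e * (g * (star t * t) * g * e) := by
      simp only [star_mul, hes, hgsa.star_eq, mul_assoc]
    rw [h1, ← hh, hge, hee]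
  refine ⟨t * g * e, ?_, ?_, ?_, ?_⟩
  · intro h0
    rw [h0, mul_zero] at hww
    exact rangeProj_ne_zero hk0 hww.symm
  · rw [mul_assoc, hww, mul_assoc, hee]
  · intro y hy
    rw [← mul_assoc, ← mul_assoc, hy, zero_mul, zero_mul]
  · intro y hy
    have h1 : k * y = 0 := by
      rw [hkq, hh, mul_assoc, mul_assoc, hy, mul_zero, mul_zero]
    rw [mul_assoc, rangeProj_mul_eq_zero hksa h1, mul_zero]

/-- A self-adjoint `b` that is almost idempotent in the 2-norm is close to a projection, namely to
the spectral projection of `b` for `(1/2, ∞)`. -/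
theorem exists_isStarProjection_near (τ : NormalState M) {b : M.toStarSubalgebra}
    (hb : IsSelfAdjoint b) :
    ∃ e : M.toStarSubalgebra, IsStarProjection e ∧ τ.norm2 (e - b) ≤ 4 * τ.norm2 (b - b * b) := by
  set k := cfc (fun s : ℝ => max (s - 1 / 2) 0) b with hk
  have hksa : IsSelfAdjoint k := cfc_predicate _ b
  have hg1c : Continuous fun s : ℝ => (max s (1 / 2))⁻¹ :=
    Continuous.inv₀ (by fun_prop) fun s => by positivity
  have hg2c : Continuous fun s : ℝ => (max (1 - s) (1 / 2))⁻¹ :=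
    Continuous.inv₀ (by fun_prop) fun s => by positivity
  set g₁ := cfc (fun s : ℝ => (max s (1 / 2))⁻¹) b with hg₁
  set g₂ := cfc (fun s : ℝ => (max (1 - s) (1 / 2))⁻¹) b with hg₂
  have hg₁n : ‖g₁‖ ≤ 2 := norm_cfc_le (by norm_num) fun s _ => by
    rw [norm_inv, Real.norm_of_nonneg (by positivity)]
    exact inv_le_of_inv_le₀ (by norm_num) ((le_max_right _ _).trans' (by norm_num))
  have hg₂n : ‖g₂‖ ≤ 2 := norm_cfc_le (by norm_num) fun s _ => by
    rw [norm_inv, Real.norm_of_nonneg (by positivity)]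
    exact inv_le_of_inv_le₀ (by norm_num) ((le_max_right _ _).trans' (by norm_num))
  set e := rangeProj k with he
  have hproj := isStarProjection_rangeProj k
  have h1 : e = e * g₁ * b := by
    have h2 : k * (1 - g₁ * b) = 0 := by
      have h3 : k * (g₁ * b) = cfc (fun s : ℝ => max (s - 1 / 2) 0 * ((max s (1 / 2))⁻¹ * s)) b := by
        rw [cfc_mul _ _ b (by fun_prop) (by fun_prop (disch := intros; positivity)),
          cfc_mul _ _ b hg1c.continuousOn (by fun_prop), cfc_id' ℝ b]
      rw [mul_sub, mul_one, h3, sub_eq_zero]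
      refine cfc_congr fun s _ => ?_
      rcases le_total s (1 / 2) with h4 | h4
      · have h5 : s - 1 / 2 ≤ 0 := by linarith
        rw [max_eq_right h5, zero_mul]
      · rw [max_eq_left h4, inv_mul_cancel₀ (by linarith), mul_one]
    have h3 := rangeProj_mul_eq_zero hksa h2
    rw [mul_sub, mul_one, sub_eq_zero] at h3
    rw [mul_assoc]
    exact h3
  have h2 : (1 - e) = (1 - e) * g₂ * (1 - b) := by
    have h3 : 1 - g₂ * (1 - b) = (2 : ℝ) • k := by
      have h4 : g₂ * (1 - b) = cfc (fun s : ℝ => (max (1 - s) (1 / 2))⁻¹ * (1 - s)) b := by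
        rw [cfc_mul _ _ b hg2c.continuousOn (by fun_prop), cfc_sub _ _ b (by fun_prop) (by fun_prop),
          cfc_id' ℝ b, cfc_const_one ℝ b]
      rw [h4, ← cfc_const_one ℝ b, ← cfc_sub _ _ b (by fun_prop)
          (by fun_prop (disch := intros; positivity)),
        hk, ← cfc_smul _ _ b (by fun_prop)]
      refine cfc_congr fun s _ => ?_
      simp only [smul_eq_mul]
      rcases le_total s (1 / 2) with h5 | h5
      · rw [max_eq_left (by linarith), max_eq_right (by linarith), inv_mul_cancel₀ (by linarith)]
        norm_num
      · rw [max_eq_right (by linarith), max_eq_left (by linarith)]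
        norm_num
        ring
    have h4 : (1 - e) * (1 - g₂ * (1 - b)) = 0 := by
      rw [h3, mul_smul_comm, sub_mul, one_mul, rangeProj_mul_self, sub_self, smul_zero]
    rw [mul_sub, mul_one, sub_eq_zero] at h4
    rw [mul_assoc]
    exact h4
  have h3 : e - b = (e * g₁ - (1 - e) * g₂) * (b - b * b) := by
    have h5 : e - b = e * (1 - b) - (1 - e) * b := by noncomm_ring
    have h6 : e * (1 - b) = e * g₁ * (b - b * b) := by
      conv_lhs => rw [h1]
      noncomm_ring
    have h7 : (1 - e) * b = (1 - e) * g₂ * (b - b * b) := by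
      conv_lhs => rw [h2]
      noncomm_ring
    rw [h5, h6, h7, ← sub_mul]
  refine ⟨e, hproj, ?_⟩
  rw [h3]
  refine (τ.norm2_mul_le _ _).trans ?_
  gcongr
  · exact τ.norm2_nonneg _
  · have h8 : ‖e * g₁‖ ≤ 2 := by
      refine (norm_mul_le _ _).trans ?_
      nlinarith [hproj.norm_le, norm_nonneg e, norm_nonneg g₁]
    have h9 : ‖(1 - e) * g₂‖ ≤ 2 := by
      refine (norm_mul_le _ _).trans ?_
      nlinarith [hproj.one_sub.norm_le, norm_nonneg (1 - e), norm_nonneg g₂]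
    linarith [norm_sub_le (e * g₁) ((1 - e) * g₂)]

end VonNeumannAlgebra

end States

section States

variable {K : Type*} [NormedAddCommGroup K] [InnerProductSpace ℂ K] [CompleteSpace K]
variable {M : VonNeumannAlgebra K} {τ : NormalState M}

/-! ### Maximal partial isometries -/

namespace NormalState

theorem isStarProjection_star_mul_self {v : M.toStarSubalgebra} (hv : v * star v * v = v) :
    IsStarProjection (star v * v) :=
  ⟨by
    change star v * v * (star v * v) = star v * v
    rw [mul_assoc, ← mul_assoc v, hv], IsSelfAdjoint.star_mul_self v⟩

theorem isStarProjection_mul_star_self {v : M.toStarSubalgebra} (hv : v * star v * v = v) :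
    IsStarProjection (v * star v) :=
  ⟨by
    change v * star v * (v * star v) = v * star v
    rw [← mul_assoc, hv], IsSelfAdjoint.mul_star_self v⟩

theorem norm_partialIsometry_le {v : M.toStarSubalgebra} (hv : v * star v * v = v) : ‖v‖ ≤ 1 := by
  have h := (isStarProjection_star_mul_self hv).norm_le
  rw [CStarRing.norm_star_mul_self] at h
  nlinarith [norm_nonneg v]

theorem norm2_le_one {v : M.toStarSubalgebra} (hv : v * star v * v = v) : τ.norm2 v ≤ 1 :=
  (τ.norm2_le_norm v).trans (norm_partialIsometry_le hv)

theorem IsTracial.tendsto_mul (ht : τ.IsTracial) {x y : ℕ → M.toStarSubalgebra}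
    {b c : M.toStarSubalgebra} (hx1 : ∀ n, ‖x n‖ ≤ 1)
    (hx : Tendsto (fun n => τ.norm2 (x n - b)) atTop (𝓝 0))
    (hy : Tendsto (fun n => τ.norm2 (y n - c)) atTop (𝓝 0)) :
    Tendsto (fun n => τ.norm2 (x n * y n - b * c)) atTop (𝓝 0) := by
  refine squeeze_zero (fun _ => τ.norm2_nonneg _) (g := fun n =>
    τ.norm2 (y n - c) + τ.norm2 (x n - b) * ‖c‖) (fun n => ?_)
    (by simpa using hy.add (hx.mul_const ‖c‖))
  have h1 : x n * y n - b * c = x n * (y n - c) + (x n - b) * c := by noncomm_ring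
  rw [h1]
  refine (τ.norm2_add_le _ _).trans ?_
  gcongr
  · refine (τ.norm2_mul_le _ _).trans ?_
    nlinarith [hx1 n, τ.norm2_nonneg (y n - c)]
  · exact ht.norm2_mul_le _ _

theorem IsTracial.tendsto_star (ht : τ.IsTracial) {x : ℕ → M.toStarSubalgebra}
    {b : M.toStarSubalgebra} (hx : Tendsto (fun n => τ.norm2 (x n - b)) atTop (𝓝 0)) :
    Tendsto (fun n => τ.norm2 (star (x n) - star b)) atTop (𝓝 0) := by
  simpa only [← star_sub, ht.norm2_star] using hx

theorem IsTracial.partialIsometry_of_tendsto (ht : τ.IsTracial) (hf : τ.IsFaithful)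
    {x : ℕ → M.toStarSubalgebra} {b : M.toStarSubalgebra} (hx1 : ∀ n, x n * star (x n) * x n = x n)
    (hx : Tendsto (fun n => τ.norm2 (x n - b)) atTop (𝓝 0)) : b * star b * b = b := by
  have hn := fun n => norm_partialIsometry_le (hx1 n)
  refine hf.eq_of_tendsto (x := x) ?_ hx
  refine (ht.tendsto_mul (fun n => ?_) (ht.tendsto_mul hn hx (ht.tendsto_star hx)) hx).congr
    fun n => by rw [hx1]
  exact (isStarProjection_mul_star_self (hx1 n)).norm_le

/-- If `w` extends the partial isometry `v`, the 2-norms satisfy Pythagoras. -/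
theorem norm2_sub_sq {v w : M.toStarSubalgebra} (h : star v * (w - v) = 0) :
    τ.norm2 (w - v) ^ 2 = τ.norm2 w ^ 2 - τ.norm2 v ^ 2 := by
  have h1 : star v * w = star v * v := by rwa [mul_sub, sub_eq_zero] at h
  have h2 : star w * v = star v * v := by
    rw [← star_star (star w * v), star_mul, star_star, h1, star_mul, star_star]
  rw [norm2_sq, norm2_sq, norm2_sq, star_sub, sub_mul, mul_sub, mul_sub, h1, h2, sub_self, sub_zero,
    map_sub, Complex.sub_re]

/-- A nonempty set of partial isometries which is closed in the 2-norm contains an element that has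
no proper extension in the set. (Along a chain of extensions the 2-norm increases, so a chain
contains a Cauchy sequence whose limit is an upper bound, and Zorn's lemma applies.) -/
theorem exists_maximal_partialIsometry (ht : τ.IsTracial) (hf : τ.IsFaithful)
    (S : Set M.toStarSubalgebra) (h0 : S.Nonempty) (hS : ∀ v ∈ S, v * star v * v = v)
    (hcl : ∀ (x : ℕ → M.toStarSubalgebra) (b : M.toStarSubalgebra), (∀ n, x n ∈ S) →
      Tendsto (fun n => τ.norm2 (x n - b)) atTop (𝓝 0) → b ∈ S) :
    ∃ v ∈ S, ∀ d, v + d ∈ S → d * star v = 0 → star v * d = 0 → d = 0 := by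
  let r : S → S → Prop := fun v w => (w.1 - v.1) * star v.1 = 0 ∧ star v.1 * (w.1 - v.1) = 0
  have hrrefl : ∀ v, r v v := fun v => by simp [r]
  have hrtrans : ∀ {u v w}, r u v → r v w → r u w := by
    rintro ⟨u, hu⟩ ⟨v, hv⟩ ⟨w, hw⟩ ⟨h1, h2⟩ ⟨h3, h4⟩
    simp only [r] at h1 h2 h3 h4 ⊢
    have hu1 := hS u hu
    have hu2 : star u * u * star u = star u := by
      rw [← star_star (star u * u * star u)]
      congr 1
      rw [star_mul, star_mul, star_star, ← mul_assoc, hu1]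
    have e1 : v * star u = u * star u := by rwa [sub_mul, sub_eq_zero] at h1
    have e2 : star u * v = star u * u := by rwa [mul_sub, sub_eq_zero] at h2
    have e1' : u * star v = u * star u := by
      rw [← star_star (u * star v), star_mul, star_star, e1, star_mul, star_star]
    have e2' : star v * u = star u * u := by
      rw [← star_star (star v * u), star_mul, star_star, e2, star_mul, star_star]
    constructor
    · have : (w - u) * star u = (w - v) * star v * u * star u + (v * star u - u * star u) := by
        rw [mul_assoc ((w - v)), e2', mul_assoc (w - v), hu2]
        noncomm_ring
      rw [this, h3, e1, zero_mul, zero_mul, sub_self, add_zero]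
    · have : star u * (w - u) = star u * (u * (star v * (w - v))) + (star u * v - star u * u) := by
        rw [← mul_assoc u, e1', ← mul_assoc, ← mul_assoc, hu2]
        noncomm_ring
      rw [this, h4, e2, mul_zero, mul_zero, sub_self, add_zero]
  have hchain : ∀ c : Set S, IsChain r c → ∃ ub, ∀ a ∈ c, r a ub := by
    intro c hc
    rcases c.eq_empty_or_nonempty with rfl | hcne
    · exact ⟨⟨_, h0.choose_spec⟩, by simp⟩
    set A : Set ℝ := (fun v : S => τ.norm2 v.1 ^ 2) '' c with hA
    have hAb : BddAbove A := by
      refine ⟨1, ?_⟩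
      rintro _ ⟨v, _, rfl⟩
      have := norm2_le_one (τ := τ) (hS v.1 v.2)
      exact pow_le_one₀ (τ.norm2_nonneg _) this
    have hex : ∀ n : ℕ, ∃ v ∈ c, sSup A - 1 / ((n : ℝ) + 1) < τ.norm2 v.1 ^ 2 := by
      intro n
      obtain ⟨_, ⟨v, hv, rfl⟩, hlt⟩ := exists_lt_of_lt_csSup (hcne.image _)
        (sub_lt_self (sSup A) (one_div_pos.2 (by positivity : (0 : ℝ) < (n : ℝ) + 1)))
      exact ⟨v, hv, hlt⟩
    choose v hvc hv using hex
    have hle : ∀ w ∈ c, τ.norm2 w.1 ^ 2 ≤ sSup A := fun w hw => le_csSup hAb ⟨w, hw, rfl⟩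
    -- either `w` is extended by `v n`, or it is close to it
    have key : ∀ w ∈ c, ∀ n, r w (v n) ∨ τ.norm2 ((v n).1 - w.1) ^ 2 ≤ 1 / ((n : ℝ) + 1) := by
      intro w hw n
      rcases eq_or_ne w (v n) with rfl | hne
      · exact Or.inl (hrrefl _)
      rcases hc hw (hvc n) hne with h | h
      · exact Or.inl h
      · right
        rw [norm2_sub_comm, norm2_sub_sq h.2]
        linarith [hle w hw, hv n]
    have hcau : CauchySeq fun n => L2.ofM τ (v n).1 := by
      have hd : ∀ n m, n ≤ m → dist (L2.ofM τ (v n).1) (L2.ofM τ (v m).1) ≤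
          √(1 / ((n : ℝ) + 1)) := by
        intro n m hnm
        rw [dist_eq_norm, ← L2.ofM_sub, L2.norm_ofM]
        refine Real.le_sqrt_of_sq_le ?_
        have hm1 : 1 / ((m : ℝ) + 1) ≤ 1 / ((n : ℝ) + 1) := by gcongr
        rcases key (v m) (hvc m) n with h | h
        · rw [norm2_sub_sq h.2]
          linarith [hle _ (hvc n), hv m]
        · exact h
      refine cauchySeq_of_le_tendsto_0' (fun n : ℕ => √(1 / ((n : ℝ) + 1))) hd ?_
      have := (tendsto_one_div_add_atTop_nhds_zero_nat (𝕜 := ℝ)).sqrt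
      simpa using this
    obtain ⟨b, -, hb⟩ := τ.exists_tendsto_of_cauchySeq hf (fun n => (v n).1)
      (fun n => norm_partialIsometry_le (hS _ (v n).2)) hcau
    refine ⟨⟨b, hcl _ b (fun n => (v n).2) hb⟩, fun w hw => ?_⟩
    have hw1 := norm_partialIsometry_le (hS _ w.2)
    have hlim0 : Tendsto (fun n : ℕ => τ.norm2 ((v n).1 - b) + √(1 / ((n : ℝ) + 1))) atTop
        (𝓝 0) := by
      have := (tendsto_one_div_add_atTop_nhds_zero_nat (𝕜 := ℝ)).sqrt
      simpa using hb.add this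
    have hsq : ∀ n : ℕ, ¬ r w (v n) → τ.norm2 ((v n).1 - w.1) ≤ √(1 / ((n : ℝ) + 1)) :=
      fun n hn => Real.le_sqrt_of_sq_le ((key w hw n).resolve_left hn)
    constructor
    · refine hf.eq_zero (le_antisymm (ge_of_tendsto' hlim0 fun n => ?_) (τ.norm2_nonneg _))
      have h1 : (b - w.1) * star w.1 = ((v n).1 - w.1) * star w.1 - ((v n).1 - b) * star w.1 := by
        noncomm_ring
      have h2 : τ.norm2 (((v n).1 - w.1) * star w.1) ≤ √(1 / ((n : ℝ) + 1)) := by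
        by_cases h : r w (v n)
        · rw [h.1, norm2_zero]; positivity
        · refine (ht.norm2_mul_le _ _).trans ((mul_le_of_le_one_right (τ.norm2_nonneg _) ?_).trans
            (hsq n h))
          rwa [norm_star]
      have h3 : τ.norm2 (((v n).1 - b) * star w.1) ≤ τ.norm2 ((v n).1 - b) :=
        (ht.norm2_mul_le _ _).trans (mul_le_of_le_one_right (τ.norm2_nonneg _) (by rwa [norm_star]))
      change τ.norm2 ((b - w.1) * star w.1) ≤ _
      rw [h1]
      linarith [τ.norm2_sub_le (((v n).1 - w.1) * star w.1) (((v n).1 - b) * star w.1)]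
    · refine hf.eq_zero (le_antisymm (ge_of_tendsto' hlim0 fun n => ?_) (τ.norm2_nonneg _))
      have h1 : star w.1 * (b - w.1) = star w.1 * ((v n).1 - w.1) - star w.1 * ((v n).1 - b) := by
        noncomm_ring
      have h2 : τ.norm2 (star w.1 * ((v n).1 - w.1)) ≤ √(1 / ((n : ℝ) + 1)) := by
        by_cases h : r w (v n)
        · rw [h.2, norm2_zero]; positivity
        · refine (τ.norm2_mul_le _ _).trans ((mul_le_of_le_one_left (τ.norm2_nonneg _) ?_).trans
            (hsq n h))
          rwa [norm_star]
      have h3 : τ.norm2 (star w.1 * ((v n).1 - b)) ≤ τ.norm2 ((v n).1 - b) :=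
        (τ.norm2_mul_le _ _).trans (mul_le_of_le_one_left (τ.norm2_nonneg _) (by rwa [norm_star]))
      change τ.norm2 (star w.1 * (b - w.1)) ≤ _
      rw [h1]
      linarith [τ.norm2_sub_le (star w.1 * ((v n).1 - w.1)) (star w.1 * ((v n).1 - b))]
  obtain ⟨m, hm⟩ := exists_maximal_of_chains_bounded hchain hrtrans
  refine ⟨m.1, m.2, fun d hd h1 h2 => ?_⟩
  have h3 := (hm ⟨m.1 + d, hd⟩ ⟨by simpa using h1, by simpa using h2⟩).1
  simp only at h3
  rw [show m.1 - (m.1 + d) = -d by abel, star_add, neg_mul, mul_add, h1, zero_add, neg_eq_zero] at h3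
  exact (CStarRing.mul_star_self_eq_zero_iff d).1 h3

end NormalState

end States

section States

variable {K : Type*} [NormedAddCommGroup K] [InnerProductSpace ℂ K] [CompleteSpace K]
variable {M : VonNeumannAlgebra K} {τ : NormalState M}

/-! ### Comparison of projections in a II₁ factor -/

namespace NormalState

theorem apply_isStarProjection {p : M.toStarSubalgebra} (hp : IsStarProjection p) :
    τ p = ((τ.norm2 p ^ 2 : ℝ) : ℂ) := by
  rw [← apply_star_mul_self, hp.isSelfAdjoint.star_eq, hp.isIdempotentElem.eq]

theorem IsTracial.apply_mul_star_self (ht : τ.IsTracial) {v : M.toStarSubalgebra} :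
    τ (v * star v) = τ (star v * v) := ht _ _

theorem IsFaithful.eq_zero_of_isStarProjection (hf : τ.IsFaithful) {p : M.toStarSubalgebra}
    (hp : IsStarProjection p) (h : (τ p).re ≤ 0) : p = 0 := by
  rw [apply_isStarProjection hp, Complex.ofReal_re] at h
  exact hf.eq_zero (pow_eq_zero_iff two_ne_zero |>.1 (le_antisymm h (sq_nonneg _)))

theorem partialIsometry_add {v w : M.toStarSubalgebra} (hv : v * star v * v = v)
    (hw : w * star w * w = w) (hwv : w * star v = 0) (hvw : star v * w = 0) :
    (v + w) * star (v + w) * (v + w) = v + w := by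
  have hvw' : v * star w = 0 := by
    rw [← star_star (v * star w), star_mul, star_star, hwv, star_zero]
  have hwv' : star w * v = 0 := by
    rw [← star_star (star w * v), star_mul, star_star, hvw, star_zero]
  have h1 : (v + w) * star (v + w) = v * star v + w * star w := by
    rw [star_add, add_mul, mul_add, mul_add, hvw', hwv, add_zero, zero_add]
  rw [h1, add_mul, mul_add, mul_add, hv, hw, mul_assoc v, hvw, mul_assoc w, hwv', mul_zero,
    mul_zero, add_zero, zero_add]

end NormalState

namespace IsIIOneFactor

open NormalState VonNeumannAlgebra

variable (hM : IsIIOneFactor τ)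
include hM

/-- A factor is a prime ring. If `a x b = 0` for all `x`, then `a` annihilates the average
`τ (b b*)` of `b b*` over the unitaries. -/
theorem exists_mul_mul_ne_zero {a b : M.toStarSubalgebra} (ha : a ≠ 0) (hb : b ≠ 0) :
    ∃ x, a * x * b ≠ 0 := by
  by_contra! h
  have hnb : τ.norm2 (star b) ≠ 0 := fun h0 => hb (star_eq_zero.1 (hM.faithful.eq_zero h0))
  have hna : τ.norm2 a ≠ 0 := fun h0 => ha (hM.faithful.eq_zero h0)
  set c := τ.norm2 (star b) ^ 2 * τ.norm2 a with hc
  have hcpos : 0 < c := by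
    have := lt_of_le_of_ne (τ.norm2_nonneg a) hna.symm
    have := lt_of_le_of_ne (τ.norm2_nonneg (star b)) hnb.symm
    positivity
  have hanorm : 0 < ‖a‖ := norm_pos_iff.2 ha
  obtain ⟨y, hy, hyε⟩ := hM.exists_convexHull_near (b * star b) (c / (2 * ‖a‖)) (by positivity)
  have hay : a * y = 0 := by
    have h1 : convexHull ℝ {z | ∃ u ∈ unitary M.toStarSubalgebra, z = u * (b * star b) * star u} ⊆
        ((LinearMap.mulLeft ℂ a).restrictScalars ℝ) ⁻¹' {0} := by
      refine convexHull_min ?_ ((convex_singleton _).linear_preimage _)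
      rintro _ ⟨u, hu, rfl⟩
      simp only [Set.mem_preimage, LinearMap.coe_restrictScalars, Set.mem_singleton_iff,
        LinearMap.mulLeft_apply]
      rw [← mul_assoc, ← mul_assoc, ← mul_assoc, h, zero_mul, zero_mul]
    exact h1 hy
  have hτ : τ (b * star b) = ((τ.norm2 (star b) ^ 2 : ℝ) : ℂ) := by
    rw [← apply_star_mul_self, star_star]
  have h2 : τ.norm2 (a * (y - τ (b * star b) • (1 : M.toStarSubalgebra))) = c := by
    rw [mul_sub, hay, zero_sub, mul_smul_comm, mul_one, ← neg_smul, norm2_smul, norm_neg, hτ,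
      Complex.norm_real, Real.norm_of_nonneg (sq_nonneg _)]
  have h3 := τ.norm2_mul_le a (y - τ (b * star b) • (1 : M.toStarSubalgebra))
  rw [h2] at h3
  have h4 : ‖a‖ * τ.norm2 (y - τ (b * star b) • (1 : M.toStarSubalgebra)) <
      ‖a‖ * (c / (2 * ‖a‖)) := by gcongr
  have h5 : ‖a‖ * (c / (2 * ‖a‖)) = c / 2 := by field_simp
  linarith

/-- In a factor there is a nonzero partial isometry between corners of two nonzero projections. -/
theorem exists_partialIsometry_corner {p q : M.toStarSubalgebra} (hp : IsStarProjection p)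
    (hq : IsStarProjection q) (hp0 : p ≠ 0) (hq0 : q ≠ 0) :
    ∃ w : M.toStarSubalgebra, w ≠ 0 ∧ w * star w * w = w ∧ q * w = w ∧ w * p = w := by
  obtain ⟨x, hx⟩ := hM.exists_mul_mul_ne_zero hq0 hp0
  obtain ⟨w, hw0, hw, hl, hr⟩ := exists_partialIsometry_of_ne_zero hx
  refine ⟨w, hw0, hw, ?_, ?_⟩
  · have := hl (1 - q) (by rw [mul_assoc, ← mul_assoc, hq.one_sub_mul_self, zero_mul])
    rw [sub_mul, one_mul, sub_eq_zero] at this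
    exact this.symm
  · have := hr (1 - p) (by rw [mul_assoc, hp.mul_one_sub_self, mul_zero])
    rw [mul_sub, mul_one, sub_eq_zero] at this
    exact this.symm

/-- Comparison of projections: if `τ p ≤ τ q`, then `p` is equivalent to a subprojection of `q`. -/
theorem exists_partialIsometry_of_le {p q : M.toStarSubalgebra} (hp : IsStarProjection p)
    (hq : IsStarProjection q) (hle : (τ p).re ≤ (τ q).re) :
    ∃ v : M.toStarSubalgebra, star v * v = p ∧ q * v = v := by
  set S : Set M.toStarSubalgebra := {v | v * star v * v = v ∧ q * v = v ∧ v * p = v} with hS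
  obtain ⟨v, ⟨hv, hqv, hvp⟩, hmax⟩ := exists_maximal_partialIsometry hM.tracial hM.faithful S
    ⟨0, by simp [hS]⟩ (fun v hv => hv.1) (by
      intro x b hx hb
      have hn := fun n => norm_partialIsometry_le (hx n).1
      refine ⟨hM.tracial.partialIsometry_of_tendsto hM.faithful (fun n => (hx n).1) hb, ?_, ?_⟩
      · refine hM.faithful.eq_of_tendsto (x := x) ?_ hb
        refine (hM.tracial.tendsto_mul (x := fun _ => q) (b := q) (fun n => hq.norm_le)
          (by simp) hb).congr fun n => ?_
        rw [(hx n).2.1]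
      · refine hM.faithful.eq_of_tendsto (x := x) ?_ hb
        refine (hM.tracial.tendsto_mul (y := fun _ => p) (c := p) hn hb (by simp)).congr fun n => ?_
        rw [(hx n).2.2])
  have hvs : star v * v * star v = star v := by
    rw [← star_star (star v * v * star v)]
    congr 1
    rw [star_mul, star_mul, star_star, ← mul_assoc, hv]
  have hpv : p * star v = star v := by
    rw [← star_star (p * star v), star_mul, star_star, hp.isSelfAdjoint.star_eq, hvp]
  have hvq : star v * q = star v := by
    rw [← star_star (star v * q), star_mul, star_star, hq.isSelfAdjoint.star_eq, hqv]
  have hp₀ : IsStarProjection (p - star v * v) :=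
    (isStarProjection_star_mul_self hv).sub_of_mul_eq_left hp (by rw [mul_assoc, hvp])
  have hq₀ : IsStarProjection (q - v * star v) :=
    (isStarProjection_mul_star_self hv).sub_of_mul_eq_left hq (by rw [mul_assoc, hvq])
  by_cases h1 : p - star v * v = 0
  · exact ⟨v, (sub_eq_zero.1 h1).symm, hqv⟩
  exfalso
  have h2 : q - v * star v ≠ 0 := by
    intro h2
    refine h1 (hM.faithful.eq_zero_of_isStarProjection hp₀ ?_)
    rw [map_sub, ← hM.tracial.apply_mul_star_self, ← sub_eq_zero.1 h2, Complex.sub_re]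
    linarith
  obtain ⟨w, hw0, hw, hqw, hwp⟩ := hM.exists_partialIsometry_corner hp₀ hq₀ h1 h2
  have hwv : w * star v = 0 := by
    rw [← hwp, mul_assoc, sub_mul, hpv, hvs, sub_self, mul_zero]
  have hvw : star v * w = 0 := by
    rw [← hqw, ← mul_assoc, mul_sub, hvq, ← mul_assoc, hvs, sub_self, zero_mul]
  refine hw0 (hmax w ⟨partialIsometry_add hv hw hwv hvw, ?_, ?_⟩ hwv hvw)
  · have h3 : q * w = w := by
      conv_lhs => rw [← hqw]
      rw [← mul_assoc, mul_sub, hq.isIdempotentElem.eq, ← mul_assoc, hqv, hqw]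
    rw [mul_add, hqv, h3]
  · have h3 : w * p = w := by
      conv_lhs => rw [← hwp]
      rw [mul_assoc, sub_mul, hp.isIdempotentElem.eq, mul_assoc, hvp, hwp]
    rw [add_mul, hvp, h3]

/-- Projections of equal trace are unitarily equivalent: the unitary is the sum of an equivalence of
the projections and one of their complements. -/
theorem exists_unitary_conj {p q : M.toStarSubalgebra} (hp : IsStarProjection p)
    (hq : IsStarProjection q) (h : τ p = τ q) :
    ∃ u ∈ unitary M.toStarSubalgebra, u * p * star u = q := by
  have key : ∀ {p q : M.toStarSubalgebra}, IsStarProjection p → IsStarProjection q → τ p = τ q →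
      ∃ v : M.toStarSubalgebra, star v * v = p ∧ v * star v = q ∧ v * p = v ∧ q * v = v := by
    intro p q hp hq h
    obtain ⟨v, hvp, hqv⟩ := hM.exists_partialIsometry_of_le hp hq (by rw [h])
    have hv : v * p = v := by
      have h1 : star (v * (1 - p)) * (v * (1 - p)) = 0 := by
        rw [star_mul, mul_assoc, ← mul_assoc (star v), hvp, hp.mul_one_sub_self, mul_zero]
      have h2 := (CStarRing.star_mul_self_eq_zero_iff _).1 h1
      rw [mul_sub, mul_one, sub_eq_zero] at h2
      exact h2.symm
    have hv' : v * star v * v = v := by rw [mul_assoc, hvp, hv]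
    have hvq : star v * q = star v := by
      rw [← star_star (star v * q), star_mul, star_star, hq.isSelfAdjoint.star_eq, hqv]
    have hq₀ : IsStarProjection (q - v * star v) :=
      (isStarProjection_mul_star_self hv').sub_of_mul_eq_left hq (by rw [mul_assoc, hvq])
    refine ⟨v, hvp, ?_, hv, hqv⟩
    refine (sub_eq_zero.1 (hM.faithful.eq_zero_of_isStarProjection hq₀ ?_)).symm
    rw [map_sub, hM.tracial.apply_mul_star_self, hvp, h, sub_self, Complex.zero_re]
  obtain ⟨v, h1, h2, h3, h4⟩ := key hp hq h
  obtain ⟨w, k1, k2, k3, k4⟩ := key hp.one_sub hq.one_sub (by rw [map_sub, map_sub, h])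
  have e1 : star v * w = 0 := by
    have : star v = star v * q := by
      rw [← star_star (star v * q), star_mul, star_star, hq.isSelfAdjoint.star_eq, h4]
    rw [this, ← k4, mul_assoc, ← mul_assoc q, hq.mul_one_sub_self, zero_mul, mul_zero]
  have e2 : v * star w = 0 := by
    have : star w = (1 - p) * star w := by
      conv_lhs => rw [← k3, star_mul, hp.one_sub.isSelfAdjoint.star_eq]
    rw [this, ← h3, mul_assoc, ← mul_assoc p, hp.mul_one_sub_self, zero_mul, mul_zero]
  have e1' : star w * v = 0 := by
    rw [← star_star (star w * v), star_mul, star_star, e1, star_zero]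
  have e2' : w * star v = 0 := by
    rw [← star_star (w * star v), star_mul, star_star, e2, star_zero]
  have e3 : w * p = 0 := by rw [← k3, mul_assoc, hp.one_sub_mul_self, mul_zero]
  refine ⟨v + w, Unitary.mem_iff.2 ⟨?_, ?_⟩, ?_⟩
  · rw [star_add, add_mul, mul_add, mul_add, h1, e1, e1', k1]
    noncomm_ring
  · rw [star_add, add_mul, mul_add, mul_add, h2, e2, e2', k2]
    noncomm_ring
  · rw [add_mul, e3, add_zero, h3, star_add, mul_add, e2, add_zero, h2]

/-- Projections whose traces almost agree are almost unitarily equivalent: the one of smaller trace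
is equivalent to a subprojection of the other. -/
theorem exists_unitary_conj_near {p q : M.toStarSubalgebra} (hp : IsStarProjection p)
    (hq : IsStarProjection q) :
    ∃ u ∈ unitary M.toStarSubalgebra, τ.norm2 (u * p * star u - q) ^ 2 ≤ ‖τ p - τ q‖ := by
  have key : ∀ {p q : M.toStarSubalgebra}, IsStarProjection p → IsStarProjection q →
      (τ p).re ≤ (τ q).re → ∃ u ∈ unitary M.toStarSubalgebra,
        τ.norm2 (u * p * star u - q) ^ 2 ≤ ‖τ p - τ q‖ := by
    intro p q hp hq hle
    obtain ⟨v, hvp, hqv⟩ := hM.exists_partialIsometry_of_le hp hq hle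
    have hv : v * star v * v = v := by
      have h1 : star (v * (1 - p)) * (v * (1 - p)) = 0 := by
        rw [star_mul, mul_assoc, ← mul_assoc (star v), hvp, hp.mul_one_sub_self, mul_zero]
      have h2 := (CStarRing.star_mul_self_eq_zero_iff _).1 h1
      rw [mul_sub, mul_one, sub_eq_zero] at h2
      rw [mul_assoc, hvp, ← h2]
    have hvq : star v * q = star v := by
      rw [← star_star (star v * q), star_mul, star_star, hq.isSelfAdjoint.star_eq, hqv]
    have hr := isStarProjection_mul_star_self hv
    have hq₀ : IsStarProjection (q - v * star v) :=
      hr.sub_of_mul_eq_left hq (by rw [mul_assoc, hvq])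
    have hτ : τ p = τ (v * star v) := by rw [hM.tracial.apply_mul_star_self, hvp]
    obtain ⟨u, hu, huq⟩ := hM.exists_unitary_conj hp hr hτ
    refine ⟨u, hu, ?_⟩
    rw [huq, τ.norm2_sub_comm, norm2_sq, hq₀.isSelfAdjoint.star_eq, hq₀.isIdempotentElem.eq,
      map_sub, ← hτ, norm_sub_rev]
    exact Complex.re_le_norm _
  rcases le_total (τ p).re (τ q).re with h | h
  · exact key hp hq h
  · obtain ⟨u, hu, hle⟩ := key hq hp h
    refine ⟨star u, Unitary.star_mem hu, ?_⟩
    have h1 : star u * p * star (star u) - q = star u * (p - u * q * star u) * u := by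
      have e := Unitary.star_mul_self_of_mem hu
      calc star u * p * star (star u) - q
          = star u * p * u - (star u * u) * q * (star u * u) := by rw [e, star_star]; simp
        _ = star u * (p - u * q * star u) * u := by noncomm_ring
    rwa [h1, hM.tracial.norm2_mul_unitary hu, norm2_unitary_mul (Unitary.star_mem hu),
      τ.norm2_sub_comm, norm_sub_rev]

end IsIIOneFactor

end States

section States

variable {K : Type*} [NormedAddCommGroup K] [InnerProductSpace ℂ K] [CompleteSpace K]
variable {M : VonNeumannAlgebra K} {τ : NormalState M}

/-! ### Diffuseness, and unital copies of the 2 by 2 matrices -/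

namespace IsIIOneFactor

open NormalState VonNeumannAlgebra

variable (hM : IsIIOneFactor τ)
include hM

/-- The left ideal `M p` of a minimal projection `p` has dimension at most `1 / τ p`: for `x, y` in
`M p` the product `x* y` is a multiple of `p`, so that an orthonormal family in `M p` consists of
multiples of partial isometries with orthogonal ranges. -/
theorem finiteDimensional_of_minimal {p : M.toStarSubalgebra} (hp : IsStarProjection p)
    (hp0 : p ≠ 0) (hmin : ∀ x, ∃ c : ℂ, p * x * p = c • p) :
    FiniteDimensional ℂ M.toStarSubalgebra := by
  have hτ := apply_isStarProjection (τ := τ) hp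
  have hn0 : 0 < τ.norm2 p :=
    lt_of_le_of_ne (τ.norm2_nonneg p) fun h => hp0 (hM.faithful.eq_zero h.symm)
  set t : ℝ := τ.norm2 p ^ 2 with ht
  have htpos : 0 < t := by positivity
  let V : Submodule ℂ M.toStarSubalgebra := LinearMap.eqLocus (LinearMap.mulRight ℂ p) LinearMap.id
  have hV : ∀ x, x ∈ V ↔ x * p = x := fun x => Iff.rfl
  have hVfin : FiniteDimensional ℂ V := by
    by_contra hinf
    have hrank : Cardinal.aleph0 ≤ Module.rank ℂ V := by
      rw [← not_lt]
      exact fun h => hinf (Module.rank_lt_aleph0_iff.1 h)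
    obtain ⟨n, hn⟩ := exists_nat_gt (1 / t)
    obtain ⟨f, hf⟩ := exists_linearIndependent_of_le_rank
      ((Cardinal.natCast_lt_aleph0 (n := n)).le.trans hrank)
    have hker : ((L2.ofMₗ τ).comp V.subtype).ker = ⊥ := by
      rw [LinearMap.ker_eq_bot']
      intro x hx
      refine Subtype.ext (hM.faithful.eq_zero ?_)
      rw [← L2.norm_ofM]
      exact norm_eq_zero.2 hx
    have hf2 := hf.map' _ hker
    have hon := InnerProductSpace.gramSchmidtNormed_orthonormal (𝕜 := ℂ) hf2
    have hmem : ∀ i, ∃ x ∈ V, L2.ofM τ x =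
        InnerProductSpace.gramSchmidtNormed ℂ (((L2.ofMₗ τ).comp V.subtype) ∘ f) i := by
      intro i
      have h1 : InnerProductSpace.gramSchmidtNormed ℂ (((L2.ofMₗ τ).comp V.subtype) ∘ f) i ∈
          Submodule.span ℂ (Set.range (((L2.ofMₗ τ).comp V.subtype) ∘ f)) := by
        rw [← InnerProductSpace.span_gramSchmidt (𝕜 := ℂ),
          ← InnerProductSpace.span_gramSchmidtNormed_range]
        exact Submodule.subset_span ⟨i, rfl⟩
      have h2 : Submodule.span ℂ (Set.range (((L2.ofMₗ τ).comp V.subtype) ∘ f)) ≤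
          V.map (L2.ofMₗ τ) := by
        rw [Submodule.span_le]
        rintro _ ⟨j, rfl⟩
        exact ⟨(f j : M.toStarSubalgebra), (f j).2, rfl⟩
      obtain ⟨x, hx, hx2⟩ := h2 h1
      exact ⟨x, hx, hx2⟩
    choose x hxV hx using hmem
    have hxx : ∀ i j, star (x i) * x j = (if i = j then ((t⁻¹ : ℝ) : ℂ) else 0) • p := by
      intro i j
      have hxi := (hV _).1 (hxV i)
      have hxj := (hV _).1 (hxV j)
      obtain ⟨c, hc⟩ := hmin (star (x i) * x j)
      have h1 : star (x i) * x j = c • p := by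
        rw [← hc, mul_assoc, mul_assoc, hxj, ← mul_assoc]
        congr 1
        conv_lhs => rw [← hxi, star_mul, hp.isSelfAdjoint.star_eq]
      have h2 := orthonormal_iff_ite.1 hon i j
      rw [← hx, ← hx, L2.inner_ofM, h1, map_smul, hτ, smul_eq_mul] at h2
      rw [h1]
      congr 1
      have h3 : (t : ℂ) ≠ 0 := by exact_mod_cast htpos.ne'
      split_ifs at h2 ⊢ with h
      · rw [Complex.ofReal_inv]
        exact eq_inv_of_mul_eq_one_left h2
      · exact (mul_eq_zero.1 h2).resolve_right h3
    set s : M.toStarSubalgebra := (t : ℂ) • ∑ i, x i * star (x i) with hs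
    have htc : (t : ℂ) ≠ 0 := by exact_mod_cast htpos.ne'
    have hss : s * s = s := by
      have h1 : ∀ i, (x i * star (x i)) * ∑ j, x j * star (x j) =
          ((t⁻¹ : ℝ) : ℂ) • (x i * star (x i)) := by
        intro i
        rw [Finset.mul_sum, Finset.sum_eq_single i]
        · rw [mul_assoc, ← mul_assoc (star (x i)), hxx, if_pos rfl, smul_mul_assoc, mul_smul_comm,
            ← mul_assoc, (hV _).1 (hxV i)]
        · intro j _ hj
          rw [mul_assoc, ← mul_assoc (star (x i)), hxx, if_neg hj.symm]
          simp
        · simp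
      rw [hs, smul_mul_smul_comm, Finset.sum_mul]
      simp_rw [h1]
      rw [← Finset.smul_sum, smul_smul, Complex.ofReal_inv, mul_assoc, mul_inv_cancel₀ htc, mul_one]
    have hsp : IsStarProjection s := by
      refine ⟨hss, ?_⟩
      change star s = s
      simp [hs]
    have hτs : τ s = n * t := by
      rw [hs, map_smul, map_sum]
      have h1 : ∀ i, τ (x i * star (x i)) = 1 := fun i => by
        have h3 : (t : ℂ) ≠ 0 := by exact_mod_cast htpos.ne'
        rw [hM.tracial.apply_mul_star_self, hxx, if_pos rfl, map_smul, hτ, smul_eq_mul,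
          Complex.ofReal_inv, inv_mul_cancel₀ h3]
      simp_rw [h1]
      simp [mul_comm]
    have h4 : τ.norm2 s ^ 2 = n * t := by
      have := apply_isStarProjection (τ := τ) hsp
      rw [hτs] at this
      exact_mod_cast this.symm
    have h5 : τ.norm2 s ^ 2 ≤ 1 :=
      pow_le_one₀ (τ.norm2_nonneg _) ((τ.norm2_le_norm s).trans hsp.norm_le)
    rw [div_lt_iff₀ htpos] at hn
    linarith
  -- left multiplication embeds `M` into the endomorphisms of `M p`
  let Φ : M.toStarSubalgebra →ₗ[ℂ] (V →ₗ[ℂ] M.toStarSubalgebra) :=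
    (LinearMap.lcomp ℂ M.toStarSubalgebra V.subtype) ∘ₗ (LinearMap.mul ℂ M.toStarSubalgebra)
  let Ψ : M.toStarSubalgebra →ₗ[ℂ] (V →ₗ[ℂ] V) :=
    { toFun := fun a => (Φ a).codRestrict V fun v => by
        rw [hV]
        change a * v.1 * p = a * v.1
        rw [mul_assoc, (hV _).1 v.2]
      map_add' := fun a b => by
        ext v
        simp [Φ]
      map_smul' := fun c a => by
        ext v
        simp [Φ] }
  have hEnd : FiniteDimensional ℂ (V →ₗ[ℂ] V) := Module.Finite.linearMap ℂ ℂ V V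
  refine FiniteDimensional.of_injective Ψ ?_
  rw [← LinearMap.ker_eq_bot, LinearMap.ker_eq_bot']
  intro a ha
  by_contra ha0
  obtain ⟨x, hx⟩ := hM.exists_mul_mul_ne_zero ha0 hp0
  refine hx ?_
  have h1 : x * p ∈ V := by rw [hV, mul_assoc, hp.isIdempotentElem.eq]
  have h2 := congrArg (fun T : V →ₗ[ℂ] V => ((T ⟨x * p, h1⟩ : V) : M.toStarSubalgebra)) ha
  rw [mul_assoc]
  exact h2

/-- A nonzero positive function of `h`, as a continuous functional calculus, has nonzero trace. -/
theorem cfc_eq_zero_of_apply_eq_zero {h : M.toStarSubalgebra} {f : ℝ → ℝ} (hf : Continuous f)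
    (hf0 : ∀ s, 0 ≤ f s) (h0 : τ (cfc f h) = 0) : cfc f h = 0 := by
  have hr : IsSelfAdjoint (cfc (fun s => √(f s)) h) := cfc_predicate _ h
  have h1 : cfc f h = star (cfc (fun s => √(f s)) h) * cfc (fun s => √(f s)) h := by
    rw [hr.star_eq, ← cfc_mul _ _ h (by fun_prop) (by fun_prop)]
    exact cfc_congr fun s _ => (Real.mul_self_sqrt (hf0 s)).symm
  rw [h1] at h0 ⊢
  rw [hM.faithful _ h0, mul_zero]

/-- A II₁ factor has no minimal projections. -/
theorem exists_subprojection {p : M.toStarSubalgebra} (hp : IsStarProjection p) (hp0 : p ≠ 0) :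
    ∃ r : M.toStarSubalgebra, IsStarProjection r ∧ r * p = r ∧ p * r = r ∧ r ≠ 0 ∧ r ≠ p := by
  have hps := hp.isSelfAdjoint.star_eq
  have hpp := hp.isIdempotentElem.eq
  have hτ := apply_isStarProjection (τ := τ) hp
  have hn0 : 0 < τ.norm2 p :=
    lt_of_le_of_ne (τ.norm2_nonneg p) fun h => hp0 (hM.faithful.eq_zero h.symm)
  set t : ℝ := τ.norm2 p ^ 2 with ht
  have htc : (t : ℂ) ≠ 0 := by exact_mod_cast (pow_pos hn0 2).ne'
  -- a nonzero self-adjoint element of trace zero in the corner of `p`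
  obtain ⟨h, hsa, hph, h0, hτh⟩ : ∃ h : M.toStarSubalgebra, IsSelfAdjoint h ∧ p * h = h ∧ h ≠ 0 ∧
      τ h = 0 := by
    by_contra! hcon
    have hself : ∀ x : M.toStarSubalgebra, IsSelfAdjoint x → ∃ c : ℂ, p * x * p = c • p := by
      intro x hx
      refine ⟨τ (p * x * p) / t, ?_⟩
      by_contra hne
      have hsa1 : star (p * x * p) = p * x * p := by
        rw [star_mul, star_mul, hps, hx.star_eq, mul_assoc]
      have hreal : starRingEnd ℂ (τ (p * x * p)) = τ (p * x * p) := by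
        rw [← τ.map_star, hsa1]
      refine hcon (p * x * p - (τ (p * x * p) / t) • p) ?_ ?_ (sub_ne_zero.2 hne) ?_
      · change star _ = _
        rw [star_sub, hsa1, star_smul, hps, Complex.star_def, map_div₀, hreal, Complex.conj_ofReal]
      · rw [mul_sub, ← mul_assoc, ← mul_assoc, hpp, mul_smul_comm, hpp]
      · rw [map_sub, map_smul, hτ, smul_eq_mul, div_mul_cancel₀ _ htc, sub_self]
    refine hM.infinite (hM.finiteDimensional_of_minimal hp hp0 fun x => ?_)
    obtain ⟨c, hc⟩ := hself _ (realPart x).2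
    obtain ⟨d, hd⟩ := hself _ (imaginaryPart x).2
    refine ⟨c + Complex.I * d, ?_⟩
    conv_lhs => rw [← realPart_add_I_smul_imaginaryPart x]
    rw [mul_add, add_mul, hc, mul_smul_comm, smul_mul_assoc, hd, smul_smul, ← add_smul]
  have hkc : Continuous fun s : ℝ => max s 0 := by fun_prop
  have hlc : Continuous fun s : ℝ => max (-s) 0 := by fun_prop
  set k := cfc (fun s : ℝ => max s 0) h with hk
  set l := cfc (fun s : ℝ => max (-s) 0) h with hl
  have hksa : IsSelfAdjoint k := cfc_predicate _ h
  have hlsa : IsSelfAdjoint l := cfc_predicate _ h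
  have hkl : k - l = h := by
    rw [hk, hl, ← cfc_sub _ _ h hkc.continuousOn hlc.continuousOn]
    refine (cfc_congr fun s _ => ?_).trans (cfc_id' ℝ h)
    rcases le_total s 0 with h1 | h1
    · simp [h1]
    · simp [h1]
  have hlk : l * k = 0 := by
    rw [hk, hl, ← cfc_mul _ _ h hlc.continuousOn hkc.continuousOn]
    refine (cfc_congr fun s _ => ?_).trans (cfc_const_zero ℝ h)
    rcases le_total s 0 with h1 | h1
    · simp [h1]
    · simp [h1]
  have hkl0 : k * l = 0 := by
    rw [← star_star (k * l), star_mul, hksa.star_eq, hlsa.star_eq, hlk, star_zero]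
  have hτkl : τ k = τ l := by
    rw [← sub_eq_zero, ← map_sub, hkl, hτh]
  have hkz : k = 0 ↔ l = 0 := by
    constructor
    · intro h1
      exact hM.cfc_eq_zero_of_apply_eq_zero hlc (fun s => le_max_right _ _)
        (by rw [← hl, ← hτkl, h1, map_zero])
    · intro h1
      exact hM.cfc_eq_zero_of_apply_eq_zero hkc (fun s => le_max_right _ _)
        (by rw [← hk, hτkl, h1, map_zero])
  have hk0 : k ≠ 0 := fun h1 => h0 (by rw [← hkl, h1, hkz.1 h1, sub_zero])
  have hl0 : l ≠ 0 := fun h1 => hk0 (hkz.2 h1)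
  have hcorner : ∀ x : M.toStarSubalgebra, IsSelfAdjoint x → (∃ y, x * x = h * y) →
      (1 - p) * x = 0 := by
    rintro x hx ⟨y, hy⟩
    have h1 : (1 - p) * x * star ((1 - p) * x) = 0 := by
      rw [star_mul, hx.star_eq, mul_assoc, ← mul_assoc x, hy, ← mul_assoc, ← mul_assoc, sub_mul,
        one_mul, hph, sub_self, zero_mul, zero_mul]
    exact (CStarRing.mul_star_self_eq_zero_iff _).1 h1
  have hpk : (1 - p) * k = 0 := hcorner k hksa ⟨k, by rw [← hkl, sub_mul, hlk, sub_zero]⟩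
  have hpl : (1 - p) * l = 0 := hcorner l hlsa ⟨-l, by
    rw [← hkl, sub_mul, mul_neg, mul_neg, hkl0]; simp⟩
  have hr := isStarProjection_rangeProj k
  have hpr : p * rangeProj k = rangeProj k := by
    have := mul_rangeProj_eq_zero hpk
    rw [sub_mul, one_mul, sub_eq_zero] at this
    exact this.symm
  refine ⟨rangeProj k, hr, ?_, hpr, rangeProj_ne_zero hk0, ?_⟩
  · rw [← star_star (rangeProj k * p), star_mul, hps, hr.isSelfAdjoint.star_eq, hpr,
      hr.isSelfAdjoint.star_eq]
  · intro heq
    have h1 : l * p = 0 := by rw [← heq]; exact mul_rangeProj_eq_zero hlk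
    have h2 : p * l = 0 := by
      rw [← star_star (p * l), star_mul, hps, hlsa.star_eq, h1, star_zero]
    rw [sub_mul, one_mul, h2, sub_zero] at hpl
    exact hl0 hpl

/-- A II₁ factor contains a unital copy of the 2 by 2 matrices: the complement of `v* v + v v*`, for
a maximal partial isometry `v` with `v² = 0`, has no room for two orthogonal projections. -/
theorem exists_matrixUnit : ∃ y : M.toStarSubalgebra, y * y = 0 ∧ star y * y + y * star y = 1 := by
  set S : Set M.toStarSubalgebra := {v | v * star v * v = v ∧ v * v = 0} with hS
  obtain ⟨v, ⟨hv, hvv⟩, hmax⟩ := exists_maximal_partialIsometry hM.tracial hM.faithful S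
    ⟨0, by simp [hS]⟩ (fun v hv => hv.1) (by
      intro x b hx hb
      have hn := fun n => norm_partialIsometry_le (hx n).1
      refine ⟨hM.tracial.partialIsometry_of_tendsto hM.faithful (fun n => (hx n).1) hb, ?_⟩
      refine hM.faithful.eq_of_tendsto (x := fun n => x n * x n) (hM.tracial.tendsto_mul hn hb hb) ?_
      have h1 : ∀ n, x n * x n = 0 := fun n => (hx n).2
      simp [h1])
  have hvs : star v * v * star v = star v := by
    rw [← star_star (star v * v * star v)]
    congr 1
    rw [star_mul, star_mul, star_star, ← mul_assoc, hv]
  have hvv' : star v * star v = 0 := by rw [← star_mul, hvv, star_zero]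
  have hp1 : IsStarProjection (star v * v + v * star v) :=
    (isStarProjection_star_mul_self hv).add (isStarProjection_mul_star_self hv) (by
      rw [mul_assoc, ← mul_assoc v, hvv, zero_mul, mul_zero])
  refine ⟨v, hvv, ?_⟩
  by_contra hne
  set p := 1 - (star v * v + v * star v) with hp
  have hpp : IsStarProjection p := hp1.one_sub
  have hp0 : p ≠ 0 := fun h => hne (sub_eq_zero.1 h).symm
  have hpv : p * v = 0 := by
    rw [hp, sub_mul, add_mul, one_mul, hv, mul_assoc, hvv, mul_zero, zero_add, sub_self]
  have hpvs : p * star v = 0 := by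
    rw [hp, sub_mul, add_mul, one_mul, hvs, mul_assoc v, hvv', mul_zero, add_zero, sub_self]
  have hvp : v * p = 0 := by
    rw [← star_star (v * p), star_mul, hpp.isSelfAdjoint.star_eq, hpvs, star_zero]
  have hvsp : star v * p = 0 := by
    rw [← star_star (star v * p), star_mul, star_star, hpp.isSelfAdjoint.star_eq, hpv, star_zero]
  obtain ⟨r, hr, hrp, hpr, hr0, hrne⟩ := hM.exists_subprojection hpp hp0
  have hr' : IsStarProjection (p - r) := hr.sub_of_mul_eq_left hpp hrp
  obtain ⟨w, hw0, hw, hw1, hw2⟩ := hM.exists_partialIsometry_corner hr hr'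
    hr0 (sub_ne_zero.2 hrne.symm)
  have hwp : w * p = w := by rw [← hw2, mul_assoc, hrp]
  have hpw : p * w = w := by
    conv_lhs => rw [← hw1]
    rw [← mul_assoc, mul_sub, hpp.isIdempotentElem.eq, hpr, hw1]
  have hww : w * w = 0 := by
    calc w * w = (w * r) * ((p - r) * w) := by rw [hw1, hw2]
      _ = w * ((r * p - r * r) * w) := by noncomm_ring
      _ = 0 := by rw [hrp, hr.isIdempotentElem.eq, sub_self, zero_mul, mul_zero]
  have hwv : w * star v = 0 := by rw [← hwp, mul_assoc, hpvs, mul_zero]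
  have hvw : star v * w = 0 := by rw [← hpw, ← mul_assoc, hvsp, zero_mul]
  have hwv2 : w * v = 0 := by rw [← hwp, mul_assoc, hpv, mul_zero]
  have hvw2 : v * w = 0 := by rw [← hpw, ← mul_assoc, hvp, zero_mul]
  refine hw0 (hmax w ⟨partialIsometry_add hv hw hwv hvw, ?_⟩ hwv hvw)
  rw [add_mul, mul_add, mul_add, hvv, hww, hvw2, hwv2]
  simp

end IsIIOneFactor

end States

/-! ### Bounded operators defined on a total family of vectors -/

section Total

variable {H H' X : Type*} [NormedAddCommGroup H] [InnerProductSpace ℂ H]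
  [NormedAddCommGroup H'] [InnerProductSpace ℂ H'] {f : X → H}

theorem eq_of_inner_total (hf : Dense (Submodule.span ℂ (Set.range f) : Set H)) {a b : H}
    (h : ∀ x, ⟪f x, a⟫_ℂ = ⟪f x, b⟫_ℂ) : a = b := by
  have h1 : innerSL ℂ a = innerSL ℂ b := by
    refine ContinuousLinearMap.ext_on hf ?_
    rintro _ ⟨x, rfl⟩
    rw [innerSL_apply_apply, innerSL_apply_apply, ← inner_conj_symm, h, inner_conj_symm]
  refine ext_inner_right ℂ fun v => ?_
  exact congrArg (fun T : H →L[ℂ] ℂ => T v) h1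

theorem clm_ext_total (hf : Dense (Submodule.span ℂ (Set.range f) : Set H)) {S T : H →L[ℂ] H'}
    (h : ∀ x, S (f x) = T (f x)) : S = T := by
  refine ContinuousLinearMap.ext_on hf ?_
  rintro _ ⟨x, rfl⟩
  exact h x

theorem eq_adjoint_of_total [CompleteSpace H] [CompleteSpace H'] {Y : Type*} {g : Y → H'}
    (hf : Dense (Submodule.span ℂ (Set.range f) : Set H))
    (hg : Dense (Submodule.span ℂ (Set.range g) : Set H')) {S : H →L[ℂ] H'} {T : H' →L[ℂ] H}
    (h : ∀ x y, ⟪f x, T (g y)⟫_ℂ = ⟪S (f x), g y⟫_ℂ) : T = ContinuousLinearMap.adjoint S := by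
  refine clm_ext_total hg fun y => eq_of_inner_total hf fun x => ?_
  rw [h, ContinuousLinearMap.adjoint_inner_right]

theorem exists_clm_of_total [CompleteSpace H']
    (hf : Dense (Submodule.span ℂ (Set.range f) : Set H)) (g : X → H') (C : ℝ)
    (h : ∀ c : X →₀ ℂ, ‖Finsupp.linearCombination ℂ g c‖ ≤ C * ‖Finsupp.linearCombination ℂ f c‖) :
    ∃ T : H →L[ℂ] H', ∀ x, T (f x) = g x := by
  have hd : DenseRange (Finsupp.linearCombination ℂ f) := by
    have : Set.range (Finsupp.linearCombination ℂ f) = (Submodule.span ℂ (Set.range f) : Set H) := by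
      rw [← Finsupp.range_linearCombination]
      rfl
    rw [DenseRange, this]
    exact hf
  refine ⟨(Finsupp.linearCombination ℂ g).extendOfNorm (Finsupp.linearCombination ℂ f), fun x => ?_⟩
  have h1 := LinearMap.extendOfNorm_eq (f := Finsupp.linearCombination ℂ g) hd ⟨C, h⟩
    (Finsupp.single x 1)
  simpa using h1

theorem inner_linearCombination (f g : X → H) (c : X →₀ ℂ) :
    ⟪Finsupp.linearCombination ℂ f c, Finsupp.linearCombination ℂ g c⟫_ℂ =
      c.sum fun x a => c.sum fun y b => starRingEnd ℂ a * b * ⟪f x, g y⟫_ℂ := by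
  simp only [Finsupp.linearCombination_apply, Finsupp.sum, sum_inner, inner_sum, inner_smul_left,
    inner_smul_right, Finset.mul_sum]
  rw [Finset.sum_comm]
  refine Finset.sum_congr rfl fun x _ => Finset.sum_congr rfl fun y _ => ?_
  ring

theorem exists_clm_of_inner [CompleteSpace H']
    (hf : Dense (Submodule.span ℂ (Set.range f) : Set H)) (g : X → H') (γ : ℂ)
    (h : ∀ x y, ⟪g x, g y⟫_ℂ = ⟪f x, f y⟫_ℂ * γ) :
    ∃ T : H →L[ℂ] H', ∀ x, T (f x) = g x := by
  refine exists_clm_of_total hf g (√‖γ‖) fun c => ?_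
  have h1 : ⟪Finsupp.linearCombination ℂ g c, Finsupp.linearCombination ℂ g c⟫_ℂ =
      ⟪Finsupp.linearCombination ℂ f c, Finsupp.linearCombination ℂ f c⟫_ℂ * γ := by
    rw [inner_linearCombination, inner_linearCombination]
    simp only [Finsupp.sum, Finset.sum_mul, h]
    refine Finset.sum_congr rfl fun x _ => Finset.sum_congr rfl fun y _ => ?_
    ring
  refine abs_le_of_sq_le_sq' ?_ (by positivity) |>.2
  have h2 := congrArg norm h1
  rw [norm_mul, inner_self_eq_norm_sq_to_K, inner_self_eq_norm_sq_to_K] at h2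
  rw [mul_pow, Real.sq_sqrt (norm_nonneg _)]
  simp only [norm_pow, RCLike.norm_ofReal, abs_norm] at h2
  linarith

theorem inner_clm_total {H₁ H₂ : Type*} [NormedAddCommGroup H₁] [InnerProductSpace ℂ H₁]
    [CompleteSpace H₁] [NormedAddCommGroup H₂] [InnerProductSpace ℂ H₂] [CompleteSpace H₂] {f : X → H₁}
    (hf : Dense (Submodule.span ℂ (Set.range f) : Set H₁)) {S T : H₁ →L[ℂ] H₂} {γ : ℂ}
    (h : ∀ x y, ⟪S (f x), T (f y)⟫_ℂ = ⟪f x, f y⟫_ℂ * γ) (v w : H₁) :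
    ⟪S v, T w⟫_ℂ = ⟪v, w⟫_ℂ * γ := by
  have h1 : ContinuousLinearMap.adjoint S ∘L T = γ • ContinuousLinearMap.id ℂ H₁ := by
    refine clm_ext_total hf fun y => eq_of_inner_total hf fun x => ?_
    simp [ContinuousLinearMap.adjoint_inner_right, h, mul_comm]
  rw [← ContinuousLinearMap.adjoint_inner_right]
  have h2 := congrArg (fun A : H₁ →L[ℂ] H₁ => A w) h1
  simp only [ContinuousLinearMap.comp_apply, smul_apply,
    ContinuousLinearMap.id_apply] at h2
  rw [h2, inner_smul_right, mul_comm]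

end Total

/-! ### Amplification of operators to a tensor product -/

section Amplification

variable {E H 𝒯 : Type*} [NormedAddCommGroup E] [InnerProductSpace ℂ E] [CompleteSpace E]
  [NormedAddCommGroup H] [InnerProductSpace ℂ H] [CompleteSpace H]

theorem inner_star_mul_self (A : H →L[ℂ] H) (ξ : H) :
    ⟪ξ, (star A * A) ξ⟫_ℂ = ((‖A ξ‖ ^ 2 : ℝ) : ℂ) := by
  rw [ContinuousLinearMap.star_eq_adjoint, mul_apply_eq_comp,
    ContinuousLinearMap.adjoint_inner_right, inner_self_eq_norm_sq_to_K]
  simp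

theorem inner_sum_star_mul_self_sub {X : Type*} (F : Finset X) (S : H →L[ℂ] H) (D : X → H →L[ℂ] H)
    (C : ℝ) (ξ : H) :
    ⟪ξ, ((C : ℂ) • ∑ x ∈ F, star (D x) * D x - star S * S) ξ⟫_ℂ =
      ((C * ∑ x ∈ F, ‖D x ξ‖ ^ 2 - ‖S ξ‖ ^ 2 : ℝ) : ℂ) := by
  rw [sub_apply, inner_sub_right, inner_star_mul_self, smul_apply, inner_smul_right, sum_apply,
    inner_sum]
  simp only [inner_star_mul_self]
  push_cast
  rfl

/-- A family `V t : E → H` of operators that exhibits `H` as a Hilbert space tensor product of `E`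
and a space spanned by vectors `ω t` with `⟪ω t, ω s⟫ = Γ t s`: think of `V t v = v ⊗ ω t`. -/
structure IsTensorFamily (V : 𝒯 → E →L[ℂ] H) (Γ : 𝒯 → 𝒯 → ℂ) : Prop where
  inner : ∀ t s v w, ⟪V t v, V s w⟫_ℂ = ⟪v, w⟫_ℂ * Γ t s
  dense : Dense (Submodule.span ℂ (Set.range fun p : 𝒯 × E => V p.1 p.2) : Set H)

namespace IsTensorFamily

variable {V : 𝒯 → E →L[ℂ] H} {Γ : 𝒯 → 𝒯 → ℂ} (hV : IsTensorFamily V Γ)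
include hV

theorem clm_ext {F : Type*} [NormedAddCommGroup F] [InnerProductSpace ℂ F] {S T : H →L[ℂ] F}
    (h : ∀ t v, S (V t v) = T (V t v)) : S = T :=
  clm_ext_total hV.dense fun p => h p.1 p.2

/-- The bound `‖∑ V t (T v)‖ ≤ ‖T‖ ‖∑ V t v‖` holds because `‖T‖² - T* T = S* S` for some `S`, and
`‖∑ V t (S v)‖² ≥ 0`. -/
theorem exists_amplification (T : E →L[ℂ] E) : ∃ T' : H →L[ℂ] H, ∀ t v, T' (V t v) = V t (T v) := by
  have hS : ∃ S : E →L[ℂ] E, star S * S = algebraMap ℝ (E →L[ℂ] E) (‖T‖ ^ 2) - star T * T := by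
    have h1 : 0 ≤ algebraMap ℝ (E →L[ℂ] E) (‖T‖ ^ 2) - star T * T :=
      sub_nonneg.2 (CStarAlgebra.star_mul_le_algebraMap_norm_sq)
    obtain ⟨S, hS⟩ := CStarAlgebra.nonneg_iff_eq_star_mul_self.1 h1
    exact ⟨S, hS.symm⟩
  obtain ⟨S, hS⟩ := hS
  obtain ⟨T', hT'⟩ := exists_clm_of_total hV.dense (fun p : 𝒯 × E => V p.1 (T p.2)) ‖T‖ (by
    intro c
    have hgen : ∀ A : E →L[ℂ] E, ((‖Finsupp.linearCombination ℂ
        (fun p : 𝒯 × E => V p.1 (A p.2)) c‖ ^ 2 : ℝ) : ℂ) =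
        c.sum fun x a => c.sum fun y b => starRingEnd ℂ a * b *
          (⟪x.2, (star A * A) y.2⟫_ℂ * Γ x.1 y.1) := by
      intro A
      rw [Complex.ofReal_pow, ← RCLike.ofReal_eq_complex_ofReal, ← inner_self_eq_norm_sq_to_K (𝕜 := ℂ),
        inner_linearCombination]
      simp only [hV.inner, ContinuousLinearMap.star_eq_adjoint, mul_apply_eq_comp,
        ContinuousLinearMap.adjoint_inner_right]
    have h1 := hgen S
    have h2 := hgen T
    have h3 := hgen 1
    have h4 : ((‖Finsupp.linearCombination ℂ (fun p : 𝒯 × E => V p.1 (S p.2)) c‖ ^ 2 : ℝ) : ℂ) =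
        ((‖T‖ ^ 2 : ℝ) : ℂ) *
          ((‖Finsupp.linearCombination ℂ (fun p : 𝒯 × E => V p.1 ((1 : E →L[ℂ] E) p.2)) c‖ ^ 2
            : ℝ) : ℂ) -
        ((‖Finsupp.linearCombination ℂ (fun p : 𝒯 × E => V p.1 (T p.2)) c‖ ^ 2 : ℝ) : ℂ) := by
      rw [h1, h2, h3, hS]
      simp only [Finsupp.sum, Finset.mul_sum, ← Finset.sum_sub_distrib]
      refine Finset.sum_congr rfl fun x _ => Finset.sum_congr rfl fun y _ => ?_
      have h5 : (algebraMap ℝ (E →L[ℂ] E) (‖T‖ ^ 2)) y.2 = ((‖T‖ ^ 2 : ℝ) : ℂ) • y.2 := by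
        rw [Algebra.algebraMap_eq_smul_one, ← Complex.coe_smul]
        rfl
      rw [sub_apply, inner_sub_right, h5, inner_smul_right, star_one, one_mul,
        one_apply_eq_self]
      ring
    have h5 : ‖Finsupp.linearCombination ℂ (fun p : 𝒯 × E => V p.1 (S p.2)) c‖ ^ 2 =
        ‖T‖ ^ 2 * ‖Finsupp.linearCombination ℂ (fun p : 𝒯 × E => V p.1 p.2) c‖ ^ 2 -
        ‖Finsupp.linearCombination ℂ (fun p : 𝒯 × E => V p.1 (T p.2)) c‖ ^ 2 := by
      exact_mod_cast h4
    refine abs_le_of_sq_le_sq' ?_ (by positivity) |>.2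
    rw [mul_pow]
    linarith [sq_nonneg ‖Finsupp.linearCombination ℂ (fun p : 𝒯 × E => V p.1 (S p.2)) c‖])
  exact ⟨T', fun t v => hT' (t, v)⟩

/-- The amplification `T ↦ T ⊗ 1`. -/
def amp : (E →L[ℂ] E) →⋆ₐ[ℂ] (H →L[ℂ] H) where
  toFun T := (hV.exists_amplification T).choose
  map_one' := hV.clm_ext fun t v => by rw [(hV.exists_amplification 1).choose_spec]; simp
  map_mul' S T := hV.clm_ext fun t v => by
    rw [(hV.exists_amplification _).choose_spec, mul_apply_eq_comp, mul_apply_eq_comp,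
      (hV.exists_amplification T).choose_spec, (hV.exists_amplification S).choose_spec]
  map_zero' := hV.clm_ext fun t v => by rw [(hV.exists_amplification 0).choose_spec]; simp
  map_add' S T := hV.clm_ext fun t v => by
    rw [(hV.exists_amplification _).choose_spec, add_apply, add_apply,
      (hV.exists_amplification T).choose_spec, (hV.exists_amplification S).choose_spec, map_add]
  commutes' r := hV.clm_ext fun t v => by
    rw [(hV.exists_amplification _).choose_spec, Algebra.algebraMap_eq_smul_one,
      Algebra.algebraMap_eq_smul_one]
    simp
  map_star' T := by
    rw [ContinuousLinearMap.star_eq_adjoint, ContinuousLinearMap.star_eq_adjoint]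
    refine eq_adjoint_of_total hV.dense hV.dense fun x y => ?_
    rw [(hV.exists_amplification _).choose_spec, (hV.exists_amplification _).choose_spec, hV.inner,
      hV.inner, ContinuousLinearMap.adjoint_inner_right]

theorem amp_apply (T : E →L[ℂ] E) (t : 𝒯) (v : E) : hV.amp T (V t v) = V t (T v) :=
  (hV.exists_amplification T).choose_spec t v

theorem norm_amp_le (T : E →L[ℂ] E) : ‖hV.amp T‖ ≤ ‖T‖ :=
  NonUnitalStarAlgHom.norm_apply_le hV.amp T

/-- An operator inequality `S* S ≤ C ∑ Dₓ* Dₓ` is inherited by amplifications. -/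
theorem norm_amp_sq_le {X : Type*} (F : Finset X) (S : E →L[ℂ] E) (D : X → E →L[ℂ] E) (C : ℝ)
    (h : ∀ ξ, ‖S ξ‖ ^ 2 ≤ C * ∑ x ∈ F, ‖D x ξ‖ ^ 2) (ξ : H) :
    ‖hV.amp S ξ‖ ^ 2 ≤ C * ∑ x ∈ F, ‖hV.amp (D x) ξ‖ ^ 2 := by
  have h1 : 0 ≤ (C : ℂ) • ∑ x ∈ F, star (D x) * D x - star S * S := by
    rw [ContinuousLinearMap.nonneg_iff_isPositive, ContinuousLinearMap.isPositive_iff_complex]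
    intro ξ
    rw [← inner_conj_symm, inner_sum_star_mul_self_sub, Complex.conj_ofReal]
    refine ⟨congrArg _ (Complex.ofReal_re _), ?_⟩
    exact (sub_nonneg.2 (h ξ)).trans_eq (Complex.ofReal_re _).symm
  obtain ⟨Q, hQ⟩ := CStarAlgebra.nonneg_iff_eq_star_mul_self.1 h1
  have h2 := inner_sum_star_mul_self_sub F (hV.amp S) (fun x => hV.amp (D x)) C ξ
  have h3 : (C : ℂ) • ∑ x ∈ F, star (hV.amp (D x)) * hV.amp (D x) - star (hV.amp S) * hV.amp S =
      star (hV.amp Q) * hV.amp Q := by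
    rw [← map_star hV.amp Q, ← map_mul, ← hQ]
    simp only [map_sub, map_smul, map_sum, map_mul, map_star]
  rw [h3, inner_star_mul_self] at h2
  have h4 := Complex.ofReal_injective h2
  linarith [sq_nonneg ‖hV.amp Q ξ‖]

end IsTensorFamily

end Amplification

/-! ### Operators on Hilbert space tensor products -/

section HilbertTensor

variable {ι : Type*} {E : ι → Type*} [∀ i, NormedAddCommGroup (E i)]
  [∀ i, InnerProductSpace ℂ (E i)]

namespace ElemTensor

variable {e : ∀ i, E i}

/-- Replace the `i`-th entry by `v`. -/
def setAt (x : ElemTensor e) (i : ι) (v : E i) : ElemTensor e := updateAt i (fun _ => v) x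

@[simp] theorem setAt_same (x : ElemTensor e) (i : ι) (v : E i) : (setAt x i v).1 i = v := by
  simp [setAt, updateAt]

theorem setAt_of_ne (x : ElemTensor e) {i j : ι} (v : E i) (h : j ≠ i) :
    (setAt x i v).1 j = x.1 j := by
  classical exact Function.update_of_ne h _ _

@[ext] theorem ext {x y : ElemTensor e} (h : ∀ i, x.1 i = y.1 i) : x = y :=
  Subtype.ext (funext h)

@[simp] theorem setAt_self (x : ElemTensor e) (i : ι) : setAt x i (x.1 i) = x := by
  ext j
  by_cases h : j = i
  · subst h; simp
  · rw [setAt_of_ne _ _ h]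

@[simp] theorem setAt_setAt (x : ElemTensor e) (i : ι) (v w : E i) :
    setAt (setAt x i v) i w = setAt x i w := by
  ext j
  by_cases h : j = i
  · subst h; simp
  · rw [setAt_of_ne _ _ h, setAt_of_ne _ _ h, setAt_of_ne _ _ h]

theorem setAt_comm (x : ElemTensor e) {i j : ι} (h : i ≠ j) (v : E i) (w : E j) :
    setAt (setAt x i v) j w = setAt (setAt x j w) i v := by
  ext k
  by_cases hi : k = i
  · subst hi; rw [setAt_of_ne _ _ h]; simp
  · by_cases hj : k = j
    · subst hj; rw [setAt_of_ne _ v hi]; simp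
    · rw [setAt_of_ne _ _ hj, setAt_of_ne _ _ hi, setAt_of_ne _ _ hi, setAt_of_ne _ _ hj]

theorem kernel_setAt (he : ∀ i, ‖e i‖ = 1) (x y : ElemTensor e) (i : ι) (v w : E i) :
    kernel (setAt x i v) (setAt y i w) =
      ⟪v, w⟫_ℂ * kernel (setAt x i (e i)) (setAt y i (e i)) := by
  classical
  have hx : ∀ v : E i, ∀ j ∉ insert i (x.2.toFinset ∪ y.2.toFinset), (setAt x i v).1 j = e j := by
    intro v j hj
    simp only [Finset.mem_insert, Finset.mem_union, Set.Finite.mem_toFinset, Set.mem_ofPred_eq,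
      not_or, not_not] at hj
    rw [setAt_of_ne _ _ hj.1, hj.2.1]
  have hy : ∀ v : E i, ∀ j ∉ insert i (x.2.toFinset ∪ y.2.toFinset), (setAt y i v).1 j = e j := by
    intro v j hj
    simp only [Finset.mem_insert, Finset.mem_union, Set.Finite.mem_toFinset, Set.mem_ofPred_eq,
      not_or, not_not] at hj
    rw [setAt_of_ne _ _ hj.1, hj.2.2]
  rw [kernel_eq_prod he _ _ _ (hx v) (hy w), kernel_eq_prod he _ _ _ (hx _) (hy _),
    ← Finset.mul_prod_erase _ _ (Finset.mem_insert_self i _),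
    ← Finset.mul_prod_erase _ _ (Finset.mem_insert_self i _)]
  simp only [setAt_same, inner_self_eq_norm_sq_to_K, he]
  have h : ∀ j ∈ (insert i (x.2.toFinset ∪ y.2.toFinset)).erase i,
      ⟪(setAt x i v).1 j, (setAt y i w).1 j⟫_ℂ =
        ⟪(setAt x i (e i)).1 j, (setAt y i (e i)).1 j⟫_ℂ := fun j hj => by
    have := Finset.ne_of_mem_erase hj
    simp only [setAt_of_ne _ _ this]
  rw [Finset.prod_congr rfl h]
  simp

theorem kernel_setAt_right (he : ∀ i, ‖e i‖ = 1) (x y : ElemTensor e) (i : ι) (w : E i) :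
    kernel x (setAt y i w) = ⟪x.1 i, w⟫_ℂ * kernel (setAt x i (e i)) (setAt y i (e i)) := by
  rw [← kernel_setAt he, setAt_self]

theorem kernel_setAt_left (he : ∀ i, ‖e i‖ = 1) (x y : ElemTensor e) (i : ι) (v : E i) :
    kernel (setAt x i v) y = ⟪v, y.1 i⟫_ℂ * kernel (setAt x i (e i)) (setAt y i (e i)) := by
  rw [← kernel_setAt he, setAt_self]

/-- Induction on the support of an elementary tensor. -/
theorem induction_on_support {P : ElemTensor e → Prop} (x : ElemTensor e) (h0 : P (base e))
    (h : ∀ (y : ElemTensor e) (i : ι) (v : E i), y.1 i = e i → P y → P (setAt y i v)) : P x := by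
  classical
  have key : ∀ s : Finset ι, ∃ y : ElemTensor e, (∀ j, y.1 j = if j ∈ s then x.1 j else e j) ∧
      P y := by
    intro s
    induction s using Finset.induction_on with
    | empty => exact ⟨base e, fun j => by simp [base], h0⟩
    | insert i s hi ih =>
      obtain ⟨y, hy, hPy⟩ := ih
      refine ⟨setAt y i (x.1 i), fun j => ?_, h y i _ (by rw [hy, if_neg hi]) hPy⟩
      by_cases hji : j = i
      · subst hji; simp
      · rw [setAt_of_ne _ _ hji, hy]; simp [hji]
  obtain ⟨y, hy, hPy⟩ := key x.2.toFinset
  have : y = x := by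
    ext j
    rw [hy]
    split_ifs with hj
    · rfl
    · simp only [Set.Finite.mem_toFinset, Set.mem_ofPred_eq, not_not] at hj
      exact hj.symm
  rwa [← this]

end ElemTensor

namespace HilbertTensor

open ElemTensor

variable {e : ∀ i, E i} {he : ∀ i, ‖e i‖ = 1}

theorem inner_tprod (x y : ElemTensor e) : ⟪tprod e he x, tprod e he y⟫_ℂ = kernel x y := by
  unfold tprod
  rw [UniformSpace.Completion.inner_coe]
  change PreTensor.form e (Finsupp.single x 1) (Finsupp.single y 1) = _
  unfold PreTensor.form
  rw [Finsupp.sum_single_index (by simp), Finsupp.sum_single_index (by simp)]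
  simp

variable (e he) in
theorem dense_span_tprod :
    Dense (Submodule.span ℂ (Set.range (tprod e he)) : Set (HilbertTensor e he)) := by
  have h1 : ∀ f : ElemTensor e →₀ ℂ, ((PreTensor.of e he f : PreTensor e he) : HilbertTensor e he) ∈
      Submodule.span ℂ (Set.range (tprod e he)) := by
    intro f
    let L : PreTensor e he →ₗ[ℂ] HilbertTensor e he :=
      (UniformSpace.Completion.toComplₗᵢ (𝕜 := ℂ) (E := PreTensor e he)).toLinearMap
    change L (PreTensor.of e he f) ∈ _
    induction f using Finsupp.induction_linear with
    | zero => rw [map_zero, map_zero]; exact zero_mem _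
    | add f g hf hg => rw [map_add, map_add]; exact add_mem hf hg
    | single x c =>
      have h2 : Finsupp.single x c = c • Finsupp.single x (1 : ℂ) := by simp
      rw [h2, map_smul, map_smul]
      exact Submodule.smul_mem _ _ (Submodule.subset_span ⟨x, rfl⟩)
  refine (UniformSpace.Completion.denseRange_coe (α := PreTensor e he)).mono ?_
  rintro _ ⟨f, rfl⟩
  exact h1 ((PreTensor.of e he).symm f)

theorem siteOp_tprod (i : ι) (T : E i →L[ℂ] E i) (x : ElemTensor e) :
    siteOp e he i T (tprod e he x) = tprod e he (setAt x i (T (x.1 i))) := by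
  unfold siteOp tprod
  rw [ContinuousLinearMap.completion_apply_coe]
  congr 1
  change Finsupp.mapDomain _ (Finsupp.single x 1) = _
  rw [Finsupp.mapDomain_single]
  rfl

theorem siteOp_tprod_setAt (i : ι) (T : E i →L[ℂ] E i) (x : ElemTensor e) (v : E i) :
    siteOp e he i T (tprod e he (setAt x i v)) = tprod e he (setAt x i (T v)) := by
  rw [siteOp_tprod, setAt_setAt, setAt_same]

theorem commute_siteOp {i j : ι} (h : i ≠ j) (S : E i →L[ℂ] E i) (T : E j →L[ℂ] E j) :
    siteOp e he i S * siteOp e he j T = siteOp e he j T * siteOp e he i S := by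
  refine clm_ext_total (dense_span_tprod e he) fun x => ?_
  rw [mul_apply_eq_comp, mul_apply_eq_comp, siteOp_tprod, siteOp_tprod, siteOp_tprod, siteOp_tprod,
    setAt_of_ne _ _ h, setAt_of_ne _ _ h.symm, setAt_comm _ h]

theorem siteOp_mul (i : ι) (S T : E i →L[ℂ] E i) :
    siteOp e he i (S * T) = siteOp e he i S * siteOp e he i T := by
  refine clm_ext_total (dense_span_tprod e he) fun x => ?_
  rw [mul_apply_eq_comp, siteOp_tprod, siteOp_tprod, siteOp_tprod_setAt, mul_apply_eq_comp]

theorem star_siteOp [∀ i, CompleteSpace (E i)] (i : ι) (T : E i →L[ℂ] E i) :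
    star (siteOp e he i T) = siteOp e he i (star T) := by
  rw [ContinuousLinearMap.star_eq_adjoint, ContinuousLinearMap.star_eq_adjoint]
  symm
  refine eq_adjoint_of_total (dense_span_tprod e he) (dense_span_tprod e he) fun x y => ?_
  rw [siteOp_tprod, siteOp_tprod, inner_tprod, inner_tprod,
    kernel_setAt_right he x y i (ContinuousLinearMap.adjoint T (y.1 i)),
    kernel_setAt_left he x y i (T (x.1 i)), ContinuousLinearMap.adjoint_inner_right]

variable (he) in
/-- The elementary tensor `x` as a linear function of its `i`-th entry. -/
def slice (x : ElemTensor e) (i : ι) : E i →L[ℂ] HilbertTensor e he :=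
  LinearMap.mkContinuous
    { toFun := fun v => tprod e he (setAt x i v)
      map_add' := fun v w => by
        refine eq_of_inner_total (dense_span_tprod e he) fun y => ?_
        rw [inner_add_right, inner_tprod, inner_tprod, inner_tprod,
          kernel_setAt_right he y x i (v + w), kernel_setAt_right he y x i v,
          kernel_setAt_right he y x i w, inner_add_right, add_mul]
      map_smul' := fun c v => by
        refine eq_of_inner_total (dense_span_tprod e he) fun y => ?_
        rw [RingHom.id_apply, inner_smul_right, inner_tprod, inner_tprod,
          kernel_setAt_right he y x i (c • v), kernel_setAt_right he y x i v, inner_smul_right, mul_assoc] }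
    ‖tprod e he (setAt x i (e i))‖ fun v => by
      have h : ‖tprod e he (setAt x i v)‖ ^ 2 = (‖tprod e he (setAt x i (e i))‖ * ‖v‖) ^ 2 := by
        have h1 : ((‖tprod e he (setAt x i v)‖ ^ 2 : ℝ) : ℂ) =
            ((‖tprod e he (setAt x i (e i))‖ * ‖v‖) ^ 2 : ℝ) := by
          rw [mul_pow]
          push_cast
          have hn : ∀ {F : Type _} [NormedAddCommGroup F] [InnerProductSpace ℂ F] (u : F),
              (‖u‖ : ℂ) ^ 2 = ⟪u, u⟫_ℂ := fun u => (inner_self_eq_norm_sq_to_K u).symm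
          rw [hn, hn, inner_tprod, inner_tprod, kernel_setAt he]
          have : (‖v‖ : ℂ) ^ 2 = ⟪v, v⟫_ℂ := (inner_self_eq_norm_sq_to_K v).symm
          rw [this, mul_comm]
        exact_mod_cast h1
      exact le_of_eq ((sq_eq_sq₀ (norm_nonneg _) (by positivity)).1 h)

theorem slice_apply (x : ElemTensor e) (i : ι) (v : E i) :
    slice he x i v = tprod e he (setAt x i v) := rfl

theorem siteOp_slice (x : ElemTensor e) (i : ι) (T : E i →L[ℂ] E i) (v : E i) :
    siteOp e he i T (slice he x i v) = slice he x i (T v) := siteOp_tprod_setAt i T x v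

theorem adjoint_slice_siteOp [∀ i, CompleteSpace (E i)] (x : ElemTensor e) (i : ι)
    (T : E i →L[ℂ] E i) (ξ : HilbertTensor e he) :
    ContinuousLinearMap.adjoint (slice he x i) (siteOp e he i T ξ) =
      T (ContinuousLinearMap.adjoint (slice he x i) ξ) := by
  have h : siteOp e he i T = ContinuousLinearMap.adjoint (siteOp e he i (star T)) := by
    rw [← ContinuousLinearMap.star_eq_adjoint, star_siteOp, star_star]
  refine ext_inner_left ℂ fun w => ?_
  rw [ContinuousLinearMap.adjoint_inner_right, h, ContinuousLinearMap.adjoint_inner_right,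
    siteOp_slice, ContinuousLinearMap.star_eq_adjoint,
    ← ContinuousLinearMap.adjoint_inner_right (slice he x i), ContinuousLinearMap.adjoint_inner_left]

theorem norm_slice_base (i : ι) (v : E i) : ‖slice he (base e) i v‖ = ‖v‖ := by
  have h : (‖slice he (base e) i v‖ : ℂ) ^ 2 = (‖v‖ : ℂ) ^ 2 := by
    have h1 := inner_self_eq_norm_sq_to_K (𝕜 := ℂ) (slice he (base e) i v)
    have h2 := inner_self_eq_norm_sq_to_K (𝕜 := ℂ) v
    have h3 : setAt (base e) i (e i) = base e := setAt_self (base e) i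
    have h4 : kernel (base e) (base e) = 1 := by
      rw [← inner_tprod (he := he), inner_self_eq_norm_sq_to_K, norm_tprod_base]
      simp
    rw [slice_apply, inner_tprod, kernel_setAt he, h3, h4, mul_one, h2] at h1
    exact h1.symm
  have h' : ‖slice he (base e) i v‖ ^ 2 = ‖v‖ ^ 2 := by exact_mod_cast h
  exact (sq_eq_sq₀ (norm_nonneg _) (norm_nonneg _)).1 h'

end HilbertTensor

end HilbertTensor

/-! ### Splitting off finitely many tensor factors -/

section Glue

variable {E : ℕ → Type*} [∀ i, NormedAddCommGroup (E i)] [∀ i, InnerProductSpace ℂ (E i)]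

namespace ElemTensor

variable {e : ∀ i, E i} {n : ℕ}

/-- The elementary tensor with the first `n` entries of `x` and the remaining entries of `t`. -/
def glue (x : ElemTensor fun j : Fin n => e j) (t : ElemTensor e) : ElemTensor e :=
  ⟨fun i => if h : i < n then x.1 ⟨i, h⟩ else t.1 i, by
    refine ((Finset.range n).finite_toSet.union t.2).subset fun i hi => ?_
    by_cases h : i < n
    · left; simpa using h
    · right
      simpa [h] using hi⟩

theorem glue_of_lt (x : ElemTensor fun j : Fin n => e j) (t : ElemTensor e) {i : ℕ} (h : i < n) :
    (glue x t).1 i = x.1 ⟨i, h⟩ := by simp [glue, h]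

theorem glue_of_not_lt (x : ElemTensor fun j : Fin n => e j) (t : ElemTensor e) {i : ℕ}
    (h : ¬ i < n) : (glue x t).1 i = t.1 i := by simp [glue, h]

/-- The first `n` entries of an elementary tensor. -/
def head (n : ℕ) (t : ElemTensor e) : ElemTensor fun j : Fin n => e j :=
  ⟨fun j => t.1 j, Set.toFinite _⟩

theorem glue_head (t : ElemTensor e) : glue (head n t) t = t := by
  ext i
  by_cases h : i < n
  · rw [glue_of_lt _ _ h]; rfl
  · rw [glue_of_not_lt _ _ h]

theorem glue_base : glue (base fun j : Fin n => e j) (base e) = base e :=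
  glue_head (base e)

theorem glue_setAt_of_lt (x : ElemTensor fun j : Fin n => e j) (t : ElemTensor e) (i : Fin n)
    (v : E i) : setAt (glue x t) (i : ℕ) v = glue (setAt x i v) t := by
  ext j
  by_cases hji : j = i
  · subst hji
    rw [setAt_same, glue_of_lt _ _ i.2]
    exact (setAt_same x i v).symm
  · rw [setAt_of_ne _ _ hji]
    by_cases h : j < n
    · rw [glue_of_lt _ _ h, glue_of_lt _ _ h, setAt_of_ne]
      exact fun h' => hji (congrArg Fin.val h')
    · rw [glue_of_not_lt _ _ h, glue_of_not_lt _ _ h]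

theorem glue_setAt_of_not_lt (x : ElemTensor fun j : Fin n => e j) (t : ElemTensor e) {i : ℕ}
    (hi : ¬ i < n) (v : E i) : setAt (glue x t) i v = glue x (setAt t i v) := by
  ext j
  by_cases hji : j = i
  · subst hji
    rw [setAt_same, glue_of_not_lt _ _ hi, setAt_same]
  · rw [setAt_of_ne _ _ hji]
    by_cases h : j < n
    · rw [glue_of_lt _ _ h, glue_of_lt _ _ h]
    · rw [glue_of_not_lt _ _ h, glue_of_not_lt _ _ h, setAt_of_ne _ _ hji]

theorem kernel_glue (he : ∀ i, ‖e i‖ = 1) (x y : ElemTensor fun j : Fin n => e j)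
    (t s : ElemTensor e) :
    kernel (glue x t) (glue y s) = kernel x y *
      kernel (glue (base fun j : Fin n => e j) t) (glue (base fun j : Fin n => e j) s) := by
  classical
  obtain ⟨A, hA⟩ := exists_finset ({t, s} : Finset (ElemTensor e))
  obtain ⟨m, hm⟩ := A.exists_nat_subset_range
  have hout : ∀ (z : ElemTensor fun j : Fin n => e j) (r : ElemTensor e),
      r ∈ ({t, s} : Finset (ElemTensor e)) → ∀ i ∉ Finset.range (n + m), (glue z r).1 i = e i := by
    intro z r hr i hi
    simp only [Finset.mem_range, not_lt] at hi
    rw [glue_of_not_lt _ _ (by omega)]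
    refine hA r hr i fun hiA => ?_
    have := Finset.mem_range.1 (hm hiA)
    omega
  have ht : t ∈ ({t, s} : Finset (ElemTensor e)) := by simp
  have hs : s ∈ ({t, s} : Finset (ElemTensor e)) := by simp
  rw [kernel_eq_prod he _ _ _ (hout x t ht) (hout y s hs),
    kernel_eq_prod he _ _ _ (hout _ t ht) (hout _ s hs),
    kernel_eq_prod (fun j : Fin n => he j) x y Finset.univ (by simp) (by simp),
    Finset.prod_range_add, Finset.prod_range_add, ← mul_assoc]
  have h1 : ∀ (z w : ElemTensor fun j : Fin n => e j) (i : Fin n),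
      ⟪(glue z t).1 i, (glue w s).1 i⟫_ℂ = ⟪z.1 i, w.1 i⟫_ℂ := by
    intro z w i
    rw [glue_of_lt _ _ i.2, glue_of_lt _ _ i.2]
  have h2 : ∀ (z w : ElemTensor fun j : Fin n => e j) (i : ℕ),
      ⟪(glue z t).1 (n + i), (glue w s).1 (n + i)⟫_ℂ = ⟪t.1 (n + i), s.1 (n + i)⟫_ℂ := by
    intro z w i
    rw [glue_of_not_lt _ _ (by omega), glue_of_not_lt _ _ (by omega)]
  simp only [h2, Finset.prod_range (n := n), h1]
  simp [base, inner_self_eq_norm_sq_to_K, he]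

end ElemTensor

namespace HilbertTensor

open ElemTensor

variable {e : ∀ i, E i} (he : ∀ i, ‖e i‖ = 1) (n : ℕ)

theorem exists_glueOp (t : ElemTensor e) :
    ∃ V : HilbertTensor (fun j : Fin n => e j) (fun j => he j) →L[ℂ] HilbertTensor e he,
      ∀ x, V (tprod _ _ x) = tprod e he (glue x t) :=
  exists_clm_of_inner (dense_span_tprod _ _) (fun x => tprod e he (glue x t)) _ fun x y => by
    rw [inner_tprod, inner_tprod, kernel_glue he]

/-- The operator `x ↦ x ⊗ t'`, where `t'` consists of the entries of `t` from the `n`-th on. -/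
def glueOp (t : ElemTensor e) :
    HilbertTensor (fun j : Fin n => e j) (fun j => he j) →L[ℂ] HilbertTensor e he :=
  (exists_glueOp he n t).choose

theorem glueOp_tprod (t : ElemTensor e) (x : ElemTensor fun j : Fin n => e j) :
    glueOp he n t (tprod _ _ x) = tprod e he (glue x t) := (exists_glueOp he n t).choose_spec x

theorem isTensorFamily_glueOp : IsTensorFamily (glueOp he n) fun t s : ElemTensor e =>
    kernel (glue (base fun j : Fin n => e j) t) (glue (base fun j : Fin n => e j) s) where
  inner t s := inner_clm_total (dense_span_tprod _ _) fun x y => by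
    rw [glueOp_tprod, glueOp_tprod, inner_tprod, inner_tprod, kernel_glue he]
  dense := by
    refine (dense_span_tprod e he).mono (Submodule.span_mono ?_)
    rintro _ ⟨x, rfl⟩
    exact ⟨(x, tprod _ _ (head n x)), (glueOp_tprod he n x _).trans (congrArg _ (glue_head x))⟩

theorem siteOp_glueOp_of_lt (t : ElemTensor e) (i : Fin n) (T : E i →L[ℂ] E i)
    (v : HilbertTensor (fun j : Fin n => e j) (fun j => he j)) :
    siteOp e he i T (glueOp he n t v) =
      glueOp he n t (siteOp (fun j : Fin n => e j) (fun j => he j) i T v) := by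
  have h : siteOp e he i T ∘L glueOp he n t =
      glueOp he n t ∘L siteOp (fun j : Fin n => e j) (fun j => he j) i T := by
    refine clm_ext_total (dense_span_tprod _ _) fun x => ?_
    rw [ContinuousLinearMap.comp_apply, ContinuousLinearMap.comp_apply, siteOp_tprod, glueOp_tprod,
      glueOp_tprod, siteOp_tprod, glue_of_lt _ _ i.2, ← glue_setAt_of_lt]
  exact congrArg (fun A : _ →L[ℂ] HilbertTensor e he => A v) h

theorem siteOp_glueOp_of_not_lt (t : ElemTensor e) {i : ℕ} (hi : ¬ i < n) (T : E i →L[ℂ] E i)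
    (v : HilbertTensor (fun j : Fin n => e j) (fun j => he j)) :
    siteOp e he i T (glueOp he n t v) = glueOp he n (setAt t i (T (t.1 i))) v := by
  have h : siteOp e he i T ∘L glueOp he n t = glueOp he n (setAt t i (T (t.1 i))) := by
    refine clm_ext_total (dense_span_tprod _ _) fun x => ?_
    rw [ContinuousLinearMap.comp_apply, glueOp_tprod, glueOp_tprod, siteOp_tprod,
      glue_of_not_lt _ _ hi, glue_setAt_of_not_lt _ _ hi]
  exact congrArg (fun A : _ →L[ℂ] HilbertTensor e he => A v) h

end HilbertTensor

end Glue

/-! ### Von Neumann algebras with a cyclic trace vector -/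

section TraceVector

variable {H : Type*} [NormedAddCommGroup H] [InnerProductSpace ℂ H] [CompleteSpace H]

theorem subset_vonNeumannClosure {S : Set (H →L[ℂ] H)} {g : H →L[ℂ] H} (hg : g ∈ S) :
    g ∈ vonNeumannClosure S := by
  change g ∈ StarSubalgebra.centralizer ℂ (StarSubalgebra.centralizer ℂ S : Set (H →L[ℂ] H))
  rw [StarSubalgebra.mem_centralizer_iff]
  intro y hy
  have hy' := StarSubalgebra.mem_centralizer_iff ℂ |>.1 hy
  have hy'' := StarSubalgebra.mem_centralizer_iff ℂ |>.1 (star_mem hy)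
  exact ⟨(hy' g hg).1.symm, (hy'' g hg).1.symm⟩

theorem mem_commutant_vonNeumannClosure {S : Set (H →L[ℂ] H)} {y : H →L[ℂ] H} :
    y ∈ (vonNeumannClosure S).commutant ↔ ∀ g ∈ S, g * y = y * g ∧ star g * y = y * star g := by
  rw [VonNeumannAlgebra.mem_commutant_iff]
  constructor
  · intro h g hg
    exact ⟨h g (subset_vonNeumannClosure hg), h _ (star_mem (subset_vonNeumannClosure hg))⟩
  · intro h x hx
    have hx' := StarSubalgebra.mem_centralizer_iff ℂ |>.1 hx
    exact (hx' y (StarSubalgebra.mem_centralizer_iff ℂ |>.2 h)).1.symm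

/-- By polarization, a state is a trace if its 2-norm is invariant under the adjoint. -/
theorem NormalState.isTracial_of_norm2_star {M : VonNeumannAlgebra H} (τ : NormalState M)
    (h : ∀ x, τ.norm2 (star x) = τ.norm2 x) : τ.IsTracial := by
  intro x y
  have h1 : τ.norm2 (star y + x) = τ.norm2 (star x + y) := by
    rw [← h, star_add, star_star, add_comm]
  have h2 : τ.norm2 (star y - x) = τ.norm2 (star x - y) := by
    rw [← h, star_sub, star_star, τ.norm2_sub_comm]
  have h3 : ∀ c : ℂ, c = Complex.I ∨ c = -Complex.I →
      τ.norm2 (star y + c • x) = τ.norm2 (star x + c • y) := by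
    intro c hc
    have hc1 : c * starRingEnd ℂ c = 1 := by rcases hc with rfl | rfl <;> simp
    have hc2 : ‖c‖ = 1 := by rcases hc with rfl | rfl <;> simp
    have : star x + c • y = c • star (star y + c • x) := by
      rw [star_add, star_star, star_smul, smul_add, smul_smul, Complex.star_def, hc1, one_smul,
        add_comm]
    rw [this, norm2_smul, hc2, one_mul, h]
  have h4 := h3 Complex.I (Or.inl rfl)
  have h5 := h3 (-Complex.I) (Or.inr rfl)
  rw [neg_smul, neg_smul, ← sub_eq_add_neg, ← sub_eq_add_neg] at h5
  have e1 := L2.inner_ofM τ (star x) y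
  have e2 := L2.inner_ofM τ (star y) x
  rw [star_star] at e1 e2
  rw [← e1, ← e2, inner_eq_sum_norm_sq_div_four, inner_eq_sum_norm_sq_div_four]
  simp only [← L2.ofM_add, ← L2.ofM_sub, ← L2.ofM_smul, L2.norm_ofM, RCLike.I_to_complex, h1, h2,
    h4, h5]

variable {M : VonNeumannAlgebra H} {Ω : H} {hΩ : ‖Ω‖ = 1}

theorem vectorState_apply (x : M.toStarSubalgebra) :
    vectorState M Ω hΩ x = ⟪Ω, (x : H →L[ℂ] H) Ω⟫_ℂ := rfl

theorem norm2_vectorState (x : M.toStarSubalgebra) :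
    (vectorState M Ω hΩ).norm2 x = ‖(x : H →L[ℂ] H) Ω‖ := by
  have h : (vectorState M Ω hΩ).norm2 x ^ 2 = ‖(x : H →L[ℂ] H) Ω‖ ^ 2 := by
    rw [NormalState.norm2_sq, vectorState_apply]
    have := inner_star_mul_self (x : H →L[ℂ] H) Ω
    change (⟪Ω, (star (x : H →L[ℂ] H) * (x : H →L[ℂ] H)) Ω⟫_ℂ).re = _
    rw [this, Complex.ofReal_re]
  exact (sq_eq_sq₀ (NormalState.norm2_nonneg _ _) (norm_nonneg _)).1 h

variable (M Ω) in
/-- The vectors `a Ω = a' Ω`, where `a ∈ M` and `a' ∈ M'` are partners: they and their adjoints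
agree on `Ω`. -/
def partnerVectors : Submodule ℂ H where
  carrier := {v | ∃ a ∈ M, ∃ a' ∈ M.commutant, v = a Ω ∧ a Ω = a' Ω ∧ star a Ω = star a' Ω}
  add_mem' := by
    rintro _ _ ⟨a, ha, a', ha', rfl, h1, h2⟩ ⟨b, hb, b', hb', rfl, h3, h4⟩
    exact ⟨a + b, add_mem ha hb, a' + b', add_mem ha' hb', by simp, by simp [h1, h3],
      by simp [h2, h4]⟩
  zero_mem' := ⟨0, zero_mem _, 0, zero_mem _, by simp, by simp, by simp⟩
  smul_mem' := by
    rintro c _ ⟨a, ha, a', ha', rfl, h1, h2⟩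
    exact ⟨c • a, M.toStarSubalgebra.smul_mem ha c, c • a',
      M.commutant.toStarSubalgebra.smul_mem ha' c, by simp, by simp [h1], by simp [h2]⟩

/-- If `g` and `a` have partners `g'` and `a'`, then `g a` has the partner `a' g'`. -/
theorem partnerVectors_invariant {g g' : H →L[ℂ] H} (hg : g ∈ M) (hg' : g' ∈ M.commutant)
    (h1 : g Ω = g' Ω) (h2 : star g Ω = star g' Ω) {v : H} (hv : v ∈ partnerVectors M Ω) :
    g v ∈ partnerVectors M Ω := by
  obtain ⟨a, ha, a', ha', rfl, h3, h4⟩ := hv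
  have hcomm : ∀ {x y : H →L[ℂ] H}, x ∈ M → y ∈ M.commutant → x (y Ω) = y (x Ω) := fun hx hy =>
    congrArg (fun T : H →L[ℂ] H => T Ω) (VonNeumannAlgebra.mem_commutant_iff.1 hy _ hx)
  refine ⟨g * a, mul_mem hg ha, a' * g', mul_mem ha' hg', rfl, ?_, ?_⟩
  · rw [mul_apply_eq_comp, mul_apply_eq_comp, h3, hcomm hg ha', h1]
  · rw [star_mul, star_mul, mul_apply_eq_comp, mul_apply_eq_comp, h2,
      hcomm (star_mem ha) (star_mem hg'), h4]

/-- If `a` has a partner `a'`, then `⟪x* Ω, a Ω⟫ = ⟪a* Ω, x Ω⟫` for `x ∈ M`, because `x` commutes with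
`a'`. For `x = a*` this gives `‖a* Ω‖ = ‖a Ω‖`, and density yields `‖x* Ω‖ ≤ ‖x Ω‖` for all `x`. -/
theorem isTracial_vectorState (hd : Dense (partnerVectors M Ω : Set H)) :
    (vectorState M Ω hΩ).IsTracial := by
  have hcomm : ∀ {x y : H →L[ℂ] H}, x ∈ M → y ∈ M.commutant → x (y Ω) = y (x Ω) := fun hx hy =>
    congrArg (fun T : H →L[ℂ] H => T Ω) (VonNeumannAlgebra.mem_commutant_iff.1 hy _ hx)
  have hswap : ∀ {x a a' : H →L[ℂ] H}, x ∈ M → a' ∈ M.commutant → a Ω = a' Ω →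
      star a Ω = star a' Ω → ⟪star x Ω, a Ω⟫_ℂ = ⟪star a Ω, x Ω⟫_ℂ := by
    intro x a a' hx ha' h1 h2
    rw [h2, h1, ContinuousLinearMap.star_eq_adjoint, ContinuousLinearMap.star_eq_adjoint,
      ContinuousLinearMap.adjoint_inner_left, ContinuousLinearMap.adjoint_inner_left, hcomm hx ha']
  have hle : ∀ x ∈ M, ‖star x Ω‖ ≤ ‖x Ω‖ := by
    intro x hx
    have h1 : ∀ v : H, ‖⟪star x Ω, v⟫_ℂ‖ ≤ ‖v‖ * ‖x Ω‖ := by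
      intro v
      have hcl : IsClosed {v : H | ‖⟪star x Ω, v⟫_ℂ‖ ≤ ‖v‖ * ‖x Ω‖} :=
        isClosed_le (by fun_prop) (by fun_prop)
      refine hcl.closure_subset_iff.2 ?_ (hd v)
      rintro _ ⟨a, ha, a', ha', rfl, h1, h2⟩
      have h3 : ‖star a Ω‖ = ‖a Ω‖ := by
        have h4 := hswap (star_mem ha) ha' h1 h2
        rw [star_star, inner_self_eq_norm_sq_to_K, inner_self_eq_norm_sq_to_K] at h4
        have h5 : ‖a Ω‖ ^ 2 = ‖star a Ω‖ ^ 2 := by exact_mod_cast h4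
        exact ((sq_eq_sq₀ (norm_nonneg _) (norm_nonneg _)).1 h5).symm
      change ‖⟪star x Ω, a Ω⟫_ℂ‖ ≤ ‖a Ω‖ * ‖x Ω‖
      rw [hswap hx ha' h1 h2, ← h3]
      exact norm_inner_le_norm _ _
    have h2 := h1 (star x Ω)
    rw [inner_self_eq_norm_sq_to_K, norm_pow, RCLike.norm_ofReal, abs_norm, pow_two] at h2
    by_cases h0 : ‖star x Ω‖ = 0
    · rw [h0]; positivity
    · exact le_of_mul_le_mul_left h2 (lt_of_le_of_ne (norm_nonneg _) (Ne.symm h0))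
  refine NormalState.isTracial_of_norm2_star _ fun x => ?_
  rw [norm2_vectorState, norm2_vectorState]
  refine le_antisymm (hle _ x.2) ?_
  have := hle _ (star x).2
  change ‖(star (star (x : H →L[ℂ] H))) Ω‖ ≤ _ at this
  rwa [star_star] at this

/-- If `x Ω = 0`, then `x a Ω = x a' Ω = a' x Ω = 0` for every `a` with a partner `a'`. -/
theorem isFaithful_vectorState (hd : Dense (partnerVectors M Ω : Set H)) :
    (vectorState M Ω hΩ).IsFaithful := by
  intro x hx
  have h0 : (x : H →L[ℂ] H) Ω = 0 := by
    rw [NormalState.apply_star_mul_self, norm2_vectorState] at hx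
    have h1 : ‖(x : H →L[ℂ] H) Ω‖ ^ 2 = 0 := by exact_mod_cast hx
    exact norm_eq_zero.1 (pow_eq_zero_iff two_ne_zero |>.1 h1)
  refine Subtype.ext (DFunLike.coe_injective
    ((x : H →L[ℂ] H).continuous.ext_on hd continuous_const ?_))
  rintro _ ⟨a, ha, a', ha', rfl, h1, h2⟩
  have h3 := congrArg (fun T : H →L[ℂ] H => T Ω) (VonNeumannAlgebra.mem_commutant_iff.1 ha' _ x.2)
  simp only [mul_apply_eq_comp] at h3
  rw [h1, h3, h0, map_zero]
  rfl

end TraceVector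

/-! ### The tensor product of II₁ factors is a II₁ factor -/

section VNTensor

open HilbertTensor ElemTensor

variable {ι : Type*} {K : ι → Type*} [∀ i, NormedAddCommGroup (K i)]
  [∀ i, InnerProductSpace ℂ (K i)] [∀ i, CompleteSpace (K i)] {M : ∀ i, VonNeumannAlgebra (K i)}
  (τ : ∀ i, NormalState (M i))

/-- The left action of `a ∈ Mᵢ` on `⊗ᵢ L²(Mᵢ, τᵢ)`. -/
def siteLeft (i : ι) (a : (M i).toStarSubalgebra) : TensorSpace τ →L[ℂ] TensorSpace τ :=
  siteOp _ _ i (L2.leftMul (τ i) a)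

/-- The right action of `a ∈ Mᵢ` on `⊗ᵢ L²(Mᵢ, τᵢ)`. -/
def siteRight {τ : ∀ i, NormalState (M i)} (ht : ∀ i, (τ i).IsTracial) (i : ι)
    (a : (M i).toStarSubalgebra) : TensorSpace τ →L[ℂ] TensorSpace τ :=
  siteOp _ _ i (L2.rightOp (ht i) a)

/-- The unit vector `⊗ᵢ 1`. -/
def vacuum : TensorSpace τ := tprod _ _ (base _)

theorem norm_vacuum : ‖vacuum τ‖ = 1 := norm_tprod_base _ _

theorem tensorState_eq : tensorState τ = vectorState _ (vacuum τ) (norm_vacuum τ) := rfl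

theorem norm2_tensorState (x : (tensorAlgebra τ).toStarSubalgebra) :
    (tensorState τ).norm2 x = ‖(x : TensorSpace τ →L[ℂ] TensorSpace τ) (vacuum τ)‖ :=
  norm2_vectorState x

theorem star_siteLeft (i : ι) (a : (M i).toStarSubalgebra) :
    star (siteLeft τ i a) = siteLeft τ i (star a) := by
  unfold siteLeft
  rw [star_siteOp, ← L2.leftHom_apply, ← map_star, L2.leftHom_apply]

theorem siteLeft_mem (i : ι) (a : (M i).toStarSubalgebra) : siteLeft τ i a ∈ tensorAlgebra τ :=
  subset_vonNeumannClosure ⟨i, a, rfl⟩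

theorem siteLeft_tprod_of_eq {i : ι} (a : (M i).toStarSubalgebra)
    (y : ElemTensor fun i => L2.ofM (τ i) 1) (hy : y.1 i = L2.ofM (τ i) 1) :
    siteLeft τ i a (tprod _ _ y) = slice (fun i => L2.norm_ofM_one (τ i)) y i (L2.ofM (τ i) a) := by
  unfold siteLeft
  rw [siteOp_tprod, hy, L2.leftMul_ofM, mul_one]
  rfl

theorem siteLeft_vacuum (i : ι) (a : (M i).toStarSubalgebra) :
    siteLeft τ i a (vacuum τ) =
      slice (fun i => L2.norm_ofM_one (τ i)) (base _) i (L2.ofM (τ i) a) :=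
  siteLeft_tprod_of_eq τ a _ rfl

theorem norm_siteLeft_vacuum (i : ι) (a : (M i).toStarSubalgebra) :
    ‖siteLeft τ i a (vacuum τ)‖ = (τ i).norm2 a := by
  rw [siteLeft_vacuum, norm_slice_base, L2.norm_ofM]

theorem commute_siteLeft {i j : ι} (h : i ≠ j) (a : (M i).toStarSubalgebra)
    (b : (M j).toStarSubalgebra) :
    siteLeft τ i a * siteLeft τ j b = siteLeft τ j b * siteLeft τ i a := commute_siteOp h _ _

theorem mem_commutant_tensorAlgebra {y : TensorSpace τ →L[ℂ] TensorSpace τ} :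
    y ∈ (tensorAlgebra τ).commutant ↔
      ∀ (i : ι) (a : (M i).toStarSubalgebra), siteLeft τ i a * y = y * siteLeft τ i a := by
  unfold tensorAlgebra
  rw [mem_commutant_vonNeumannClosure]
  constructor
  · intro h i a
    exact (h _ ⟨i, a, rfl⟩).1
  · rintro h _ ⟨i, a, rfl⟩
    refine ⟨h i a, ?_⟩
    have := h i (star a)
    rw [← star_siteLeft] at this
    exact this

/-- A subspace that contains `⊗ᵢ 1` and is invariant under the left actions of the `Mᵢ` is dense. -/
theorem dense_of_invariant (D : Submodule ℂ (TensorSpace τ)) (h0 : vacuum τ ∈ D)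
    (h : ∀ (i : ι) (a : (M i).toStarSubalgebra), ∀ v ∈ D, siteLeft τ i a v ∈ D) :
    Dense (D : Set (TensorSpace τ)) := by
  have h1 : ∀ x, tprod _ _ x ∈ D.topologicalClosure := by
    intro x
    refine induction_on_support (P := fun x => tprod _ _ x ∈ D.topologicalClosure) x
      (D.le_topologicalClosure h0) fun y i v hy hPy => ?_
    have h2 : ∀ a : (M i).toStarSubalgebra, slice (fun i => L2.norm_ofM_one (τ i)) y i
        (L2.ofM (τ i) a) ∈ D.topologicalClosure := by
      intro a
      rw [← siteLeft_tprod_of_eq τ a y hy]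
      exact map_mem_closure (siteLeft τ i a).continuous hPy fun w hw => h i a w hw
    exact (L2.denseRange_ofM (τ i)).induction_on
      (p := fun v => slice (fun i => L2.norm_ofM_one (τ i)) y i v ∈ D.topologicalClosure) v
      (D.isClosed_topologicalClosure.preimage (slice _ y i).continuous) h2
  have h2 : Submodule.span ℂ (Set.range (tprod (fun i => L2.ofM (τ i) 1)
      (fun i => L2.norm_ofM_one (τ i)))) ≤ D.topologicalClosure := by
    rw [Submodule.span_le]
    rintro _ ⟨x, rfl⟩
    exact h1 x
  have h3 := (dense_span_tprod (fun i => L2.ofM (τ i) 1) (fun i => L2.norm_ofM_one (τ i))).mono h2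
  rw [Submodule.topologicalClosure_coe] at h3
  exact dense_closure.1 h3

variable {τ} (ht : ∀ i, (τ i).IsTracial)

theorem siteRight_mem_commutant (i : ι) (a : (M i).toStarSubalgebra) :
    siteRight ht i a ∈ (tensorAlgebra τ).commutant := by
  rw [mem_commutant_tensorAlgebra]
  intro j b
  unfold siteLeft siteRight
  by_cases h : j = i
  · subst h
    rw [← siteOp_mul, ← siteOp_mul, L2.leftMul_mul_rightOp]
  · exact commute_siteOp h _ _

theorem siteRight_vacuum (i : ι) (a : (M i).toStarSubalgebra) :
    siteRight ht i a (vacuum τ) = siteLeft τ i a (vacuum τ) := by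
  unfold siteRight siteLeft vacuum
  have h : (base fun i => L2.ofM (τ i) 1).1 i = L2.ofM (τ i) 1 := rfl
  rw [siteOp_tprod, siteOp_tprod, h, L2.rightOp_ofM, L2.leftMul_ofM, one_mul, mul_one]

theorem star_siteRight (i : ι) (a : (M i).toStarSubalgebra) :
    star (siteRight ht i a) = siteRight ht i (star a) := by
  unfold siteRight
  rw [star_siteOp, L2.star_rightOp]

include ht in
theorem dense_partnerVectors :
    Dense (partnerVectors (tensorAlgebra τ) (vacuum τ) : Set (TensorSpace τ)) := by
  refine dense_of_invariant τ _ ⟨1, one_mem _, 1, one_mem _, by simp, by simp, by simp⟩ ?_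
  intro i a v hv
  refine partnerVectors_invariant (siteLeft_mem τ i a) (siteRight_mem_commutant ht i a)
    (siteRight_vacuum ht i a).symm ?_ hv
  rw [star_siteLeft, star_siteRight, siteRight_vacuum]

include ht in
theorem isTracial_tensorState : (tensorState τ).IsTracial :=
  isTracial_vectorState (dense_partnerVectors ht)

include ht in
theorem isFaithful_tensorState : (tensorState τ).IsFaithful :=
  isFaithful_vectorState (dense_partnerVectors ht)

/-- A vector of `⊗ᵢ L²(Mᵢ, τᵢ)` that commutes with all `Mᵢ` is a multiple of `⊗ᵢ 1`: its slices
are vectors of `L²(Mᵢ, τᵢ)` that commute with `Mᵢ`, hence scalars. -/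
theorem eq_smul_vacuum_of_central (hM : ∀ i, IsIIOneFactor (τ i)) {ξ : TensorSpace τ}
    (hξ : ∀ i a, siteLeft τ i a ξ = siteRight (fun i => (hM i).tracial) i a ξ) :
    ξ = ⟪vacuum τ, ξ⟫_ℂ • vacuum τ := by
  refine eq_of_inner_total (dense_span_tprod _ _) fun x => ?_
  rw [inner_smul_right]
  refine induction_on_support (P := fun x => ⟪tprod _ _ x, ξ⟫_ℂ =
    ⟪vacuum τ, ξ⟫_ℂ * ⟪tprod _ _ x, vacuum τ⟫_ℂ) x ?_ fun y i v hy hPy => ?_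
  · change ⟪vacuum τ, ξ⟫_ℂ = ⟪vacuum τ, ξ⟫_ℂ * ⟪vacuum τ, vacuum τ⟫_ℂ
    rw [inner_self_eq_norm_sq_to_K, norm_vacuum]
    simp
  · have he : ∀ i, ‖L2.ofM (τ i) 1‖ = 1 := fun i => L2.norm_ofM_one (τ i)
    have hy' : setAt y i (L2.ofM (τ i) 1) = y := by rw [← hy, setAt_self]
    set η := ContinuousLinearMap.adjoint (slice he y i) ξ with hη
    have hcen : ∀ a, L2.leftMul (τ i) a η = L2.rightOp (hM i).tracial a η := by
      intro a
      have h1 := hξ i a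
      unfold siteLeft siteRight at h1
      have h2 := congrArg (ContinuousLinearMap.adjoint (slice he y i)) h1
      exact (adjoint_slice_siteOp (E := fun i => L2 (τ i)) (he := he) y i _ ξ).symm.trans
        (h2.trans (adjoint_slice_siteOp (E := fun i => L2 (τ i)) (he := he) y i _ ξ))
    have h1 : ∀ v, ⟪η, v⟫_ℂ = ⟪L2.ofM (τ i) 1, v⟫_ℂ * ⟪η, L2.ofM (τ i) 1⟫_ℂ := by
      intro v
      refine (L2.denseRange_ofM (τ i)).induction_on v
        (isClosed_eq (by fun_prop) (by fun_prop)) fun a => ?_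
      rw [(hM i).inner_eq_of_central hcen, L2.inner_ofM, star_one, one_mul]
    have h2 : ∀ v, ⟪slice he y i v, ξ⟫_ℂ = ⟪v, L2.ofM (τ i) 1⟫_ℂ * ⟪tprod _ _ y, ξ⟫_ℂ := by
      intro v
      have h3 : ⟪tprod _ _ y, ξ⟫_ℂ = ⟪L2.ofM (τ i) 1, η⟫_ℂ := by
        rw [hη, ContinuousLinearMap.adjoint_inner_right, slice_apply, hy']
      rw [← ContinuousLinearMap.adjoint_inner_right, ← hη, h3, ← inner_conj_symm v η, h1, map_mul,
        inner_conj_symm, inner_conj_symm]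
    have h3 := h2 v
    rw [slice_apply] at h3
    rw [h3, hPy, vacuum, inner_tprod, inner_tprod, kernel_setAt_left he]
    have h4 : (base fun i => L2.ofM (τ i) 1).1 i = L2.ofM (τ i) 1 := rfl
    have h5 : setAt (base fun i => L2.ofM (τ i) 1) i (L2.ofM (τ i) 1) = base _ :=
      setAt_self (base fun i => L2.ofM (τ i) 1) i
    rw [h4, h5, hy']
    ring

/-- The centre of `⊗ᵢ Mᵢ` is trivial. -/
theorem center_tensorAlgebra (hM : ∀ i, IsIIOneFactor (τ i))
    {z : TensorSpace τ →L[ℂ] TensorSpace τ} (hz : z ∈ tensorAlgebra τ)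
    (hz' : z ∈ (tensorAlgebra τ).commutant) :
    ∃ c : ℂ, z = c • (1 : TensorSpace τ →L[ℂ] TensorSpace τ) := by
  set ht : ∀ i, (τ i).IsTracial := fun i => (hM i).tracial
  have h1 : z (vacuum τ) = ⟪vacuum τ, z (vacuum τ)⟫_ℂ • vacuum τ := by
    refine eq_smul_vacuum_of_central hM fun i a => ?_
    have h2 := congrArg (fun T : TensorSpace τ →L[ℂ] TensorSpace τ => T (vacuum τ))
      (VonNeumannAlgebra.mem_commutant_iff.1 hz' _ (siteLeft_mem τ i a))
    have h3 := congrArg (fun T : TensorSpace τ →L[ℂ] TensorSpace τ => T (vacuum τ))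
      (VonNeumannAlgebra.mem_commutant_iff.1 (siteRight_mem_commutant ht i a) _ hz)
    simp only [mul_apply_eq_comp] at h2 h3
    rw [h2, ← siteRight_vacuum ht, h3]
  set c := ⟪vacuum τ, z (vacuum τ)⟫_ℂ with hc
  refine ⟨c, ?_⟩
  have h2 : (⟨z, hz⟩ - c • 1 : (tensorAlgebra τ).toStarSubalgebra) = 0 := by
    refine (isFaithful_tensorState ht).eq_zero ?_
    rw [norm2_tensorState, norm_eq_zero]
    change z (vacuum τ) - c • vacuum τ = 0
    rw [← h1, sub_self]
  have h3 := congrArg (fun x : (tensorAlgebra τ).toStarSubalgebra =>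
    (x : TensorSpace τ →L[ℂ] TensorSpace τ)) h2
  exact sub_eq_zero.1 h3

/-- An algebra on `⊗ᵢ L²(Mᵢ, τᵢ)` that contains one of the II₁ factors `Mᵢ` is
infinite-dimensional. -/
theorem not_finiteDimensional_of_siteLeft_mem {i : ι} (hM : IsIIOneFactor (τ i))
    (A : VonNeumannAlgebra (TensorSpace τ)) (hA : ∀ a, siteLeft τ i a ∈ A) :
    ¬ FiniteDimensional ℂ A.toStarSubalgebra := by
  intro hfin
  let ev : A.toStarSubalgebra →ₗ[ℂ] TensorSpace τ :=
    { toFun := fun x => (x : TensorSpace τ →L[ℂ] TensorSpace τ) (vacuum τ)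
      map_add' := fun x y => rfl
      map_smul' := fun c x => rfl }
  let f : (M i).toStarSubalgebra →ₗ[ℂ] TensorSpace τ :=
    (slice (fun i => L2.norm_ofM_one (τ i)) (base _) i).toLinearMap ∘ₗ L2.ofMₗ (τ i)
  have hf : ∀ a, f a ∈ LinearMap.range ev := fun a =>
    ⟨⟨siteLeft τ i a, hA a⟩, siteLeft_vacuum τ i a⟩
  refine hM.infinite (FiniteDimensional.of_injective (f.codRestrict (LinearMap.range ev) hf) ?_)
  rw [← LinearMap.ker_eq_bot, LinearMap.ker_eq_bot']
  intro a ha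
  refine hM.faithful.eq_zero ?_
  rw [← norm_siteLeft_vacuum, siteLeft_vacuum, norm_eq_zero]
  exact congrArg Subtype.val ha

theorem isIIOneFactor_tensorState [Nonempty ι] (hM : ∀ i, IsIIOneFactor (τ i)) :
    IsIIOneFactor (tensorState τ) where
  tracial := isTracial_tensorState fun i => (hM i).tracial
  faithful := isFaithful_tensorState fun i => (hM i).tracial
  center z hz := by
    obtain ⟨c, hc⟩ := center_tensorAlgebra hM z.2 (VonNeumannAlgebra.mem_commutant_iff.2
      fun g hg => (congrArg Subtype.val (hz ⟨g, hg⟩)).symm)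
    exact ⟨c, Subtype.ext hc⟩
  infinite := not_finiteDimensional_of_siteLeft_mem (hM (Classical.arbitrary ι)) _
    fun a => siteLeft_mem τ _ a

end VNTensor

/-! ### Spectral gap for an algebra with a cyclic trace vector -/

section SpectralGap

variable {H : Type*} [NormedAddCommGroup H] [InnerProductSpace ℂ H] [CompleteSpace H]
  {A : VonNeumannAlgebra H} {Ω : H} {hΩ : ‖Ω‖ = 1}

theorem dense_span_orbit (hd : Dense (partnerVectors A Ω : Set H)) :
    Dense (Submodule.span ℂ
      (Set.range fun x : A.toStarSubalgebra => (x : H →L[ℂ] H) Ω) : Set H) := by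
  refine hd.mono ?_
  rintro _ ⟨a, ha, _, _, rfl, _⟩
  exact Submodule.subset_span ⟨⟨a, ha⟩, rfl⟩

/-- `L²(A, τ)` is the Hilbert space on which `A` acts, if `τ` is the vector state of a cyclic
vector `Ω`; the isomorphism `U` maps `x` to `x Ω`, and `V` is its inverse. -/
theorem exists_standardForm (hd : Dense (partnerVectors A Ω : Set H)) :
    ∃ (U : L2 (vectorState A Ω hΩ) →L[ℂ] H) (V : H →L[ℂ] L2 (vectorState A Ω hΩ)),
      (∀ x, U (L2.ofM _ x) = (x : H →L[ℂ] H) Ω) ∧ (∀ ξ, ‖U ξ‖ = ‖ξ‖) ∧ (∀ ξ, ‖V ξ‖ = ‖ξ‖) ∧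
      (∀ ξ, V (U ξ) = ξ) ∧ ∀ ξ, U (V ξ) = ξ := by
  have hd0 : Dense (Submodule.span ℂ (Set.range (L2.ofM (vectorState A Ω hΩ))) :
      Set (L2 (vectorState A Ω hΩ))) :=
    (L2.denseRange_ofM _).mono Submodule.subset_span
  have hinner : ∀ x y : A.toStarSubalgebra, ⟪(x : H →L[ℂ] H) Ω, (y : H →L[ℂ] H) Ω⟫_ℂ =
      ⟪L2.ofM (vectorState A Ω hΩ) x, L2.ofM (vectorState A Ω hΩ) y⟫_ℂ * 1 := by
    intro x y
    rw [mul_one, L2.inner_ofM, vectorState_apply]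
    change _ = ⟪Ω, (star (x : H →L[ℂ] H) * (y : H →L[ℂ] H)) Ω⟫_ℂ
    rw [ContinuousLinearMap.star_eq_adjoint, mul_apply_eq_comp,
      ContinuousLinearMap.adjoint_inner_right]
  obtain ⟨U, hU⟩ := exists_clm_of_inner hd0 (fun x : A.toStarSubalgebra => (x : H →L[ℂ] H) Ω) 1
    hinner
  have hUU : ∀ v w, ⟪U v, U w⟫_ℂ = ⟪v, w⟫_ℂ := by
    intro v w
    rw [inner_clm_total hd0 (S := U) (T := U) (γ := 1) _ v w, mul_one]
    intro x y
    rw [hU, hU, hinner]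
  have hUn : ∀ v, ‖U v‖ = ‖v‖ := fun v => by
    rw [@norm_eq_sqrt_re_inner ℂ, @norm_eq_sqrt_re_inner ℂ, hUU]
  set V := ContinuousLinearMap.adjoint U with hV
  have hVU : ∀ v, V (U v) = v := fun v => ext_inner_left ℂ fun w => by
    rw [hV, ContinuousLinearMap.adjoint_inner_right, hUU]
  have hUV : U ∘L V = ContinuousLinearMap.id ℂ H := by
    refine clm_ext_total (dense_span_orbit hd) fun x => ?_
    rw [ContinuousLinearMap.comp_apply, ← hU, hVU]
    rfl
  have hUV' : ∀ v, U (V v) = v := fun v => congrArg (fun T : H →L[ℂ] H => T v) hUV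
  exact ⟨U, V, hU, hUn, fun ξ => by rw [← hUn, hUV'], hVU, hUV'⟩

/-- On the range of the projection onto the closure of the centre, the left and the right actions
agree. -/
theorem leftMul_starProjection {τ : NormalState A} (ht : τ.IsTracial) (x : A.toStarSubalgebra)
    (ξ : L2 τ) :
    L2.leftMul τ x ((relCommutantL2 A τ).starProjection ξ) =
      L2.rightOp ht x ((relCommutantL2 A τ).starProjection ξ) := by
  have h1 : relCommutantL2 A τ ≤
      LinearMap.eqLocus (L2.leftMul τ x).toLinearMap (L2.rightOp ht x).toLinearMap := by
    refine Submodule.topologicalClosure_minimal _ ?_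
      (isClosed_eq (L2.leftMul τ x).continuous (L2.rightOp ht x).continuous)
    rw [Submodule.span_le]
    rintro _ ⟨z, hz, rfl⟩
    change L2.leftMul τ x (L2.ofM τ z) = L2.rightOp ht x (L2.ofM τ z)
    rw [L2.leftMul_ofM, L2.rightOp_ofM]
    exact congrArg _ (Subtype.ext (VonNeumannAlgebra.mem_commutant_iff.1 hz _ x.2))
  exact h1 (Submodule.starProjection_apply_mem _ _)

/-- A spectral gap number for `A ⊆ A`, expressed on the Hilbert space on which `A` acts with a cyclic
trace vector. The operator `R x` is the right multiplication by `x`. -/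
theorem IsSpectralGapNumber.exists_operators {C : ℝ} (hd : Dense (partnerVectors A Ω : Set H))
    (hC : IsSpectralGapNumber A (vectorState A Ω hΩ) C) :
    ∃ (F : Finset A.toStarSubalgebra) (R : A.toStarSubalgebra → H →L[ℂ] H) (P : H →L[ℂ] H),
      (∀ x ∈ F, ‖x‖ ≤ 1) ∧ (F.card : ℝ) ≤ C ∧
      (∀ x, R x ∈ A.commutant ∧ R x Ω = (x : H →L[ℂ] H) Ω ∧ ‖R x‖ ≤ ‖x‖ ∧
        (x : H →L[ℂ] H) * P = R x * P) ∧
      ∀ ξ, ‖(1 - P) ξ‖ ^ 2 ≤ C * ∑ x ∈ F, ‖((x : H →L[ℂ] H) - R x) ξ‖ ^ 2 := by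
  obtain ⟨-, F, hF, hcard, hgap⟩ := hC
  have ht : (vectorState A Ω hΩ).IsTracial := isTracial_vectorState hd
  obtain ⟨U, V, hU, hUn, hVn, hVU, hUV⟩ := exists_standardForm (hΩ := hΩ) hd
  set Q := (relCommutantL2 A (vectorState A Ω hΩ)).starProjection with hQ
  have hR : ∀ x z : A.toStarSubalgebra, U (L2.rightOp ht x (V ((z : H →L[ℂ] H) Ω))) =
      (z : H →L[ℂ] H) ((x : H →L[ℂ] H) Ω) := by
    intro x z
    rw [← hU, hVU, L2.rightOp_ofM, hU]
    rfl
  have hL : ∀ (x : A.toStarSubalgebra) ξ, U (L2.leftMul _ x ξ) = (x : H →L[ℂ] H) (U ξ) := by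
    intro x ξ
    have h1 : U ∘L L2.leftMul _ x = (x : H →L[ℂ] H) ∘L U := by
      refine L2.clm_ext _ fun z => ?_
      rw [ContinuousLinearMap.comp_apply, ContinuousLinearMap.comp_apply, L2.leftMul_ofM, hU, hU]
      rfl
    exact congrArg (fun T : L2 (vectorState A Ω hΩ) →L[ℂ] H => T ξ) h1
  refine ⟨F, fun x => U ∘L L2.rightOp ht x ∘L V, U ∘L Q ∘L V, fun x hx => (hF x hx).1, hcard,
    fun x => ⟨?_, ?_, ?_, ?_⟩, fun ξ => ?_⟩
  · rw [VonNeumannAlgebra.mem_commutant_iff]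
    intro y hy
    refine clm_ext_total (dense_span_orbit hd) fun z => ?_
    simp only [mul_apply_eq_comp, ContinuousLinearMap.comp_apply]
    rw [hR, ← mul_apply_eq_comp y (z : H →L[ℂ] H)]
    exact (hR x (⟨y, hy⟩ * z)).symm
  · exact hR x 1
  · refine ContinuousLinearMap.opNorm_le_bound _ (norm_nonneg _) fun ξ => ?_
    rw [ContinuousLinearMap.comp_apply, ContinuousLinearMap.comp_apply, hUn, ← hVn ξ]
    exact ((L2.rightOp ht x).le_opNorm _).trans
      (mul_le_mul_of_nonneg_right (L2.norm_rightOp_le ht x) (norm_nonneg _))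
  · ext ξ
    simp only [mul_apply_eq_comp, ContinuousLinearMap.comp_apply]
    rw [← hL, hVU, leftMul_starProjection ht]
  · have h1 : (1 - U ∘L Q ∘L V) ξ = U (V ξ - Q (V ξ)) := by
      rw [map_sub, hUV]
      rfl
    have h2 : ∀ x : A.toStarSubalgebra, ((x : H →L[ℂ] H) - U ∘L L2.rightOp ht x ∘L V) ξ =
        U (L2.leftMul _ x (V ξ) - L2.rightMul _ x (V ξ)) := by
      intro x
      rw [map_sub, hL, hUV]
      rfl
    simp only [h1, h2, hUn]
    exact hgap (V ξ)

end SpectralGap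

/-! ### Averaging over the unitary group of an amplified algebra -/

section Averaging

variable {H H₀ : Type*} [NormedAddCommGroup H] [InnerProductSpace ℂ H] [CompleteSpace H]
  [NormedAddCommGroup H₀] [InnerProductSpace ℂ H₀] [CompleteSpace H₀]
  {A : VonNeumannAlgebra H₀} {N : VonNeumannAlgebra H} {Ω : H} {hΩ : ‖Ω‖ = 1}

/-- If the vectors in the range of `P` are fixed by the conjugations `ξ ↦ x ξ x*`, then the average
of `p` over these conjugations is close to `p` when `P p Ω` is. -/
theorem exists_average_near (ht : (vectorState N Ω hΩ).IsTracial)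
    (hf : (vectorState N Ω hΩ).IsFaithful) (φ : A.toStarSubalgebra →⋆ₐ[ℂ] N.toStarSubalgebra)
    (R : A.toStarSubalgebra → H →L[ℂ] H) (P : H →L[ℂ] H)
    (hR : ∀ x, R x ∈ N.commutant ∧ R x Ω = (φ x : H →L[ℂ] H) Ω ∧ ‖R x‖ ≤ ‖x‖ ∧
      (φ x : H →L[ℂ] H) * P = R x * P)
    {p : N.toStarSubalgebra} (hp : IsSelfAdjoint p) :
    ∃ b : N.toStarSubalgebra, IsSelfAdjoint b ∧ ‖b‖ ≤ ‖p‖ ∧ (∀ x, φ x * b = b * φ x) ∧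
      (vectorState N Ω hΩ).norm2 (b - p) ≤ 2 * ‖(1 - P) ((p : H →L[ℂ] H) Ω)‖ := by
  set τ := vectorState N Ω hΩ with hτ
  set G : Submonoid N.toStarSubalgebra :=
    (unitary A.toStarSubalgebra).map (φ : A.toStarSubalgebra →* N.toStarSubalgebra) with hG
  have hGmem : ∀ u ∈ G, ∃ x ∈ unitary A.toStarSubalgebra, φ x = u := fun u hu => hu
  obtain ⟨b, hbn, hbG, hb⟩ := NormalState.exists_average ht hf G (by
    rintro u hu
    obtain ⟨x, hx, rfl⟩ := hGmem u hu
    exact Unitary.map_mem φ hx) p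
  set η : H := P ((p : H →L[ℂ] H) Ω) with hη
  set d : ℝ := ‖(1 - P) ((p : H →L[ℂ] H) Ω)‖ with hd
  have hd' : d = ‖(p : H →L[ℂ] H) Ω - η‖ := rfl
  have hsa : ∀ y ∈ convexHull ℝ {z | ∃ u ∈ G, z = u * p * star u}, IsSelfAdjoint y := by
    have h1 : convexHull ℝ {z | ∃ u ∈ G, z = u * p * star u} ⊆
        (selfAdjoint.submodule ℝ N.toStarSubalgebra : Set N.toStarSubalgebra) := by
      refine convexHull_min ?_ (Submodule.convex _)
      rintro _ ⟨u, -, rfl⟩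
      exact hp.conjugate u
    exact fun y hy => h1 hy
  have hcomm : ∀ x (y : N.toStarSubalgebra) v,
      (y : H →L[ℂ] H) (R x v) = R x ((y : H →L[ℂ] H) v) := fun x y v =>
    congrArg (fun T : H →L[ℂ] H => T v) (VonNeumannAlgebra.mem_commutant_iff.1 (hR x).1 _ y.2)
  have hRη : ∀ x, (φ x : H →L[ℂ] H) η = R x η := fun x =>
    congrArg (fun T : H →L[ℂ] H => T ((p : H →L[ℂ] H) Ω)) (hR x).2.2.2
  have hnear : ∀ y ∈ convexHull ℝ {z | ∃ u ∈ G, z = u * p * star u},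
      ‖(y : H →L[ℂ] H) Ω - η‖ ≤ d := by
    let ev : N.toStarSubalgebra →ₗ[ℝ] H :=
      { toFun := fun y => (y : H →L[ℂ] H) Ω
        map_add' := fun _ _ => rfl
        map_smul' := fun _ _ => rfl }
    have h1 : convexHull ℝ {z | ∃ u ∈ G, z = u * p * star u} ⊆ ev ⁻¹' Metric.closedBall η d := by
      refine convexHull_min ?_ ((convex_closedBall _ _).linear_preimage ev)
      rintro _ ⟨u, hu, rfl⟩
      obtain ⟨x, hx, rfl⟩ := hGmem u hu
      rw [Set.mem_preimage, mem_closedBall_iff_norm]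
      -- conjugation by `x` is the left action of `x` followed by the right action of `x*`
      have h2 : ev (φ x * p * star (φ x)) = R (star x) ((φ x : H →L[ℂ] H) ((p : H →L[ℂ] H) Ω)) := by
        rw [← map_star]
        change (φ x : H →L[ℂ] H) ((p : H →L[ℂ] H) ((φ (star x) : H →L[ℂ] H) Ω)) = _
        rw [← (hR (star x)).2.1, hcomm, hcomm]
      have h3 : η = R (star x) ((φ x : H →L[ℂ] H) η) := by
        rw [← hcomm, ← hRη, ← mul_apply_eq_comp]
        change η = ((φ x * φ (star x) : N.toStarSubalgebra) : H →L[ℂ] H) η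
        rw [← map_mul, Unitary.mul_star_self_of_mem hx, map_one]
        rfl
      have hx1 : ‖R (star x)‖ ≤ 1 :=
        (hR (star x)).2.2.1.trans (NormalState.unitary_norm_le _ (Unitary.star_mem hx))
      have hx2 : ‖(φ x : H →L[ℂ] H)‖ ≤ 1 := NormalState.unitary_norm_le _ (Unitary.map_mem φ hx)
      rw [h2, hd']
      nth_rw 1 [h3]
      rw [← map_sub, ← map_sub]
      exact ((R (star x)).le_of_opNorm_le hx1 _).trans
        (by rw [one_mul]; exact ((φ x : H →L[ℂ] H).le_of_opNorm_le hx2 _).trans (one_mul _).le)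
    intro y hy
    have h2 := h1 hy
    rwa [Set.mem_preimage, mem_closedBall_iff_norm] at h2
  refine ⟨b, ?_, hbn, fun x => ?_, ?_⟩
  · refine hf.eq_of_norm2_sub_le fun ε hε => ?_
    obtain ⟨y, hy, hyb⟩ := hb (ε / 2) (by linarith)
    have h1 : τ.norm2 (star b - y) < ε / 2 := by
      rw [← (hsa y hy).star_eq, ← star_sub, ht.norm2_star, τ.norm2_sub_comm]
      exact hyb
    have h2 := τ.norm2_sub_le_add (star b) y b
    linarith
  · refine Submodule.span_induction (p := fun x _ => φ x * b = b * φ x)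
      (fun u hu => hbG _ ⟨u, hu, rfl⟩) (by simp) ?_ ?_ (VonNeumannAlgebra.mem_span_unitary x)
    · intro x y _ _ hx hy
      rw [map_add, add_mul, mul_add, hx, hy]
    · intro c x _ hx
      rw [map_smul, smul_mul_assoc, mul_smul_comm, hx]
  · refine le_of_forall_pos_le_add fun ε hε => ?_
    obtain ⟨y, hy, hyb⟩ := hb ε hε
    have h1 : τ.norm2 (y - p) ≤ 2 * d := by
      rw [norm2_vectorState]
      change ‖(y : H →L[ℂ] H) Ω - (p : H →L[ℂ] H) Ω‖ ≤ _
      have h2 := norm_sub_le_norm_sub_add_norm_sub ((y : H →L[ℂ] H) Ω) η ((p : H →L[ℂ] H) Ω)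
      have h3 := hnear y hy
      rw [norm_sub_rev η, ← hd'] at h2
      linarith
    have h2 := τ.norm2_sub_le_add b y p
    rw [τ.norm2_sub_comm b y] at h2
    linarith

end Averaging

/-! ### Spectral gap of a tensor factor -/

section TensorFactor

variable {H H₀ 𝒯 : Type*} [NormedAddCommGroup H] [InnerProductSpace ℂ H] [CompleteSpace H]
  [NormedAddCommGroup H₀] [InnerProductSpace ℂ H₀] [CompleteSpace H₀]
  {V : 𝒯 → H₀ →L[ℂ] H} {Γ : 𝒯 → 𝒯 → ℂ}

namespace IsTensorFamily

theorem amp_eq_of_apply (hV : IsTensorFamily V Γ) {g : H →L[ℂ] H} {g₀ : H₀ →L[ℂ] H₀}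
    (h : ∀ t v, g (V t v) = V t (g₀ v)) : hV.amp g₀ = g :=
  hV.clm_ext fun t v => by rw [hV.amp_apply, h]

/-- An operator on the first tensor factor that commutes with `S₀` commutes, once amplified, with
operators that act on the first factor like elements of `S₀`, or only on the second factor. -/
theorem commute_amp (hV : IsTensorFamily V Γ) {S₀ : Set (H₀ →L[ℂ] H₀)} {g : H →L[ℂ] H}
    (hg : (∃ g₀ ∈ S₀, ∀ t v, g (V t v) = V t (g₀ v)) ∨ ∃ σ : 𝒯 → 𝒯, ∀ t v, g (V t v) = V (σ t) v)
    {R : H₀ →L[ℂ] H₀} (hR : ∀ g₀ ∈ S₀, g₀ * R = R * g₀) : g * hV.amp R = hV.amp R * g := by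
  rcases hg with ⟨g₀, hg₀, h⟩ | ⟨σ, h⟩
  · rw [← hV.amp_eq_of_apply h, ← map_mul, ← map_mul, hR g₀ hg₀]
  · refine hV.clm_ext fun t v => ?_
    rw [mul_apply_eq_comp, mul_apply_eq_comp, hV.amp_apply, h, h, hV.amp_apply]

/-- The compressions of `y` to the first tensor factor commute with `g₀` if `y` commutes with the
amplification of `g₀`. -/
theorem commute_adjoint_comp (hV : IsTensorFamily V Γ) {y : H →L[ℂ] H} {g₀ : H₀ →L[ℂ] H₀}
    (hy : hV.amp g₀ * y = y * hV.amp g₀) (s t : 𝒯) :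
    g₀ * (ContinuousLinearMap.adjoint (V s) ∘L y ∘L V t) =
      (ContinuousLinearMap.adjoint (V s) ∘L y ∘L V t) * g₀ := by
  ext v
  refine ext_inner_left ℂ fun w => ?_
  have h1 : ⟪w, g₀ (ContinuousLinearMap.adjoint (V s) (y (V t v)))⟫_ℂ =
      ⟪V s (ContinuousLinearMap.adjoint g₀ w), y (V t v)⟫_ℂ := by
    rw [← ContinuousLinearMap.adjoint_inner_left, ContinuousLinearMap.adjoint_inner_right]
  have h2 : V s (ContinuousLinearMap.adjoint g₀ w) =
      ContinuousLinearMap.adjoint (hV.amp g₀) (V s w) := by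
    rw [← ContinuousLinearMap.star_eq_adjoint, ← ContinuousLinearMap.star_eq_adjoint, ← map_star,
      hV.amp_apply]
  have h3 := congrArg (fun T : H →L[ℂ] H => T (V t v)) hy
  simp only [mul_apply_eq_comp, ContinuousLinearMap.comp_apply] at h3 ⊢
  rw [h1, h2, ContinuousLinearMap.adjoint_inner_left, h3, hV.amp_apply,
    ContinuousLinearMap.adjoint_inner_right]

/-- The amplification of `x` commutes with `y` if `x` commutes with the compressions of `y`. -/
theorem commute_amp_of_commute_compression (hV : IsTensorFamily V Γ) {y : H →L[ℂ] H}
    {x : H₀ →L[ℂ] H₀} (h : ∀ s t, x * (ContinuousLinearMap.adjoint (V s) ∘L y ∘L V t) =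
      (ContinuousLinearMap.adjoint (V s) ∘L y ∘L V t) * x) :
    y * hV.amp x = hV.amp x * y := by
  refine hV.clm_ext fun t v => ?_
  refine eq_of_inner_total hV.dense fun p => ?_
  obtain ⟨s, w⟩ := p
  have h1 := congrArg (fun T : H₀ →L[ℂ] H₀ => T v) (h s t)
  have h2 : hV.amp x = ContinuousLinearMap.adjoint (hV.amp (star x)) := by
    rw [← ContinuousLinearMap.star_eq_adjoint, ← map_star, star_star]
  simp only [mul_apply_eq_comp, ContinuousLinearMap.comp_apply] at h1
  rw [mul_apply_eq_comp, mul_apply_eq_comp, hV.amp_apply]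
  change ⟪V s w, y (V t (x v))⟫_ℂ = ⟪V s w, _⟫_ℂ
  rw [← ContinuousLinearMap.adjoint_inner_right, ← h1, h2, ContinuousLinearMap.adjoint_inner_right,
    hV.amp_apply, ContinuousLinearMap.star_eq_adjoint,
    ← ContinuousLinearMap.adjoint_inner_right (V s), ContinuousLinearMap.adjoint_inner_left]

variable {A : VonNeumannAlgebra H₀} {N : VonNeumannAlgebra H} {Ω₀ : H₀} {hΩ₀ : ‖Ω₀‖ = 1} {Ω : H}
  {hΩ : ‖Ω‖ = 1}

/-- Spectral gap of a tensor factor `A` of `N`: a self-adjoint element of `N` that almost commutes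
with a suitable finite set is close to the commutant of `A`. -/
theorem exists_near_commutant (hV : IsTensorFamily V Γ)
    (hA : ∀ x ∈ A, hV.amp x ∈ N) (hA' : ∀ R ∈ A.commutant, hV.amp R ∈ N.commutant)
    {t₀ : 𝒯} (ht₀ : V t₀ Ω₀ = Ω) (hd₀ : Dense (partnerVectors A Ω₀ : Set H₀))
    (hd : Dense (partnerVectors N Ω : Set H)) {C : ℝ}
    (hC : IsSpectralGapNumber A (vectorState A Ω₀ hΩ₀) C) :
    ∃ G : Finset N.toStarSubalgebra, (∀ x ∈ G, ‖x‖ ≤ 1) ∧ (G.card : ℝ) ≤ C ∧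
      ∀ δ : ℝ, 0 ≤ δ → ∀ p : N.toStarSubalgebra, IsSelfAdjoint p →
      (∀ x ∈ G, (vectorState N Ω hΩ).norm2 (x * p - p * x) ≤ δ) →
      ∃ b : N.toStarSubalgebra, IsSelfAdjoint b ∧ ‖b‖ ≤ ‖p‖ ∧
        (∀ x ∈ A, hV.amp x * (b : H →L[ℂ] H) = b * hV.amp x) ∧
        (vectorState N Ω hΩ).norm2 (b - p) ≤ 2 * (C * δ) := by
  classical
  have hC0 := hC.1
  obtain ⟨F, R, P, hF, hcard, hR, hgap⟩ := hC.exists_operators hd₀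
  let φ : A.toStarSubalgebra →⋆ₐ[ℂ] N.toStarSubalgebra :=
    StarAlgHom.codRestrict (hV.amp.comp A.toStarSubalgebra.subtype) N.toStarSubalgebra
      fun x => hA _ x.2
  have hφ : ∀ x : A.toStarSubalgebra, (φ x : H →L[ℂ] H) = hV.amp x := fun x => rfl
  have hampΩ : ∀ T, hV.amp T Ω = V t₀ (T Ω₀) := fun T => by rw [← ht₀, hV.amp_apply]
  have hR' : ∀ x, hV.amp (R x) ∈ N.commutant ∧ hV.amp (R x) Ω = (φ x : H →L[ℂ] H) Ω ∧
      ‖hV.amp (R x)‖ ≤ ‖x‖ ∧ (φ x : H →L[ℂ] H) * hV.amp P = hV.amp (R x) * hV.amp P := by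
    intro x
    obtain ⟨h1, h2, h3, h4⟩ := hR x
    refine ⟨hA' _ h1, ?_, (hV.norm_amp_le _).trans h3, ?_⟩
    · rw [hφ, hampΩ, hampΩ, h2]
    · rw [hφ, ← map_mul, ← map_mul, h4]
  refine ⟨F.image φ, ?_, le_trans (by exact_mod_cast Finset.card_image_le) hcard, ?_⟩
  · intro y hy
    obtain ⟨x, hx, rfl⟩ := Finset.mem_image.1 hy
    exact (hV.norm_amp_le _).trans (hF x hx)
  intro δ hδ p hp hpG
  obtain ⟨b, hb, hbn, hbc, hbp⟩ := exists_average_near (hΩ := hΩ) (isTracial_vectorState hd)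
    (isFaithful_vectorState hd) φ (fun x => hV.amp (R x)) (hV.amp P) hR' hp
  refine ⟨b, hb, hbn, fun x hx => congrArg Subtype.val (hbc ⟨x, hx⟩),
    hbp.trans (mul_le_mul_of_nonneg_left ?_ zero_le_two)⟩
  have h1 := hV.norm_amp_sq_le F (1 - P) (fun x => (x : H₀ →L[ℂ] H₀) - R x) C hgap
    ((p : H →L[ℂ] H) Ω)
  have h2 : ∀ x ∈ F, ‖hV.amp ((x : H₀ →L[ℂ] H₀) - R x) ((p : H →L[ℂ] H) Ω)‖ ^ 2 ≤ δ ^ 2 := by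
    intro x hx
    have h3 := hpG _ (Finset.mem_image_of_mem φ hx)
    rw [norm2_vectorState] at h3
    have h4 : hV.amp ((x : H₀ →L[ℂ] H₀) - R x) ((p : H →L[ℂ] H) Ω) =
        ((φ x * p - p * φ x : N.toStarSubalgebra) : H →L[ℂ] H) Ω := by
      have h5 := congrArg (fun T : H →L[ℂ] H => T Ω)
        (VonNeumannAlgebra.mem_commutant_iff.1 (hR' x).1 _ p.2)
      simp only [mul_apply_eq_comp] at h5
      rw [(hR' x).2.1] at h5
      rw [map_sub, sub_apply, ← h5]
      rfl
    rw [h4]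
    exact pow_le_pow_left₀ (norm_nonneg _) h3 2
  have h3 : ‖hV.amp (1 - P) ((p : H →L[ℂ] H) Ω)‖ ^ 2 ≤ (C * δ) ^ 2 :=
    calc _ ≤ C * ∑ x ∈ F, δ ^ 2 :=
          h1.trans (mul_le_mul_of_nonneg_left (Finset.sum_le_sum h2) hC0.le)
      _ = C * (F.card * δ ^ 2) := by rw [Finset.sum_const, nsmul_eq_mul]
      _ ≤ C * (C * δ ^ 2) := by gcongr
      _ = (C * δ) ^ 2 := by ring
  rw [map_sub, map_one] at h3
  exact abs_le_of_sq_le_sq' h3 (by positivity) |>.2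

end IsTensorFamily

end TensorFactor

/-! ### Spectral gap of the finite partial tensor products -/

section FinitePart

open HilbertTensor ElemTensor

variable {K : ℕ → Type*} [∀ k, NormedAddCommGroup (K k)] [∀ k, InnerProductSpace ℂ (K k)]
  [∀ k, CompleteSpace (K k)] {M : ∀ k, VonNeumannAlgebra (K k)} (τ : ∀ k, NormalState (M k))

/-- The operator `x ↦ x ⊗ t'` from the tensor product of the first `n` factors, where `t'` consists
of the entries of `t` from the `n`-th on. -/
def glueTail (n : ℕ) (t : ElemTensor fun k => L2.ofM (τ k) 1) :
    TensorSpace (fun j : Fin n => τ j) →L[ℂ] TensorSpace τ :=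
  glueOp (fun k => L2.norm_ofM_one (τ k)) n t

theorem exists_isTensorFamily_glueTail (n : ℕ) : ∃ Γ, IsTensorFamily (glueTail τ n) Γ :=
  ⟨_, isTensorFamily_glueOp (fun k => L2.norm_ofM_one (τ k)) n⟩

theorem glueTail_base_vacuum (n : ℕ) :
    glueTail τ n (base _) (vacuum fun j : Fin n => τ j) = vacuum τ := by
  unfold glueTail vacuum
  rw [glueOp_tprod]
  exact congrArg _ glue_base

theorem siteLeft_glueTail_of_lt {n : ℕ} (t : ElemTensor fun k => L2.ofM (τ k) 1) (i : Fin n)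
    (a : (M i).toStarSubalgebra) (v : TensorSpace fun j : Fin n => τ j) :
    siteLeft τ (i : ℕ) a (glueTail τ n t v) =
      glueTail τ n t (siteLeft (fun j : Fin n => τ j) i a v) :=
  siteOp_glueOp_of_lt (fun k => L2.norm_ofM_one (τ k)) n t i (L2.leftMul (τ i) a) v

theorem siteLeft_glueTail_of_not_lt {n : ℕ} (t : ElemTensor fun k => L2.ofM (τ k) 1) {i : ℕ}
    (hi : ¬ i < n) (a : (M i).toStarSubalgebra) (v : TensorSpace fun j : Fin n => τ j) :
    siteLeft τ i a (glueTail τ n t v) = glueTail τ n (setAt t i (L2.leftMul (τ i) a (t.1 i))) v :=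
  siteOp_glueOp_of_not_lt (fun k => L2.norm_ofM_one (τ k)) n t hi (L2.leftMul (τ i) a) v

variable {τ}

/-- Each left action of a factor `Mᵢ` acts on the first `n` factors or on the others. -/
theorem siteLeft_glueTail (n i : ℕ) (a : (M i).toStarSubalgebra) :
    (∃ g₀ ∈ tensorAlgebra (fun j : Fin n => τ j),
      ∀ t v, siteLeft τ i a (glueTail τ n t v) = glueTail τ n t (g₀ v)) ∨
    ∃ σ : (ElemTensor fun k => L2.ofM (τ k) 1) → ElemTensor fun k => L2.ofM (τ k) 1,
      ∀ t v, siteLeft τ i a (glueTail τ n t v) = glueTail τ n (σ t) v := by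
  by_cases hi : i < n
  · exact Or.inl ⟨siteLeft (fun j : Fin n => τ j) ⟨i, hi⟩ a, siteLeft_mem _ _ _, fun t v =>
      siteLeft_glueTail_of_lt τ t ⟨i, hi⟩ a v⟩
  · exact Or.inr ⟨_, fun t v => siteLeft_glueTail_of_not_lt τ t hi a v⟩

theorem amp_glueTail_mem_commutant {n : ℕ} {Γ} (hV : IsTensorFamily (glueTail τ n) Γ) :
    ∀ R ∈ (tensorAlgebra fun j : Fin n => τ j).commutant,
      hV.amp R ∈ (tensorAlgebra τ).commutant := by
  intro R hR
  rw [mem_commutant_tensorAlgebra]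
  intro i a
  exact hV.commute_amp (siteLeft_glueTail n i a) (VonNeumannAlgebra.mem_commutant_iff.1 hR)

theorem amp_glueTail_siteLeft {n : ℕ} {Γ} (hV : IsTensorFamily (glueTail τ n) Γ) (i : Fin n)
    (a : (M i).toStarSubalgebra) :
    hV.amp (siteLeft (fun j : Fin n => τ j) i a) = siteLeft τ (i : ℕ) a :=
  hV.amp_eq_of_apply fun t v => siteLeft_glueTail_of_lt τ t i a v

theorem amp_glueTail_mem {n : ℕ} {Γ} (hV : IsTensorFamily (glueTail τ n) Γ) :
    ∀ x ∈ tensorAlgebra (fun j : Fin n => τ j), hV.amp x ∈ tensorAlgebra τ := by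
  intro x hx
  rw [VonNeumannAlgebra.mem_iff_commute]
  intro y hy
  refine hV.commute_amp_of_commute_compression fun s t => ?_
  refine VonNeumannAlgebra.mem_commutant_iff.1 (mem_commutant_tensorAlgebra _ |>.2 ?_) x hx
  intro i a
  refine hV.commute_adjoint_comp ?_ s t
  rw [amp_glueTail_siteLeft hV]
  exact (mem_commutant_tensorAlgebra τ).1 hy i a

/-- A self-adjoint element of `⊗ₖ Mₖ` that almost commutes with a suitable finite set is close to
the relative commutant of the first `n` factors. -/
theorem exists_near_relCommutant (ht : ∀ k, (τ k).IsTracial) {n : ℕ} {C : ℝ}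
    (hC : IsSpectralGapNumber (tensorAlgebra fun j : Fin n => τ j)
      (tensorState fun j : Fin n => τ j) C) :
    ∃ G : Finset (tensorAlgebra τ).toStarSubalgebra, (∀ x ∈ G, ‖x‖ ≤ 1) ∧ (G.card : ℝ) ≤ C ∧
      ∀ δ : ℝ, 0 ≤ δ → ∀ p : (tensorAlgebra τ).toStarSubalgebra, IsSelfAdjoint p →
      (∀ x ∈ G, (tensorState τ).norm2 (x * p - p * x) ≤ δ) →
      ∃ b : (tensorAlgebra τ).toStarSubalgebra, IsSelfAdjoint b ∧ ‖b‖ ≤ ‖p‖ ∧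
        (∀ i < n, ∀ a : (M i).toStarSubalgebra, siteLeft τ i a *
          (b : TensorSpace τ →L[ℂ] TensorSpace τ) = b * siteLeft τ i a) ∧
        (tensorState τ).norm2 (b - p) ≤ 2 * (C * δ) := by
  refine (exists_isTensorFamily_glueTail τ n).elim fun Γ hV =>
    (hV.exists_near_commutant (hΩ := norm_vacuum τ) (amp_glueTail_mem hV)
      (amp_glueTail_mem_commutant hV) (glueTail_base_vacuum τ n)
      (dense_partnerVectors fun j : Fin n => ht j) (dense_partnerVectors ht) hC).imp fun G hG =>
    ⟨hG.1, hG.2.1, fun δ hδ p hp hpG => (hG.2.2 δ hδ p hp hpG).imp fun b hb =>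
      ⟨hb.1, hb.2.1, fun i hi a => ?_, hb.2.2.2⟩⟩
  have h1 := hb.2.2.1 _ (siteLeft_mem (fun j : Fin n => τ j) ⟨i, hi⟩ a)
  rw [amp_glueTail_siteLeft hV] at h1
  exact h1

end FinitePart

/-! ### A criterion for being uniformly super McDuff -/

section Criterion

variable {H : Type*} [NormedAddCommGroup H] [InnerProductSpace ℂ H] [CompleteSpace H]
  {N : VonNeumannAlgebra H} {Ω : H} {hΩ : ‖Ω‖ = 1}

/-- The relative commutant `N ∩ (S ∪ S*)'`. -/
def relCommutant (N : VonNeumannAlgebra H) (S : Set (H →L[ℂ] H)) : VonNeumannAlgebra H :=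
  (vonNeumannClosure ((N.commutant : Set (H →L[ℂ] H)) ∪ S)).commutant

theorem mem_relCommutant {S : Set (H →L[ℂ] H)} {x : H →L[ℂ] H} :
    x ∈ relCommutant N S ↔ x ∈ N ∧ ∀ g ∈ S, g * x = x * g ∧ star g * x = x * star g := by
  unfold relCommutant
  rw [mem_commutant_vonNeumannClosure]
  constructor
  · intro h
    exact ⟨VonNeumannAlgebra.mem_iff_commute.2 fun y hy => (h y (Or.inl hy)).1,
      fun g hg => h g (Or.inr hg)⟩
  · rintro ⟨h1, h2⟩ g (hg | hg)
    · exact ⟨VonNeumannAlgebra.mem_iff_commute.1 h1 g hg,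
        VonNeumannAlgebra.mem_iff_commute.1 h1 _ (star_mem hg)⟩
    · exact h2 g hg

/-- An infinite-dimensional subalgebra of a II₁ factor whose centre is central in the whole algebra
is a II₁ factor for the same vector state. -/
theorem isIIOneFactor_of_le (hN : IsIIOneFactor (vectorState N Ω hΩ)) {B : VonNeumannAlgebra H}
    (hB : ∀ x ∈ B, x ∈ N)
    (hz : ∀ z ∈ B, (∀ x ∈ B, z * x = x * z) → z ∈ N.commutant)
    (hinf : ¬ FiniteDimensional ℂ B.toStarSubalgebra) :
    IsIIOneFactor (vectorState B Ω hΩ) where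
  tracial x y := hN.tracial ⟨x, hB _ x.2⟩ ⟨y, hB _ y.2⟩
  faithful x hx :=
    have h1 := congrArg Subtype.val (hN.faithful ⟨x, hB _ x.2⟩ hx)
    Subtype.ext h1
  center z h := by
    have h1 := hz z z.2 fun x hx => congrArg Subtype.val (h ⟨x, hx⟩)
    obtain ⟨c, hc⟩ := hN.center ⟨z, hB _ z.2⟩ fun x =>
      Subtype.ext (VonNeumannAlgebra.mem_commutant_iff.1 h1 _ x.2).symm
    have h2 := congrArg Subtype.val hc
    exact ⟨c, Subtype.ext h2⟩
  infinite := hinf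

/-- Projections of equal trace that are close to a II₁ subfactor `B` are almost conjugate by a
unitary of `B`: round the approximants to projections of `B`, and compare these in `B`. -/
theorem exists_unitary_conj_of_near {B : VonNeumannAlgebra H} (hB : ∀ x ∈ B, x ∈ N)
    (hN : IsIIOneFactor (vectorState N Ω hΩ)) (hBf : IsIIOneFactor (vectorState B Ω hΩ)) {δ : ℝ}
    {p q : N.toStarSubalgebra} (hp : IsStarProjection p) (hq : IsStarProjection q)
    (hpq : vectorState N Ω hΩ p = vectorState N Ω hΩ q)
    (hpB : ∃ b : N.toStarSubalgebra, IsSelfAdjoint b ∧ ‖b‖ ≤ ‖p‖ ∧ (b : H →L[ℂ] H) ∈ B ∧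
      (vectorState N Ω hΩ).norm2 (b - p) ≤ δ)
    (hqB : ∃ b : N.toStarSubalgebra, IsSelfAdjoint b ∧ ‖b‖ ≤ ‖q‖ ∧ (b : H →L[ℂ] H) ∈ B ∧
      (vectorState N Ω hΩ).norm2 (b - q) ≤ δ) :
    ∃ u ∈ unitary N.toStarSubalgebra, (u : H →L[ℂ] H) ∈ B ∧
      (vectorState N Ω hΩ).norm2 (u * p * star u - q) ≤ 26 * δ + √(26 * δ) := by
  set τ := vectorState N Ω hΩ with hτ
  have hproj : ∀ p : N.toStarSubalgebra, IsStarProjection p →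
      (∃ b : N.toStarSubalgebra, IsSelfAdjoint b ∧ ‖b‖ ≤ ‖p‖ ∧ (b : H →L[ℂ] H) ∈ B ∧
        τ.norm2 (b - p) ≤ δ) →
      ∃ e : B.toStarSubalgebra, IsStarProjection e ∧ τ.norm2 (⟨e, hB _ e.2⟩ - p) ≤ 13 * δ := by
    rintro p hp ⟨b, hb, hbn, hbB, hbp⟩
    have hp1 : ‖p‖ ≤ 1 := hp.norm_le
    have h0 := congrArg Subtype.val hb.star_eq
    have h1 : IsSelfAdjoint (⟨b, hbB⟩ : B.toStarSubalgebra) := Subtype.ext h0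
    obtain ⟨e, he, hen⟩ := VonNeumannAlgebra.exists_isStarProjection_near (vectorState B Ω hΩ) h1
    refine ⟨e, he, ?_⟩
    have h2 : τ.norm2 (⟨e, hB _ e.2⟩ - b) ≤ 4 * τ.norm2 (b - b * b) := hen
    have h3 : b - b * b = (b - p) + ((p - b) * p + b * (p - b)) := by
      have : p * p = p := hp.isIdempotentElem
      rw [sub_mul, mul_sub, this]
      abel
    have h4 : τ.norm2 (b - b * b) ≤ 3 * δ := by
      have h5 := τ.norm2_add_le (b - p) ((p - b) * p + b * (p - b))
      have h6 := τ.norm2_add_le ((p - b) * p) (b * (p - b))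
      have h7 := hN.tracial.norm2_mul_le (p - b) p
      have h8 := τ.norm2_mul_le b (p - b)
      rw [τ.norm2_sub_comm p b] at h7 h8
      have h9 := mul_le_mul_of_nonneg_left hp1 (τ.norm2_nonneg (b - p))
      have h10 := mul_le_mul_of_nonneg_right (hbn.trans hp1) (τ.norm2_nonneg (b - p))
      rw [← h3] at h5
      linarith
    have h5 := τ.norm2_sub_le_add ⟨e, hB _ e.2⟩ b p
    linarith
  obtain ⟨e, he, hep⟩ := hproj p hp hpB
  obtain ⟨f, hf, hfq⟩ := hproj q hq hqB
  obtain ⟨u, hu, huef⟩ := hBf.exists_unitary_conj_near he hf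
  have hτef : ‖vectorState B Ω hΩ e - vectorState B Ω hΩ f‖ ≤ 26 * δ := by
    have h1 : vectorState B Ω hΩ e - vectorState B Ω hΩ f =
        τ (⟨e, hB _ e.2⟩ - p) - τ (⟨f, hB _ f.2⟩ - q) := by
      rw [map_sub, map_sub, hpq]
      change _ = vectorState B Ω hΩ e - _ - (vectorState B Ω hΩ f - _)
      ring
    rw [h1]
    have h2 := norm_sub_le (τ (⟨e, hB _ e.2⟩ - p)) (τ (⟨f, hB _ f.2⟩ - q))
    have h3 := τ.norm_apply_le (⟨e, hB _ e.2⟩ - p)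
    have h4 := τ.norm_apply_le (⟨f, hB _ f.2⟩ - q)
    linarith
  set e' : N.toStarSubalgebra := ⟨e, hB _ e.2⟩ with he'
  set f' : N.toStarSubalgebra := ⟨f, hB _ f.2⟩ with hf'
  set u' : N.toStarSubalgebra := ⟨u, hB _ u.2⟩ with hu'
  have hu'u : u' ∈ unitary N.toStarSubalgebra := by
    rw [Unitary.mem_iff] at hu ⊢
    have h1 := congrArg Subtype.val hu.1
    have h2 := congrArg Subtype.val hu.2
    exact ⟨Subtype.ext h1, Subtype.ext h2⟩
  have h1 : τ.norm2 (u' * e' * star u' - f') ≤ √(26 * δ) := by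
    refine Real.le_sqrt_of_sq_le (le_trans ?_ hτef)
    exact huef
  have h2 : τ.norm2 (u' * p * star u' - u' * e' * star u') ≤ 13 * δ := by
    rw [← sub_mul, ← mul_sub, hN.tracial.norm2_mul_unitary (Unitary.star_mem hu'u),
      NormalState.norm2_unitary_mul hu'u, τ.norm2_sub_comm]
    exact hep
  refine ⟨u', hu'u, u.2, ?_⟩
  have h3 := τ.norm2_sub_le_add (u' * p * star u') (u' * e' * star u') q
  have h4 := τ.norm2_sub_le_add (u' * e' * star u') f' q
  linarith

/-- An element that almost equals one that commutes with `u` almost commutes with `u`. -/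
theorem norm2_commutator_le (hN : IsIIOneFactor (vectorState N Ω hΩ)) {x a u : N.toStarSubalgebra}
    (hu : ‖u‖ ≤ 1) (h : a * u = u * a) :
    (vectorState N Ω hΩ).norm2 (x * u - u * x) ≤ 2 * (vectorState N Ω hΩ).norm2 (x - a) := by
  set τ := vectorState N Ω hΩ
  have h1 : x * u - u * x = (x - a) * u - u * (x - a) := by
    rw [sub_mul, mul_sub, h]
    abel
  have h2 := τ.norm2_sub_le ((x - a) * u) (u * (x - a))
  have h3 := hN.tracial.norm2_mul_le (x - a) u
  have h4 := τ.norm2_mul_le u (x - a)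
  have h5 := mul_le_mul_of_nonneg_left hu (τ.norm2_nonneg (x - a))
  have h6 := mul_le_mul_of_nonneg_right hu (τ.norm2_nonneg (x - a))
  rw [h1]
  linarith

/-- A II₁ factor `N` is uniformly super McDuff if every finite subset almost commutes with a II₁
subfactor `B` such that almost commuting with a finite set, of size bounded by a constant `C`,
forces closeness to `B`, with a bound that depends only on `C`. -/
theorem isUniformlySuperMcDuff_of_subfactors (hN : IsIIOneFactor (vectorState N Ω hΩ)) {C : ℝ}
    (hC : 0 < C)
    (h : ∀ (F : Finset N.toStarSubalgebra) (ε : ℝ), 0 < ε → ∃ B : VonNeumannAlgebra H,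
      (∀ x ∈ B, x ∈ N) ∧ IsIIOneFactor (vectorState B Ω hΩ) ∧
      (∀ x ∈ F, ∃ a : N.toStarSubalgebra, (vectorState N Ω hΩ).norm2 (x - a) < ε ∧
        ∀ b ∈ B, (a : H →L[ℂ] H) * b = b * a) ∧
      ∃ G : Finset N.toStarSubalgebra, (∀ x ∈ G, ‖x‖ ≤ 1) ∧ (G.card : ℝ) ≤ C ∧
        ∀ δ : ℝ, 0 ≤ δ → ∀ p : N.toStarSubalgebra, IsSelfAdjoint p →
        (∀ x ∈ G, (vectorState N Ω hΩ).norm2 (x * p - p * x) ≤ δ) →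
        ∃ b : N.toStarSubalgebra, IsSelfAdjoint b ∧ ‖b‖ ≤ ‖p‖ ∧ (b : H →L[ℂ] H) ∈ B ∧
          (vectorState N Ω hΩ).norm2 (b - p) ≤ 2 * (C * δ)) :
    IsUniformlySuperMcDuff (vectorState N Ω hΩ) := by
  refine ⟨⟨hN, fun F ε hε => ?_⟩, fun n hn => ?_⟩
  · obtain ⟨B, hBN, hB, hF, -⟩ := h F (ε / 2) (by linarith)
    obtain ⟨y, hy1, hy2⟩ := hB.exists_matrixUnit
    have e1 := congrArg Subtype.val hy1
    have e2 := congrArg Subtype.val hy2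
    have hyN : (⟨y, hBN _ y.2⟩ : N.toStarSubalgebra) * ⟨y, hBN _ y.2⟩ = 0 := Subtype.ext e1
    have hyN2 : star (⟨y, hBN _ y.2⟩ : N.toStarSubalgebra) * ⟨y, hBN _ y.2⟩ +
        ⟨y, hBN _ y.2⟩ * star (⟨y, hBN _ y.2⟩ : N.toStarSubalgebra) = 1 := Subtype.ext e2
    refine ⟨⟨y, hBN _ y.2⟩, hyN, hyN2, fun x hx => ?_⟩
    obtain ⟨a, ha, hab⟩ := hF x hx
    have hy : ‖(⟨y, hBN _ y.2⟩ : N.toStarSubalgebra)‖ ≤ 1 := by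
      refine NormalState.norm_partialIsometry_le ?_
      calc _ = (⟨y, hBN _ y.2⟩ : N.toStarSubalgebra) * (star ⟨y, hBN _ y.2⟩ * ⟨y, hBN _ y.2⟩ +
            ⟨y, hBN _ y.2⟩ * star ⟨y, hBN _ y.2⟩) := by
            rw [mul_add, ← mul_assoc, ← mul_assoc, hyN, zero_mul, add_zero]
        _ = _ := by rw [hyN2, mul_one]
    have := norm2_commutator_le hN (x := x) hy (Subtype.ext (hab y y.2))
    linarith
  · have hn' : (1 : ℝ) ≤ n := by exact_mod_cast hn
    obtain ⟨m, hm⟩ := exists_nat_gt (208 * C * n ^ 2)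
    have hmC : C ≤ m := by nlinarith [mul_le_mul_of_nonneg_left (one_le_pow₀ hn' (n := 2)) hC.le]
    have hm0 : (0 : ℝ) < m := hC.trans_le hmC
    refine ⟨m, by exact_mod_cast hm0, fun F _ _ => ?_⟩
    obtain ⟨B, hBN, hB, hF, G, hG1, hGC, hG⟩ := h F (1 / (2 * n)) (by positivity)
    refine ⟨G, hG1, by exact_mod_cast hGC.trans hmC, fun p q hpq hcomm => ?_⟩
    obtain ⟨hp, hq, htr⟩ := hpq
    obtain ⟨u, hu, huB, hupq⟩ := exists_unitary_conj_of_near hBN hN hB hp hq htr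
      (hG (1 / m) (by positivity) p hp.isSelfAdjoint fun x hx => (hcomm x hx).1.le)
      (hG (1 / m) (by positivity) q hq.isSelfAdjoint fun x hx => (hcomm x hx).2.le)
    refine ⟨u, hu, hupq.trans_lt ?_, fun x hx => ?_⟩
    · -- the choice of `m` makes `26 δ` smaller than `1 / (2 n) ^ 2`, for `δ = 2 C / m`
      have h1 : 26 * (2 * (C * (1 / (m : ℝ)))) < (1 / (2 * n)) ^ 2 := by
        rw [div_pow, one_pow, lt_div_iff₀ (by positivity)]
        have : 26 * (2 * (C * (1 / (m : ℝ)))) * (2 * n) ^ 2 = 208 * C * n ^ 2 / m := by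
          field_simp
          ring
        rwa [this, div_lt_one hm0]
      have h2 : √(26 * (2 * (C * (1 / (m : ℝ))))) < 1 / (2 * n) :=
        (Real.sqrt_lt' (by positivity)).2 h1
      have h3 : (1 / (2 * n : ℝ)) ^ 2 ≤ 1 / (2 * n) := by
        refine pow_le_of_le_one (by positivity) ?_ two_ne_zero
        rw [div_le_one (by positivity)]
        linarith
      have h4 : 1 / (2 * n : ℝ) + 1 / (2 * n) = 1 / n := by
        field_simp
        norm_num
      linarith
    · obtain ⟨a, ha, hab⟩ := hF x hx
      have h1 := norm2_commutator_le hN (x := x) (NormalState.unitary_norm_le u hu)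
        (Subtype.ext (hab u huB))
      have h4 : 2 * (1 / (2 * n : ℝ)) = 1 / n := by
        field_simp
      linarith

end Criterion

/-! ### The relative commutants of the finite partial tensor products -/

section Tail

variable {K : ℕ → Type*} [∀ k, NormedAddCommGroup (K k)] [∀ k, InnerProductSpace ℂ (K k)]
  [∀ k, CompleteSpace (K k)] {M : ∀ k, VonNeumannAlgebra (K k)} (τ : ∀ k, NormalState (M k))

/-- The relative commutant in `⊗ₖ Mₖ` of the factors `Mᵢ` with `i < n`. -/
def tailAlgebra (n : ℕ) : VonNeumannAlgebra (TensorSpace τ) :=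
  relCommutant (tensorAlgebra τ) {T | ∃ i < n, ∃ a, T = siteLeft τ i a}

variable {τ}

theorem mem_tailAlgebra {n : ℕ} {x : TensorSpace τ →L[ℂ] TensorSpace τ} :
    x ∈ tailAlgebra τ n ↔ x ∈ tensorAlgebra τ ∧
      ∀ i < n, ∀ a, siteLeft τ i a * x = x * siteLeft τ i a := by
  unfold tailAlgebra
  rw [mem_relCommutant]
  refine and_congr_right fun _ => ⟨fun h i hi a => (h _ ⟨i, hi, a, rfl⟩).1, ?_⟩
  rintro h _ ⟨i, hi, a, rfl⟩
  rw [star_siteLeft]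
  exact ⟨h i hi a, h i hi _⟩

theorem tailAlgebra_anti {m n : ℕ} (h : m ≤ n) {x : TensorSpace τ →L[ℂ] TensorSpace τ}
    (hx : x ∈ tailAlgebra τ n) : x ∈ tailAlgebra τ m := by
  rw [mem_tailAlgebra] at hx ⊢
  exact ⟨hx.1, fun i hi => hx.2 i (hi.trans_le h)⟩

theorem siteLeft_mem_tailAlgebra {n i : ℕ} (h : n ≤ i) (a : (M i).toStarSubalgebra) :
    siteLeft τ i a ∈ tailAlgebra τ n := by
  rw [mem_tailAlgebra]
  exact ⟨siteLeft_mem τ i a, fun j hj b => commute_siteLeft τ (hj.trans_le h).ne b a⟩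

theorem isIIOneFactor_tailAlgebra (hM : ∀ k, IsIIOneFactor (τ k)) (n : ℕ) :
    IsIIOneFactor (vectorState (tailAlgebra τ n) (vacuum τ) (norm_vacuum τ)) := by
  refine isIIOneFactor_of_le (isIIOneFactor_tensorState hM) (fun x hx => (mem_tailAlgebra.1 hx).1)
    (fun z hz hzc => ?_)
    (not_finiteDimensional_of_siteLeft_mem (hM n) _ fun a => siteLeft_mem_tailAlgebra le_rfl a)
  rw [mem_commutant_tensorAlgebra]
  intro i a
  rcases lt_or_ge i n with hi | hi
  · exact (mem_tailAlgebra.1 hz).2 i hi a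
  · exact (hzc _ (siteLeft_mem_tailAlgebra hi a)).symm

variable (τ) in
/-- The vectors `a (⊗ₖ 1)`, where `a ∈ ⊗ₖ Mₖ` commutes with one of the tail algebras. -/
def headVectors : Submodule ℂ (TensorSpace τ) where
  carrier := {v | ∃ n, ∃ a ∈ tensorAlgebra τ, (∀ b ∈ tailAlgebra τ n, a * b = b * a) ∧
    v = a (vacuum τ)}
  add_mem' := by
    rintro _ _ ⟨m, a, ha, ha', rfl⟩ ⟨n, c, hc, hc', rfl⟩
    refine ⟨max m n, a + c, add_mem ha hc, fun b hb => ?_, rfl⟩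
    rw [add_mul, mul_add, ha' b (tailAlgebra_anti (le_max_left _ _) hb),
      hc' b (tailAlgebra_anti (le_max_right _ _) hb)]
  zero_mem' := ⟨0, 0, zero_mem _, fun b _ => by rw [zero_mul, mul_zero], rfl⟩
  smul_mem' := by
    rintro c _ ⟨n, a, ha, ha', rfl⟩
    refine ⟨n, c • a, (tensorAlgebra τ).toStarSubalgebra.smul_mem ha c, fun b hb => ?_, rfl⟩
    rw [smul_mul_assoc, mul_smul_comm, ha' b hb]

theorem dense_headVectors : Dense (headVectors τ : Set (TensorSpace τ)) := by
  refine dense_of_invariant τ _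
    ⟨0, 1, one_mem _, fun b _ => by rw [one_mul, mul_one], rfl⟩ ?_
  rintro i a _ ⟨n, c, hc, hc', rfl⟩
  refine ⟨max (i + 1) n, siteLeft τ i a * c, mul_mem (siteLeft_mem τ i a) hc, fun b hb => ?_, rfl⟩
  rw [mul_assoc, hc' b (tailAlgebra_anti (le_max_right _ _) hb), ← mul_assoc,
    (mem_tailAlgebra.1 (tailAlgebra_anti (le_max_left _ _) hb)).2 i (Nat.lt_succ_self i) a,
    mul_assoc]

/-- Finite subsets of `⊗ₖ Mₖ` are approximated in the 2-norm by elements that commute with one of the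
tail algebras. -/
theorem exists_near_commute_tailAlgebra (F : Finset (tensorAlgebra τ).toStarSubalgebra) {ε : ℝ}
    (hε : 0 < ε) :
    ∃ n, ∀ x ∈ F, ∃ a : (tensorAlgebra τ).toStarSubalgebra, (tensorState τ).norm2 (x - a) < ε ∧
      ∀ b ∈ tailAlgebra τ n, (a : TensorSpace τ →L[ℂ] TensorSpace τ) * b = b * a := by
  have h1 : ∀ x : (tensorAlgebra τ).toStarSubalgebra, ∃ n, ∃ a : (tensorAlgebra τ).toStarSubalgebra,
      (tensorState τ).norm2 (x - a) < ε ∧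
        ∀ b ∈ tailAlgebra τ n, (a : TensorSpace τ →L[ℂ] TensorSpace τ) * b = b * a := by
    intro x
    obtain ⟨_, hv, n, a, ha, ha', rfl⟩ := Metric.dense_iff.1 (dense_headVectors (τ := τ))
      ((x : TensorSpace τ →L[ℂ] TensorSpace τ) (vacuum τ)) ε hε
    refine ⟨n, ⟨a, ha⟩, ?_, ha'⟩
    rw [norm2_tensorState]
    rw [mem_ball_iff_norm'] at hv
    exact hv
  choose N hN using h1
  refine ⟨F.sup N, fun x hx => ?_⟩
  obtain ⟨a, ha, hab⟩ := hN x
  exact ⟨a, ha, fun b hb => hab b (tailAlgebra_anti (Finset.le_sup hx) hb)⟩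

set_option maxHeartbeats 800000 in
/-- If the spectral gap numbers of `M₀ ⊗ ⋯ ⊗ Mₖ` are bounded by `C`, uniformly in `k`, then `⊗ₖ Mₖ`
is uniformly super McDuff. -/
theorem isUniformlySuperMcDuff_tensorState (hM : ∀ k, IsIIOneFactor (τ k)) {C : ℝ} (hC : 0 < C)
    (h : ∀ k : ℕ, ∃ c ≤ C, IsSpectralGapNumber (tensorAlgebra fun j : Fin (k + 1) => τ j)
      (tensorState fun j : Fin (k + 1) => τ j) c) :
    IsUniformlySuperMcDuff (tensorState τ) := by
  rw [tensorState_eq]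
  refine isUniformlySuperMcDuff_of_subfactors (hΩ := norm_vacuum τ)
    (isIIOneFactor_tensorState hM) hC fun F ε hε => ?_
  obtain ⟨n, hn⟩ := exists_near_commute_tailAlgebra F hε
  refine (h n).elim fun c hc => (exists_near_relCommutant (fun k => (hM k).tracial) hc.2).elim
    fun G hG => ?_
  refine ⟨tailAlgebra τ (n + 1), fun x hx => (mem_tailAlgebra.1 hx).1,
    isIIOneFactor_tailAlgebra hM _, fun x hx => ?_, G, hG.1, hG.2.1.trans hc.1,
    fun δ hδ p hp hpG => ?_⟩
  · obtain ⟨a, ha, hab⟩ := hn x hx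
    exact ⟨a, ha, fun b hb => hab b (tailAlgebra_anti n.le_succ hb)⟩
  · refine (hG.2.2 δ hδ p hp hpG).imp fun b hb => ⟨hb.1, hb.2.1, mem_tailAlgebra.2 ⟨b.2, hb.2.2.1⟩,
      hb.2.2.2.trans ?_⟩
    gcongr
    exact hc.1

end Tail

/-- A finite upper bound for `SG(M)` bounds one of the spectral gap numbers. -/
theorem exists_isSpectralGapNumber_of_SG_lt {K : Type*} [NormedAddCommGroup K]
    [InnerProductSpace ℂ K] [CompleteSpace K] {M : VonNeumannAlgebra K} {τ : NormalState M} {C : ℝ}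
    (h : SG τ < ENNReal.ofReal C) : ∃ c ≤ C, IsSpectralGapNumber M τ c := by
  unfold SG relSG at h
  obtain ⟨_, ⟨c, hc, rfl⟩, hlt⟩ := sInf_lt_iff.1 h
  exact ⟨c, (ENNReal.ofReal_lt_ofReal_iff'.1 hlt).1.le, hc⟩
theorem exists_ofReal_gt_of_iSup_lt_top {f : ℕ → ENNReal} (h : ⨆ k, f k < ⊤) :
    ∃ C : ℝ, 0 < C ∧ ∀ k, f k < ENNReal.ofReal C :=
  ⟨(⨆ k, f k).toReal + 1, by positivity, fun k =>
    (le_iSup f k).trans_lt ((ENNReal.lt_ofReal_iff_toReal_lt h.ne).2 (lt_add_one _))⟩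

end

theorem mainTheorem11 {K : ℕ → Type*} [∀ k, NormedAddCommGroup (K k)]
    [∀ k, InnerProductSpace ℂ (K k)] [∀ k, CompleteSpace (K k)]
    (M : ∀ k, VonNeumannAlgebra (K k)) (τ : ∀ k, NormalState (M k))
    (hM : ∀ k, IsIIOneFactor (τ k)) (hfull : ∀ k, IsFull (τ k))
    (hSG : ⨆ k : ℕ, SG (tensorState fun j : Fin (k + 1) => τ j) < ⊤) :
    IsUniformlySuperMcDuff (tensorState τ) := by
  exact (exists_ofReal_gt_of_iSup_lt_top hSG).elim fun _ hC =>
    isUniformlySuperMcDuff_tensorState hM hC.1 fun k =>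
      exists_isSpectralGapNumber_of_SG_lt (hC.2 k)
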